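/- All superalgebras are finite-dimensional over $\mathbb{C}$; ideals, isomorphisms and direct sums are graded. A Leibniz superalgebra is a $\mathbb{Z}_2$-graded space $L=L_0\oplus L_1$ with a bilinear product, additive on parities, such that $[x,[y,z]]=[[x,y],z]-(-1)^{\alpha\beta}[[x,z],y]$ for all $x\in L$, $y\in L_\alpha$, $z\in L_\beta$. Its nilradical is a maximal nilpotent ideal containing $[L,L]$. A superalgebra is split if it is the direct sum of two nonzero ideals. Let $n\ge 3$. For $\beta_4,\dots,\beta_n,\gamma\in\mathbb{C}$ let $G(\beta_4,\dots,\beta_n,\gamma)$ be the superalgebra with even basis $e_1,\dots,e_n$, odd basis $y_1,\dots,y_{n-1}$ and the products (products not listed are zero, as are basis elements with an index out of range) $$\begin{array}{ll} [e_1,e_1]=e_3,\quad [e_i,e_1]=e_{i+1}\ (3\le i\le n-1), & [y_j,e_1]=y_{j+1}\ (1\le j\le n-2),\\ [e_1,y_1]=\tfrac12 y_2,\quad [e_i,y_1]=\tfrac12 y_i\ (3\le i\le n-1), & [y_1,y_1]=e_1,\quad [y_j,y_1]=e_{j+1}\ (2\le j\le n-1),\\ [e_1,e_2]=\sum_{k=4}^{n}\beta_k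 e_k,\quad [e_2,e_2]=\gamma e_n, & [e_j,e_2]=\sum_{k=4}^{n+2-j}\beta_k e_{j+k-2}\ (3\le j\le n-2),\\ [y_j,e_2]=\sum_{k=4}^{n+1-j}\beta_k y_{j+k-2}\ (1\le j\le n-3). & \end{array}$$ For $b\in\mathbb{C}$ let $\widehat G(\beta_4,\dots,\beta_n,\gamma;b)$ be the superalgebra with one more even basis element $x$, the products above, and $$\begin{array}{l} [e_1,x]=2e_1,\quad [e_2,x]=b\,e_2,\quad [e_i,x]=2(i-1)e_i\ (3\le i\le n),\quad [y_i,x]=(2i-1)y_i\ (1\le i\le n-1),\\ [x,e_1]=-2e_1,\quad [x,e_2]=-b\,e_2-2\sum_{k=4}^{n}\beta_k e_{k-1},\quad [x,y_1]=-y_1. \end{array}$$ Define - $SG_1(t)$, for $4\le t\le n$: $\widehat G$ with $\beta_t=1$, all other $\beta_k=0$, $\gamma=0$, $b=2(t-2)$; - $SG_2(\gamma)$, for $n\ge 5$ odd and $\gamma\ne 0$: $\widehat G$ with $\beta_{(n+3)/2}=1$, all other $\beta_k=0$, the given $\gamma$, and $b=n-1$; - $SG_3$: $\widehat G$ with all $\beta_k=0$,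 $\gamma=1$, $b=n-1$. **Theorem.** Let $L$ be a non-nilpotent solvable Leibniz superalgebra whose nilradical is isomorphic to a non-split superalgebra $G(\beta_4,\dots,\beta_n,\gamma)$. Then $L$ is isomorphic to one of $SG_1(t)$ ($4\le t\le n$), $SG_2(\gamma')$ ($n\geq 5$ odd, $\gamma'\ne0$), $SG_3$. These are Leibniz superalgebras, and they are pairwise non-isomorphic (different families, or different parameter values in one family, give non-isomorphic superalgebras). -/

import Mathlib

/-! Complex superalgebras and Leibniz superalgebras. -/

/-- A (not necessarily associative) complex superalgebra structure on the vector space `V`: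
a decomposition `V = V₀ ⊕ V₁` into an even and an odd part and a bilinear product
`[x, y] = mul x y` which is additive on parities. -/
structure Superalgebra (V : Type*) [AddCommGroup V] [Module ℂ V] where
  /-- the homogeneous parts `V₀` and `V₁` -/
  part : ZMod 2 → Submodule ℂ V
  isCompl_part : IsCompl (part 0) (part 1)
  /-- the product `[x, y]` -/
  mul : V →ₗ[ℂ] V →ₗ[ℂ] V
  mul_mem : ∀ {a b : ZMod 2} {x y : V}, x ∈ part a → y ∈ part b → mul x y ∈ part (a + b)

namespace Superalgebra

variable {V W : Type*} [AddCommGroup V] [Module ℂ V] [AddCommGroup W] [Module ℂ W]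

/-- The Leibniz superidentity
`[x, [y, z]] = [[x, y], z] - (-1) ^ (a b) [[x, z], y]`
for all `x` and all homogeneous `y`, `z` of parities `a`, `b`. -/
def IsLeibniz (A : Superalgebra V) : Prop :=
  ∀ (a b : ZMod 2) (x y z : V), y ∈ A.part a → z ∈ A.part b →
    A.mul x (A.mul y z) =
      A.mul (A.mul x y) z - (-1 : ℂ) ^ (a.val * b.val) • A.mul (A.mul x z) y

/-- The span `[I, J]` of all products of an element of `I` with an element of `J`. -/
def bracket (A : Superalgebra V) (I J : Submodule ℂ V) : Submodule ℂ V :=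
  Submodule.map₂ A.mul I J

/-- A (two-sided, graded) ideal of a superalgebra. -/
structure IsIdeal (A : Superalgebra V) (I : Submodule ℂ V) : Prop where
  graded : I = (I ⊓ A.part 0) ⊔ (I ⊓ A.part 1)
  mul_left : ∀ x y : V, y ∈ I → A.mul x y ∈ I
  mul_right : ∀ x y : V, x ∈ I → A.mul x y ∈ I

/-- The lower central series of a subalgebra `I` (with the index shifted by one):
`I, [I, I], [[I, I], I], …`. -/
def lowerSeries (A : Superalgebra V) (I : Submodule ℂ V) : ℕ → Submodule ℂ V
  | 0 => I
  | k + 1 => A.bracket (A.lowerSeries I k) I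

/-- The subalgebra `I` is nilpotent. The superalgebra itself is the case `I = ⊤`. -/
def IsNilpotent (A : Superalgebra V) (I : Submodule ℂ V) : Prop :=
  ∃ k : ℕ, A.lowerSeries I k = ⊥

/-- The derived series `V, [V, V], [[V, V], [V, V]], …`. -/
def derivedSeries (A : Superalgebra V) : ℕ → Submodule ℂ V
  | 0 => ⊤
  | k + 1 => A.bracket (A.derivedSeries k) (A.derivedSeries k)

/-- The superalgebra is solvable. -/
def IsSolvable (A : Superalgebra V) : Prop :=
  ∃ k : ℕ, A.derivedSeries k = ⊥

/-- `N` is a nilradical: a maximal nilpotent ideal which contains `[V, V]`. -/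
structure IsNilradical (A : Superalgebra V) (N : Submodule ℂ V) : Prop where
  isIdeal : A.IsIdeal N
  isNilpotent : A.IsNilpotent N
  bracket_le : A.bracket ⊤ ⊤ ≤ N
  maximal : ∀ I : Submodule ℂ V, A.IsIdeal I → A.IsNilpotent I → N ≤ I → I = N

/-- The superalgebra is split: it is the direct sum of two nonzero ideals. -/
def IsSplit (A : Superalgebra V) : Prop :=
  ∃ I J : Submodule ℂ V, A.IsIdeal I ∧ A.IsIdeal J ∧ I ≠ ⊥ ∧ J ≠ ⊥ ∧ IsCompl I J

/-- `A` and `B` are isomorphic: there is a parity-preserving linear bijection which is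
multiplicative. -/
def Isomorphic (A : Superalgebra V) (B : Superalgebra W) : Prop :=
  ∃ f : V ≃ₗ[ℂ] W, (∀ (a : ZMod 2) (x : V), x ∈ A.part a → f x ∈ B.part a) ∧
    ∀ x y : V, f (A.mul x y) = B.mul (f x) (f y)

/-- The ideal `N` of `A`, with the induced product and parity, is isomorphic to `B`: there is a
parity-preserving multiplicative linear bijection from `B` onto `N`. -/
def IdealIsomorphic (A : Superalgebra V) (N : Submodule ℂ V) (B : Superalgebra W) : Prop :=
  ∃ f : W ≃ₗ[ℂ] N, (∀ (a : ZMod 2) (x : W), x ∈ B.part a → (f x : V) ∈ A.part a) ∧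
    ∀ x y : W, (f (B.mul x y) : V) = A.mul (f x) (f y)

end Superalgebra

/-! Superalgebras given by multiplication tables in a basis made of even elements `e i`, odd
elements `y j` and possibly one more even element `x`. -/

/-- Names of basis elements. -/
inductive Gen : Type
  | e (i : ℕ)
  | y (j : ℕ)
  | x

/-- The `e i` and `x` are even, the `y j` are odd. -/
def Gen.parity : Gen → ZMod 2
  | .e _ => 0
  | .y _ => 1
  | .x => 0

/-- The names `e 1, …, e n, y 1, …, y (n - 1)`. -/
def nilGens (n : ℕ) : Set Gen :=
  {g | (∃ i, 1 ≤ i ∧ i ≤ n ∧ g = .e i) ∨ (∃ j, 1 ≤ j ∧ j + 1 ≤ n ∧ g = .y j)}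

/-- The names `e 1, …, e n, x, y 1, …, y (n - 1)`. -/
def solvGens (n : ℕ) : Set Gen := insert .x (nilGens n)

/-- The complex vector space with basis `S`. -/
abbrev Space (S : Set Gen) : Type := S →₀ ℂ

open Classical in
/-- The basis vector with the given name; it is `0` if the name does not belong to `S`
(basis elements with an index out of range are read as zero). -/
noncomputable def vec (S : Set Gen) (g : Gen) : Space S :=
  if h : g ∈ S then Finsupp.single ⟨g, h⟩ 1 else 0

/-- The span of the basis vectors of parity `a`. -/
def spacePart (S : Set Gen) (a : ZMod 2) : Submodule ℂ (Space S) :=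
  Finsupp.supported ℂ ℂ {s : S | s.1.parity = a}

/-- The superalgebra with basis `S` in which `[g, h] = T g h` for basis elements `g`, `h`. -/
noncomputable def ofTable (S : Set Gen) (T : Gen → Gen → Space S)
    (hT : ∀ g h, T g h ∈ spacePart S (g.parity + h.parity)) : Superalgebra (Space S) where
  part := spacePart S
  isCompl_part := by
    refine ⟨Finsupp.disjoint_supported_supported ?_, Finsupp.codisjoint_supported_supported ?_⟩
    · rw [Set.disjoint_left]
      intro s h0 h1
      have h2 : (0 : ZMod 2) = 1 := Eq.trans (Eq.symm h0) h1
      exact absurd h2 (by decide)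
    · rw [codisjoint_iff_le_sup]
      rintro ⟨g, hg⟩ -
      cases g
      · exact Or.inl rfl
      · exact Or.inr rfl
      · exact Or.inl rfl
  mul := Finsupp.linearCombination ℂ fun g : S =>
    Finsupp.linearCombination ℂ fun h : S => T g.1 h.1
  mul_mem := by
    intro a b u v hu hv
    rw [Finsupp.linearCombination_apply, Finsupp.sum, LinearMap.sum_apply]
    refine Submodule.sum_mem _ fun g hg => ?_
    rw [LinearMap.smul_apply]
    refine Submodule.smul_mem _ _ ?_
    rw [Finsupp.linearCombination_apply, Finsupp.sum]
    refine Submodule.sum_mem _ fun h hh => Submodule.smul_mem _ _ ?_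
    have h1 : g.1.parity = a := (Finsupp.mem_supported ℂ u).1 hu hg
    have h2 : h.1.parity = b := (Finsupp.mem_supported ℂ v).1 hv hh
    rw [← h1, ← h2]
    exact hT _ _

theorem vec_mem_spacePart {S : Set Gen} {g : Gen} {a : ZMod 2} (h : g.parity = a) :
    vec S g ∈ spacePart S a := by
  unfold vec
  split_ifs with hg
  · exact Finsupp.single_mem_supported ℂ 1 h
  · exact Submodule.zero_mem _

theorem ite_mem_spacePart {S : Set Gen} {a : ZMod 2} {p : Prop} [Decidable p] {v : Space S}
    (h : v ∈ spacePart S a) : (if p then v else 0) ∈ spacePart S a := by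
  split_ifs
  · exact h
  · exact Submodule.zero_mem _

/-- The multiplication table of `G(β₄, …, βₙ, γ)` (in a space that has at least the basis
elements `e 1, …, e n, y 1, …, y (n - 1)`):
* `[e 1, e 1] = e 3`, `[e i, e 1] = e (i + 1)` for `3 ≤ i ≤ n - 1`,
* `[e 1, e 2] = ∑_{k = 4}^{n} β k • e k`,
* `[e i, e 2] = ∑_{k = 4}^{n + 2 - i} β k • e (i + k - 2)` for `3 ≤ i ≤ n - 2`,
* `[e 2, e 2] = γ • e n`,
* `[y i, e 1] = y (i + 1)` for `1 ≤ i ≤ n - 2`,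
* `[y i, e 2] = ∑_{k = 4}^{n + 1 - i} β k • y (i + k - 2)` for `1 ≤ i ≤ n - 3`,
* `[e 1, y 1] = 1/2 • y 2`, `[e i, y 1] = 1/2 • y i` for `3 ≤ i ≤ n - 1`,
* `[y 1, y 1] = e 1`, `[y i, y 1] = e (i + 1)` for `2 ≤ i ≤ n - 1`,

and all other products of basis elements are zero. -/
noncomputable def gTable (S : Set Gen) (n : ℕ) (β : ℕ → ℂ) (γ : ℂ) : Gen → Gen → Space S
  | .e i, .e j =>
      (if i = 1 ∧ j = 1 then vec S (.e 3) else 0)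
      + (if 3 ≤ i ∧ i + 1 ≤ n ∧ j = 1 then vec S (.e (i + 1)) else 0)
      + (if i = 1 ∧ j = 2 then ∑ k ∈ Finset.Icc 4 n, β k • vec S (.e k) else 0)
      + (if 3 ≤ i ∧ i + 2 ≤ n ∧ j = 2 then
          ∑ k ∈ Finset.Icc 4 (n + 2 - i), β k • vec S (.e (i + k - 2)) else 0)
      + (if i = 2 ∧ j = 2 then γ • vec S (.e n) else 0)
  | .y i, .e j =>
      (if 1 ≤ i ∧ i + 2 ≤ n ∧ j = 1 then vec S (.y (i + 1)) else 0)
      + (if 1 ≤ i ∧ i + 3 ≤ n ∧ j = 2 then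
          ∑ k ∈ Finset.Icc 4 (n + 1 - i), β k • vec S (.y (i + k - 2)) else 0)
  | .e i, .y j =>
      (if i = 1 ∧ j = 1 then (1 / 2 : ℂ) • vec S (.y 2) else 0)
      + (if 3 ≤ i ∧ i + 1 ≤ n ∧ j = 1 then (1 / 2 : ℂ) • vec S (.y i) else 0)
  | .y i, .y j =>
      (if i = 1 ∧ j = 1 then vec S (.e 1) else 0)
      + (if 2 ≤ i ∧ i + 1 ≤ n ∧ j = 1 then vec S (.e (i + 1)) else 0)
  | .x, _ => 0
  | .e _, .x => 0
  | .y _, .x => 0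

/-- The products that involve `x`, for a scalar `b`:
* `[e 1, x] = 2 • e 1`, `[e 2, x] = b • e 2`, `[e i, x] = 2 (i - 1) • e i` for `3 ≤ i ≤ n`,
* `[y i, x] = (2 i - 1) • y i` for `1 ≤ i ≤ n - 1`,
* `[x, e 1] = - 2 • e 1`, `[x, e 2] = - b • e 2 - 2 • ∑_{k = 4}^{n} β k • e (k - 1)`,
* `[x, y 1] = - y 1`,

and all other products that involve `x` are zero. -/
noncomputable def xTable (S : Set Gen) (n : ℕ) (β : ℕ → ℂ) (b : ℂ) : Gen → Gen → Space S
  | .e i, .x =>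
      (if i = 1 then (2 : ℂ) • vec S (.e 1) else 0)
      + (if i = 2 then b • vec S (.e 2) else 0)
      + (if 3 ≤ i ∧ i ≤ n then (2 * ((i : ℂ) - 1)) • vec S (.e i) else 0)
  | .y i, .x => if 1 ≤ i ∧ i + 1 ≤ n then (2 * (i : ℂ) - 1) • vec S (.y i) else 0
  | .x, .e j =>
      (if j = 1 then (-2 : ℂ) • vec S (.e 1) else 0)
      + (if j = 2 then
          (-b) • vec S (.e 2) + (-2 : ℂ) • ∑ k ∈ Finset.Icc 4 n, β k • vec S (.e (k - 1)) else 0)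
  | .x, .y j => if j = 1 then -vec S (.y 1) else 0
  | .x, .x => 0
  | .e _, .e _ => 0
  | .e _, .y _ => 0
  | .y _, .e _ => 0
  | .y _, .y _ => 0

theorem gTable_mem (S : Set Gen) (n : ℕ) (β : ℕ → ℂ) (γ : ℂ) (g h : Gen) :
    gTable S n β γ g h ∈ spacePart S (g.parity + h.parity) := by
  cases g <;> cases h <;> simp only [gTable] <;>
    repeat' first
      | with_reducible exact Submodule.zero_mem _
      | with_reducible exact vec_mem_spacePart (by simp only [Gen.parity]; decide)
      | with_reducible apply ite_mem_spacePart
      | with_reducible apply Submodule.add_mem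
      | with_reducible apply Submodule.smul_mem
      | with_reducible refine Submodule.sum_mem _ fun k _ => ?_

theorem xTable_mem (S : Set Gen) (n : ℕ) (β : ℕ → ℂ) (b : ℂ) (g h : Gen) :
    xTable S n β b g h ∈ spacePart S (g.parity + h.parity) := by
  cases g <;> cases h <;> simp only [xTable] <;>
    repeat' first
      | with_reducible exact Submodule.zero_mem _
      | with_reducible exact vec_mem_spacePart (by simp only [Gen.parity]; decide)
      | with_reducible apply ite_mem_spacePart
      | with_reducible apply Submodule.add_mem
      | with_reducible apply Submodule.smul_mem
      | with_reducible apply Submodule.neg_mem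
      | with_reducible refine Submodule.sum_mem _ fun k _ => ?_

/-- The superalgebra `G(β₄, …, βₙ, γ)`, with even part of dimension `n` and odd part of dimension
`n - 1`. Only the values `β k` with `4 ≤ k ≤ n` matter. -/
noncomputable def superG (n : ℕ) (β : ℕ → ℂ) (γ : ℂ) : Superalgebra (Space (nilGens n)) :=
  ofTable (nilGens n) (gTable (nilGens n) n β γ) (gTable_mem _ n β γ)

/-- The extension of `G(β₄, …, βₙ, γ)` by the even element `x` with the products of `xTable`. -/
noncomputable def extG (n : ℕ) (β : ℕ → ℂ) (γ b : ℂ) : Superalgebra (Space (solvGens n)) :=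
  ofTable (solvGens n)
    (fun g h => gTable (solvGens n) n β γ g h + xTable (solvGens n) n β b g h)
    (fun g h => Submodule.add_mem _ (gTable_mem _ n β γ g h) (xTable_mem _ n β b g h))

/-- `SG₁(t)`: here `[e 1, e 2] = e t`, `[e i, e 2] = e (i + t - 2)`, `[y i, e 2] = y (i + t - 2)`,
`[e 2, e 2] = 0`, `[e 2, x] = 2 (t - 2) • e 2`,
`[x, e 2] = - 2 (t - 2) • e 2 - 2 • e (t - 1)`. -/
noncomputable def SG₁ (n t : ℕ) : Superalgebra (Space (solvGens n)) :=
  extG n (Pi.single t 1) 0 (2 * ((t : ℂ) - 2))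

/-- `SG₂(γ)`: here, with `t = (n + 3) / 2`, `[e 1, e 2] = e t`, `[e i, e 2] = e (i + t - 2)`,
`[y i, e 2] = y (i + t - 2)`, `[e 2, e 2] = γ • e n`, `[e 2, x] = (n - 1) • e 2`,
`[x, e 2] = - (n - 1) • e 2 - 2 • e (t - 1)`. -/
noncomputable def SG₂ (n : ℕ) (γ : ℂ) : Superalgebra (Space (solvGens n)) :=
  extG n (Pi.single ((n + 3) / 2) 1) γ ((n : ℂ) - 1)

/-- `SG₃`: here `[e i, e 2] = [y i, e 2] = 0` except for `[e 2, e 2] = e n`, and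
`[e 2, x] = (n - 1) • e 2`, `[x, e 2] = - (n - 1) • e 2`. -/
noncomputable def SG₃ (n : ℕ) : Superalgebra (Space (solvGens n)) :=
  extG n 0 1 ((n : ℂ) - 1)

/-- The entries of the list of solvable superalgebras. -/
inductive SGEntry : Type
  | sg₁ (t : ℕ)
  | sg₂ (γ : ℂ)
  | sg₃

namespace SGEntry

/-- The range of the parameters: `4 ≤ t ≤ n` for `SG₁(t)`; `n` odd, `n ≥ 5` (so that
`4 ≤ (n + 3) / 2 ≤ n`) and `γ ≠ 0` for `SG₂(γ)`; no condition for `SG₃`. -/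
def Admissible (n : ℕ) : SGEntry → Prop
  | sg₁ t => 4 ≤ t ∧ t ≤ n
  | sg₂ γ => Odd n ∧ 5 ≤ n ∧ γ ≠ 0
  | sg₃ => True

/-- The superalgebra with the given name. -/
noncomputable def alg (n : ℕ) : SGEntry → Superalgebra (Space (solvGens n))
  | sg₁ t => SG₁ n t
  | sg₂ γ => SG₂ n γ
  | sg₃ => SG₃ n

end SGEntry

/-! Everything is read through the right multiplications R_v. The superidentity makes R_{[u,v]} a
supercommutator of R_v and R_u; for odd y it gives R_{[y,y]} = 2 R_y². Put D = R_{[y,y]}. Then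
[y,[y,y]] and [[y,y],[y,y]] are right annihilators, so right multiplication by q(D)y or q(D)[y,y]
sees only q(0). With y = y_1, e = e_2 and m = n - 1, the odd part of G(β, γ) is ℂ[D]y and its even
part is ℂ[D][y,y] ⊕ ℂe. Here D^m kills y and [y,y], R_e acts on both cyclic pieces as p(D) with p =
∑ β_k X^(k-2), and [e,e] = γ D^(m-1)[y,y]. Computations in the nilradical become polynomial
arithmetic modulo X^m (`NilFrame`).

If β = 0 and γ = 0, then ℂe_2 splits off; hence non-splitness means that some β_k or γ is nonzero.
Let K be the set of v such that [y,v] has no y-component. It contains the nilradical N and all odd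
elements, it is the kernel of a linear functional, and it acts nilpotently on a filtration of N. By
maximality K = N, so non-nilpotency of L leaves exactly one further dimension, spanned by an even x
with [y,x] = y + higher terms (`exists_complement`).

Such an x acts by weights: y has weight 1, D has weight 2, e has some weight b. Applying R_x to
[y,e] = p(D)y and to [e,e] = γ D^(m-1)[y,y] yields b = 2(k-2) whenever β_k ≠ 0 and b = n-1 whenever
γ ≠ 0. Successive corrections make y and e exact eigenvectors and [x,x] zero; the left action of x
is then forced, because [x,v] + [v,x] is a right annihilator (`exists_solvFrame`).

Hence at most one β_k survives, and if γ survives too then 2k = n+3. Rescaling e multiplies β by s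
and γ by s², which yields the list. Conversely the weight equations are all that the table of Ĝ
needs in order to be Leibniz (`SolvTable.isLeibniz`). An isomorphism between members preserves b and
changes β, γ only by a two-parameter torus (`SolvFrame.param_eq`), which separates the entries. -/

open Polynomial

/-! ### Polynomials in an operator, and right multiplications. -/

namespace Superalgebra

variable {V : Type*} [AddCommGroup V] [Module ℂ V]

/-- An operator `T` with `T D = D T + c D` acts on polynomials in `D` like a derivation. -/
theorem end_mul_aeval {T D : Module.End ℂ V} {c : ℂ} (h : T * D = D * T + c • D) (q : ℂ[X]) :
    T * aeval D q = aeval D q * T + c • aeval D (X * derivative q) := by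
  have hpow : ∀ k : ℕ, T * D ^ k = D ^ k * T + (c * k) • D ^ k := by
    intro k
    induction k with
    | zero => simp
    | succ k ih =>
      rw [pow_succ, ← mul_assoc, ih, add_mul, mul_assoc, h, smul_mul_assoc, mul_add, mul_smul_comm,
        ← pow_succ, ← mul_assoc, ← pow_succ]
      push_cast
      module
  induction q using Polynomial.induction_on' with
  | add p q hp hq =>
    simp only [map_add, mul_add, add_mul, hp, hq]
    module
  | monomial k a =>
    rcases k with _ | k
    · simp [Algebra.commutes]
    · have : (X * derivative (monomial (k + 1) a) : ℂ[X]) = monomial (k + 1) (a * (k + 1)) := by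
        rw [derivative_monomial, X_mul_monomial]; simp
      rw [this, aeval_monomial, aeval_monomial]
      simp only [Algebra.algebraMap_eq_smul_one, mul_smul_comm, smul_mul_assoc, one_mul]
      rw [hpow]
      push_cast
      module

theorem end_aeval_apply {T D : Module.End ℂ V} {c : ℂ} (h : T * D = D * T + c • D) (q : ℂ[X])
    (v : V) : T (aeval D q v) = aeval D q (T v) + c • aeval D (X * derivative q) v := by
  have := congrArg (fun S : Module.End ℂ V => S v) (end_mul_aeval h q)
  simpa using this

theorem end_aeval_apply_of_commute {T D : Module.End ℂ V} (h : T * D = D * T) (q : ℂ[X])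
    (v : V) : T (aeval D q v) = aeval D q (T v) := by
  have := end_aeval_apply (c := 0) (by simpa using h) q v
  simpa using this

theorem aeval_mul_apply (D : Module.End ℂ V) (p q : ℂ[X]) (v : V) :
    aeval D (p * q) v = aeval D p (aeval D q v) := by
  rw [map_mul]; rfl

theorem aeval_comm_apply (D : Module.End ℂ V) (p q : ℂ[X]) (v : V) :
    aeval D p (aeval D q v) = aeval D q (aeval D p v) := by
  rw [← aeval_mul_apply, mul_comm, aeval_mul_apply]

theorem aeval_X_mul_apply (D : Module.End ℂ V) (q : ℂ[X]) (v : V) :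
    aeval D (X * q) v = D (aeval D q v) := by
  rw [aeval_mul_apply, aeval_X]

theorem aeval_C_mul_apply (D : Module.End ℂ V) (c : ℂ) (q : ℂ[X]) (v : V) :
    aeval D (C c * q) v = c • aeval D q v := by
  rw [aeval_mul_apply, aeval_C, Algebra.algebraMap_eq_smul_one]; rfl

theorem aeval_C_mul_X_pow_apply (D : Module.End ℂ V) (c : ℂ) (k : ℕ) (v : V) :
    aeval D (C c * X ^ k) v = c • (D ^ k) v := by
  rw [aeval_C_mul_apply, aeval_X_pow]

/-- Only the coefficients below `m` matter if `D ^ m` kills the vector. -/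
theorem aeval_apply_congr {D : Module.End ℂ V} {v : V} {m : ℕ} (h : (D ^ m) v = 0) {p q : ℂ[X]}
    (hpq : ∀ j < m, p.coeff j = q.coeff j) : aeval D p v = aeval D q v := by
  have hd : X ^ m ∣ p - q := X_pow_dvd_iff.2 fun d hd => by simp [hpq d hd]
  obtain ⟨r, hr⟩ := hd
  rw [← sub_eq_zero, ← LinearMap.sub_apply, ← map_sub, hr, mul_comm, aeval_mul_apply]
  simp [h]

/-- Isolates the constant term: the remainder lies in the image of `D v`, which in the applications
is a right annihilator or sits deeper in the filtration. -/
theorem aeval_split (D : Module.End ℂ V) (q : ℂ[X]) (v : V) :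
    aeval D q v = aeval D q.divX (D v) + q.coeff 0 • v := by
  conv_lhs => rw [← divX_mul_X_add q]
  rw [map_add, LinearMap.add_apply, aeval_mul_apply, aeval_X, aeval_C,
    Algebra.algebraMap_eq_smul_one, LinearMap.smul_apply, Module.End.one_apply]

variable (L : Superalgebra V)

/-- Right multiplication. -/
abbrev R : V →ₗ[ℂ] Module.End ℂ V := L.mul.flip

variable {L}

theorem R_apply (u v : V) : L.R v u = L.mul u v := rfl

theorem exists_even_add_odd (L : Superalgebra V) (v : V) :
    ∃ v₀ ∈ L.part 0, ∃ v₁ ∈ L.part 1, v = v₀ + v₁ := by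
  have : v ∈ L.part 0 ⊔ L.part 1 := by rw [L.isCompl_part.sup_eq_top]; trivial
  obtain ⟨a, ha, b, hb, h⟩ := Submodule.mem_sup.1 this
  exact ⟨a, ha, b, hb, h.symm⟩

theorem eq_zero_of_even_of_odd {v : V} (h0 : v ∈ L.part 0) (h1 : v ∈ L.part 1) : v = 0 := by
  have := Submodule.disjoint_def.1 L.isCompl_part.disjoint v h0 h1
  exact this

theorem mul_mem_even_even {u v : V} (hu : u ∈ L.part 0) (hv : v ∈ L.part 0) :
    L.mul u v ∈ L.part 0 := L.mul_mem hu hv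

theorem mul_mem_even_odd {u v : V} (hu : u ∈ L.part 0) (hv : v ∈ L.part 1) :
    L.mul u v ∈ L.part 1 := L.mul_mem hu hv

theorem mul_mem_odd_even {u v : V} (hu : u ∈ L.part 1) (hv : v ∈ L.part 0) :
    L.mul u v ∈ L.part 1 := L.mul_mem hu hv

theorem mul_mem_odd_odd {u v : V} (hu : u ∈ L.part 1) (hv : v ∈ L.part 1) :
    L.mul u v ∈ L.part 0 := by
  have := L.mul_mem hu hv
  rwa [show (1 : ZMod 2) + 1 = 0 from by decide] at this

/-- Operator form of the superidentity for two odd factors, where the sign turns the commutator into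
an anticommutator. -/
theorem IsLeibniz.R_mul_odd (hL : L.IsLeibniz) {u v : V} (hu : u ∈ L.part 1) (hv : v ∈ L.part 1) :
    L.R (L.mul u v) = L.R v * L.R u + L.R u * L.R v := by
  ext w
  have := hL 1 1 w u v hu hv
  simp only [ZMod.val_one] at this
  simpa [R] using this

/-- One even factor makes the sign trivial, so the other factor need not be homogeneous. -/
theorem IsLeibniz.R_mul_even (hL : L.IsLeibniz) {v : V} (hv : v ∈ L.part 0) (u : V) :
    L.R (L.mul u v) = L.R v * L.R u - L.R u * L.R v := by
  obtain ⟨u₀, h0, u₁, h1, rfl⟩ := L.exists_even_add_odd u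
  ext w
  have e0 := hL 0 0 w u₀ v h0 hv
  have e1 := hL 1 0 w u₁ v h1 hv
  simp only [ZMod.val_zero, mul_zero, pow_zero, one_smul] at e0 e1
  simp only [R, map_add, LinearMap.add_apply, LinearMap.sub_apply, Module.End.mul_apply,
    LinearMap.flip_apply, e0, e1]
  abel

theorem IsLeibniz.R_even_mul (hL : L.IsLeibniz) {u : V} (hu : u ∈ L.part 0) (v : V) :
    L.R (L.mul u v) = L.R v * L.R u - L.R u * L.R v := by
  obtain ⟨v₀, h0, v₁, h1, rfl⟩ := L.exists_even_add_odd v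
  ext w
  have e0 := hL 0 0 w u v₀ hu h0
  have e1 := hL 0 1 w u v₁ hu h1
  simp only [ZMod.val_zero, zero_mul, pow_zero, one_smul] at e0 e1
  simp only [R, map_add, LinearMap.add_apply, LinearMap.sub_apply, Module.End.mul_apply,
    LinearMap.flip_apply, e0, e1]
  abel

theorem IsLeibniz.mul_mul_even (hL : L.IsLeibniz) {v : V} (hv : v ∈ L.part 0) (w u : V) :
    L.mul (L.mul w u) v = L.mul w (L.mul u v) + L.mul (L.mul w v) u := by
  have := congrArg (fun T : Module.End ℂ V => T w) (hL.R_mul_even hv u)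
  simp only [R_apply, LinearMap.sub_apply, Module.End.mul_apply] at this
  rw [this]; abel

theorem IsLeibniz.mul_mul_odd (hL : L.IsLeibniz) {u v : V} (hu : u ∈ L.part 1) (hv : v ∈ L.part 1)
    (w : V) : L.mul (L.mul w u) v = L.mul w (L.mul u v) - L.mul (L.mul w v) u := by
  have := congrArg (fun T : Module.End ℂ V => T w) (hL.R_mul_odd hu hv)
  simp only [R_apply, LinearMap.add_apply, Module.End.mul_apply] at this
  rw [this]; abel

/-- Right multiplication by the square `[y, y]`. -/
abbrev sqR (L : Superalgebra V) (y : V) : Module.End ℂ V := L.R (L.mul y y)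

theorem aeval_mem_part {y : V} (hy : y ∈ L.part 1) (q : ℂ[X]) {v : V} {a : ZMod 2} (hv : v ∈ L.part a) :
    aeval (L.sqR y) q v ∈ L.part a := by
  have hpow : ∀ k : ℕ, (L.sqR y ^ k) v ∈ L.part a := fun k => by
    induction k with
    | zero => simpa using hv
    | succ k ih =>
      rw [pow_succ', Module.End.mul_apply]
      have := L.mul_mem ih (mul_mem_odd_odd hy hy)
      rwa [add_zero] at this
  induction q using Polynomial.induction_on' with
  | add p q hp hq => rw [map_add, LinearMap.add_apply]; exact Submodule.add_mem _ hp hq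
  | monomial k a =>
    rw [aeval_monomial, Algebra.algebraMap_eq_smul_one, smul_mul_assoc, one_mul,
      LinearMap.smul_apply]
    exact Submodule.smul_mem _ _ (hpow k)

section Odd

variable {y : V} (hL : L.IsLeibniz) (hy : y ∈ L.part 1)
include hL hy

theorem sqR_eq : L.sqR y = (2 : ℂ) • (L.R y * L.R y) := by
  rw [sqR, hL.R_mul_odd hy hy, two_smul]

theorem R_comm_sqR : L.R y * L.sqR y = L.sqR y * L.R y := by
  rw [sqR_eq hL hy, mul_smul_comm, smul_mul_assoc, mul_assoc]

/-- Here R_{[y,[y,y]]} is the commutator of R_y with a multiple of its own square. -/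
theorem R_sqR_self : L.R (L.sqR y y) = 0 := by
  change L.R (L.mul y (L.mul y y)) = 0
  rw [hL.R_mul_even (mul_mem_odd_odd hy hy), sub_eq_zero]
  exact (R_comm_sqR hL hy).symm

theorem R_sqR_sq : L.R (L.sqR y (L.mul y y)) = 0 := by
  change L.R (L.mul (L.mul y y) (L.mul y y)) = 0
  rw [hL.R_mul_even (mul_mem_odd_odd hy hy), sub_self]

/-- Right multiplication by an even element preserves right annihilators, as R of the product is a
commutator with R_v = 0. -/
theorem R_aeval_of_R_eq_zero {v : V} (hv : L.R v = 0) (q : ℂ[X]) :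
    L.R (aeval (L.sqR y) q v) = 0 := by
  have hD : ∀ w, L.R w = 0 → L.R (L.sqR y w) = 0 := fun w hw => by
    change L.R (L.mul w (L.mul y y)) = 0
    rw [hL.R_mul_even (mul_mem_odd_odd hy hy), hw]; simp
  have hpow : ∀ k : ℕ, L.R ((L.sqR y ^ k) v) = 0 := fun k => by
    induction k with
    | zero => simpa using hv
    | succ k ih => rw [pow_succ', Module.End.mul_apply]; exact hD _ ih
  induction q using Polynomial.induction_on' with
  | add p q hp hq => rw [map_add, LinearMap.add_apply, map_add, hp, hq, add_zero]
  | monomial k a =>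
    rw [aeval_monomial, Algebra.algebraMap_eq_smul_one, smul_mul_assoc, one_mul,
      LinearMap.smul_apply, map_smul, hpow, smul_zero]

theorem R_aeval_self (q : ℂ[X]) : L.R (aeval (L.sqR y) q y) = q.coeff 0 • L.R y := by
  rw [aeval_split, map_add, R_aeval_of_R_eq_zero hL hy (R_sqR_self hL hy), zero_add, map_smul]

theorem R_aeval_sq (q : ℂ[X]) : L.R (aeval (L.sqR y) q (L.mul y y)) = q.coeff 0 • L.sqR y := by
  rw [aeval_split, map_add, R_aeval_of_R_eq_zero hL hy (R_sqR_sq hL hy), zero_add, map_smul]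

theorem aeval_mul_self (q : ℂ[X]) (v : V) :
    L.mul (aeval (L.sqR y) q v) y = aeval (L.sqR y) q (L.mul v y) :=
  end_aeval_apply_of_commute (R_comm_sqR hL hy) q v

/-- Source of the factors 1/2 in the table: R_y² is half of D. -/
theorem sq_mul_self : L.mul (L.mul y y) y = (1 / 2 : ℂ) • L.sqR y y := by
  rw [sqR_eq hL hy, LinearMap.smul_apply, smul_smul]
  norm_num [Module.End.mul_apply, R_apply]

end Odd

end Superalgebra

/-! ### The nilradical as a module over polynomials in D. -/

namespace Superalgebra

variable {V : Type*} [AddCommGroup V] [Module ℂ V]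

/-- The subspace `N` of `L` is a subalgebra of the form `G(β, γ)`, generated by the odd element `y`
and the even element `e`. Here `D` is the right multiplication by `[y, y]`, the right
multiplication by `e` acts as `p(D)`, and `m` is the dimension of the odd part of `N`. -/
structure NilFrame (L : Superalgebra V) (N : Submodule ℂ V) (m : ℕ) (p : ℂ[X]) (γ : ℂ)
    (y e : V) : Prop where
  two_le : 2 ≤ m
  coeff_zero : p.coeff 0 = 0
  coeff_one : p.coeff 1 = 0
  y_odd : y ∈ L.part 1
  e_even : e ∈ L.part 0
  pow_apply : (L.sqR y ^ m) y = 0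
  ye : L.mul y e = aeval (L.sqR y) p y
  ey : L.mul e y = 0
  ee : L.mul e e = γ • (L.sqR y ^ (m - 1)) (L.mul y y)
  mem_iff : ∀ v, v ∈ N ↔ ∃ (q r : ℂ[X]) (s : ℂ),
    v = aeval (L.sqR y) q y + aeval (L.sqR y) r (L.mul y y) + s • e
  indep : ∀ (q r : ℂ[X]) (s : ℂ),
    aeval (L.sqR y) q y + aeval (L.sqR y) r (L.mul y y) + s • e = 0 →
      (∀ j < m, q.coeff j = 0) ∧ (∀ j < m, r.coeff j = 0) ∧ s = 0

namespace NilFrame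

variable {L : Superalgebra V} {N : Submodule ℂ V} {m : ℕ} {p : ℂ[X]} {γ : ℂ} {y e : V}
variable (h : NilFrame L N m p γ y e) (hL : L.IsLeibniz)
include h

theorem sq_even : L.mul y y ∈ L.part 0 := mul_mem_odd_odd h.y_odd h.y_odd

theorem aeval_sq_mem (q : ℂ[X]) : aeval (L.sqR y) q (L.mul y y) ∈ N :=
  (h.mem_iff _).2 ⟨0, q, 0, by simp⟩

theorem coeff_y {q : ℂ[X]} (hq : aeval (L.sqR y) q y = 0) : ∀ j < m, q.coeff j = 0 :=
  (h.indep q 0 0 (by simpa using hq)).1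

theorem coeff_sq {q : ℂ[X]} (hq : aeval (L.sqR y) q (L.mul y y) = 0) : ∀ j < m, q.coeff j = 0 :=
  (h.indep 0 q 0 (by simpa using hq)).2.1

theorem coeff_y_eq {q r : ℂ[X]} (hq : aeval (L.sqR y) q y = aeval (L.sqR y) r y) :
    ∀ j < m, q.coeff j = r.coeff j := fun j hj => by
  have := h.coeff_y (q := q - r) (by rw [map_sub, LinearMap.sub_apply, hq, sub_self]) j hj
  rwa [coeff_sub, sub_eq_zero] at this

theorem coeff_sq_eq {q r : ℂ[X]}
    (hq : aeval (L.sqR y) q (L.mul y y) = aeval (L.sqR y) r (L.mul y y)) :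
    ∀ j < m, q.coeff j = r.coeff j := fun j hj => by
  have := h.coeff_sq (q := q - r) (by rw [map_sub, LinearMap.sub_apply, hq, sub_self]) j hj
  rwa [coeff_sub, sub_eq_zero] at this

theorem aeval_y_congr {q r : ℂ[X]} (hq : ∀ j < m, q.coeff j = r.coeff j) :
    aeval (L.sqR y) q y = aeval (L.sqR y) r y := aeval_apply_congr h.pow_apply hq

theorem odd_form {v : V} (hv : v ∈ N) (ho : v ∈ L.part 1) : ∃ q : ℂ[X], v = aeval (L.sqR y) q y := by
  obtain ⟨q, r, s, rfl⟩ := (h.mem_iff _).1 hv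
  refine ⟨q, ?_⟩
  have h1 : aeval (L.sqR y) r (L.mul y y) + s • e ∈ L.part 0 :=
    Submodule.add_mem _ (aeval_mem_part h.y_odd r h.sq_even) (Submodule.smul_mem _ _ h.e_even)
  have h2 : aeval (L.sqR y) r (L.mul y y) + s • e ∈ L.part 1 := by
    have := Submodule.sub_mem _ ho (aeval_mem_part h.y_odd q h.y_odd)
    rwa [add_assoc, add_sub_cancel_left] at this
  rw [add_assoc, eq_zero_of_even_of_odd h1 h2, add_zero]

theorem even_form {v : V} (hv : v ∈ N) (ho : v ∈ L.part 0) :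
    ∃ (r : ℂ[X]) (s : ℂ), v = aeval (L.sqR y) r (L.mul y y) + s • e := by
  obtain ⟨q, r, s, rfl⟩ := (h.mem_iff _).1 hv
  refine ⟨r, s, ?_⟩
  have h1 : aeval (L.sqR y) r (L.mul y y) + s • e ∈ L.part 0 :=
    Submodule.add_mem _ (aeval_mem_part h.y_odd r h.sq_even) (Submodule.smul_mem _ _ h.e_even)
  have h2 : aeval (L.sqR y) q y ∈ L.part 0 := by
    have := Submodule.sub_mem _ ho h1
    rwa [add_assoc, add_sub_cancel_right] at this
  rw [add_assoc, eq_zero_of_even_of_odd h2 (aeval_mem_part h.y_odd q h.y_odd), zero_add]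

include hL

theorem pow_sq : (L.sqR y ^ m) (L.mul y y) = 0 := by
  have := aeval_mul_self hL h.y_odd (X ^ m) y
  rw [aeval_X_pow, h.pow_apply] at this
  rw [← this]; simp

theorem aeval_sq_congr {q r : ℂ[X]} (hq : ∀ j < m, q.coeff j = r.coeff j) :
    aeval (L.sqR y) q (L.mul y y) = aeval (L.sqR y) r (L.mul y y) :=
  aeval_apply_congr (h.pow_sq hL) hq

theorem R_aeval_y (q : ℂ[X]) : L.R (aeval (L.sqR y) q y) = q.coeff 0 • L.R y :=
  R_aeval_self hL h.y_odd q

theorem R_aeval_sq' (q : ℂ[X]) : L.R (aeval (L.sqR y) q (L.mul y y)) = q.coeff 0 • L.sqR y :=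
  R_aeval_sq hL h.y_odd q

theorem R_pow_sq : L.R ((L.sqR y ^ (m - 1)) (L.mul y y)) = 0 := by
  have := h.R_aeval_sq' hL (X ^ (m - 1))
  rw [aeval_X_pow] at this
  rw [this, coeff_X_pow, if_neg (by have := h.two_le; omega), zero_smul]

/-- The commutator is R_{[y,e]} with [y,e] = p(D)y, and p has no constant term. -/
theorem R_e_comm : L.R e * L.R y = L.R y * L.R e := by
  have := hL.R_mul_even h.e_even y
  rw [h.ye, h.R_aeval_y hL, h.coeff_zero, zero_smul] at this
  exact (sub_eq_zero.1 this.symm)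

theorem R_e_sqR_comm : L.R e * L.sqR y = L.sqR y * L.R e := by
  rw [sqR_eq hL h.y_odd, mul_smul_comm, smul_mul_assoc, ← mul_assoc, h.R_e_comm hL, mul_assoc,
    h.R_e_comm hL, mul_assoc]

theorem sq_mul_e : L.mul (L.mul y y) e = aeval (L.sqR y) p (L.mul y y) := by
  have := congrArg (fun T : Module.End ℂ V => T y) (h.R_e_comm hL)
  simp only [Module.End.mul_apply, R_apply] at this
  rw [this, h.ye, aeval_mul_self hL h.y_odd]

theorem aeval_y_mul_e (q : ℂ[X]) :
    L.mul (aeval (L.sqR y) q y) e = aeval (L.sqR y) (q * p) y := by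
  rw [aeval_mul_apply, ← h.ye]
  exact end_aeval_apply_of_commute (h.R_e_sqR_comm hL) q y

theorem aeval_sq_mul_e (q : ℂ[X]) :
    L.mul (aeval (L.sqR y) q (L.mul y y)) e = aeval (L.sqR y) (q * p) (L.mul y y) := by
  rw [aeval_mul_apply, ← h.sq_mul_e hL]
  exact end_aeval_apply_of_commute (h.R_e_sqR_comm hL) q _

theorem aeval_sq_mul_y (q : ℂ[X]) :
    L.mul (aeval (L.sqR y) q (L.mul y y)) y = (1 / 2 : ℂ) • aeval (L.sqR y) (X * q) y := by
  rw [aeval_mul_self hL h.y_odd, sq_mul_self hL h.y_odd, map_smul, mul_comm, aeval_mul_apply,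
    aeval_X]

theorem mul_aeval_y (q : ℂ[X]) (v : V) :
    L.mul v (aeval (L.sqR y) q y) = q.coeff 0 • L.mul v y := by
  rw [← R_apply, h.R_aeval_y hL]; rfl

theorem mul_aeval_sq (q : ℂ[X]) (v : V) :
    L.mul v (aeval (L.sqR y) q (L.mul y y)) = q.coeff 0 • L.sqR y v := by
  rw [← R_apply, h.R_aeval_sq' hL]; rfl

theorem e_sq : L.mul e (L.mul y y) = 0 := by
  rw [← R_apply, hL.R_mul_odd h.y_odd h.y_odd]
  simp [h.ey]

/-- R_e multiplies by p, which is divisible by X and so pushes the top power D^(m-1) to zero. -/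
theorem pow_mul_e : L.mul ((L.sqR y ^ (m - 1)) (L.mul y y)) e = 0 := by
  have := h.aeval_sq_mul_e hL (X ^ (m - 1))
  rw [aeval_X_pow] at this
  rw [this, h.aeval_sq_congr hL (r := 0), map_zero, LinearMap.zero_apply]
  intro j hj
  rw [coeff_X_pow_mul', Polynomial.coeff_zero]
  split_ifs with h1
  · rw [show j - (m - 1) = 0 by omega, h.coeff_zero]
  · rfl

theorem pow_mul_y : L.mul ((L.sqR y ^ (m - 1)) (L.mul y y)) y = 0 := by
  have := h.aeval_sq_mul_y hL (X ^ (m - 1))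
  rw [aeval_X_pow] at this
  rw [this, ← pow_succ', Nat.sub_add_cancel (by linarith [h.two_le]), aeval_X_pow, h.pow_apply,
    smul_zero]

/-! Even elements acting from the right. -/

section Even

variable {x : V} (hx : x ∈ L.part 0) {a : ℂ[X]} (hyx : L.mul y x = aeval (L.sqR y) a y)
include hx hyx

/-- R_x acts as a derivation on [y,y]; the right-hand factor contributes only a(0), because right
multiplication by a(D)y is a(0) R_y. -/
theorem sq_mul_even : L.mul (L.mul y y) x = aeval (L.sqR y) (a + C (a.coeff 0)) (L.mul y y) := by
  rw [hL.mul_mul_even hx, hyx, h.mul_aeval_y hL, aeval_mul_self hL h.y_odd, map_add, add_comm,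
    aeval_C, Algebra.algebraMap_eq_smul_one]
  rfl

/-- D is a weight vector of weight 2a(0) for R_x; this is what lets R_x act on polynomials in D as
an Euler derivation. -/
theorem R_even_sqR : L.R x * L.sqR y = L.sqR y * L.R x + (2 * a.coeff 0) • L.sqR y := by
  have := hL.R_mul_even hx (L.mul y y)
  rw [h.sq_mul_even hL hx hyx, h.R_aeval_sq' hL, coeff_add, coeff_C_zero, ← two_mul] at this
  rw [this]; abel

theorem aeval_y_mul_even (q : ℂ[X]) : L.mul (aeval (L.sqR y) q y) x =
    aeval (L.sqR y) (q * a + C (2 * a.coeff 0) * (X * derivative q)) y := by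
  rw [map_add, LinearMap.add_apply, aeval_mul_apply, ← hyx, aeval_mul_apply, aeval_C,
    Algebra.algebraMap_eq_smul_one]
  exact end_aeval_apply (h.R_even_sqR hL hx hyx) q y

theorem aeval_sq_mul_even (q : ℂ[X]) : L.mul (aeval (L.sqR y) q (L.mul y y)) x =
    aeval (L.sqR y) (q * (a + C (a.coeff 0)) + C (2 * a.coeff 0) * (X * derivative q))
      (L.mul y y) := by
  rw [map_add, LinearMap.add_apply, aeval_mul_apply, ← h.sq_mul_even hL hx hyx, aeval_mul_apply,
    aeval_C, Algebra.algebraMap_eq_smul_one]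
  exact end_aeval_apply (h.R_even_sqR hL hx hyx) q _

theorem pow_mul_even : L.mul ((L.sqR y ^ (m - 1)) (L.mul y y)) x =
    (2 * m * a.coeff 0) • (L.sqR y ^ (m - 1)) (L.mul y y) := by
  obtain ⟨k, rfl⟩ : ∃ k, m = k + 1 := ⟨m - 1, by have := h.two_le; omega⟩
  have e1 := h.aeval_sq_mul_even hL hx hyx (X ^ (k + 1 - 1))
  rw [aeval_X_pow] at e1
  rw [e1, h.aeval_sq_congr hL (r := C (2 * (k + 1 : ℕ) * a.coeff 0) * X ^ (k + 1 - 1))]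
  · rw [aeval_C_mul_X_pow_apply]
  · intro j hj
    simp only [Nat.add_sub_cancel]
    rw [coeff_add, coeff_X_pow_mul', coeff_C_mul, coeff_C_mul, coeff_X_pow]
    have : (X * derivative (X ^ k) : ℂ[X]) = C (k : ℂ) * X ^ k := by
      rcases k with _ | k
      · simp
      · rw [derivative_X_pow]; push_cast; simp; ring
    rw [this, coeff_C_mul, coeff_X_pow]
    rcases Nat.lt_or_ge j k with h1 | h1
    · simp [show ¬ k ≤ j by omega, show j ≠ k by omega]
    · obtain rfl : j = k := by omega
      simp; ring

/-- The action of an even element on `e`. -/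
theorem exists_e_mul_even (hex : L.mul e x ∈ N) : ∃ c c' : ℂ,
    L.mul e x = c • e + c' • (L.sqR y ^ (m - 1)) (L.mul y y) ∧
    (∀ j < m, c * p.coeff j = 2 * a.coeff 0 * j * p.coeff j) ∧
    c * γ = m * a.coeff 0 * γ := by
  have hm := h.two_le
  obtain ⟨r, c, hr⟩ := h.even_form hex (mul_mem_even_even h.e_even hx)
  -- Apply R_x to [e,y] = 0: this leaves [[e,x],y] = 0, which kills every coefficient of `r` except
  -- the top one, of degree m - 1.
  have e1 := hL.mul_mul_even hx e y
  rw [h.ey, LinearMap.map_zero, LinearMap.zero_apply, hyx, h.mul_aeval_y hL, h.ey, smul_zero,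
    zero_add, hr, map_add, LinearMap.add_apply, map_smul, LinearMap.smul_apply, h.ey, smul_zero,
    add_zero, h.aeval_sq_mul_y hL] at e1
  have e2 := h.coeff_y ((smul_eq_zero.1 e1.symm).resolve_left (by norm_num))
  have hex' : L.mul e x = c • e + r.coeff (m - 1) • (L.sqR y ^ (m - 1)) (L.mul y y) := by
    rw [hr, add_comm]
    congr 1
    rw [h.aeval_sq_congr hL (r := C (r.coeff (m - 1)) * X ^ (m - 1)), aeval_C_mul_X_pow_apply]
    · intro j hj
      rw [coeff_C_mul, coeff_X_pow]
      split_ifs with hj'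
      · rw [hj', mul_one]
      · have := e2 (j + 1) (by omega)
        rw [coeff_X_mul] at this
        rw [this, mul_zero]
  refine ⟨c, r.coeff (m - 1), hex', ?_, ?_⟩
  -- Apply R_x to [y,e] = p(D)y. The product of p and a occurs on both sides and cancels; what
  -- remains compares c·p with 2a(0)·X·p'.
  · have e3 := hL.mul_mul_even hx y e
    have e4 : L.mul y ((L.sqR y ^ (m - 1)) (L.mul y y)) = 0 := by
      rw [← R_apply, h.R_pow_sq hL]; rfl
    rw [h.ye, h.aeval_y_mul_even hL hx hyx, hex', (L.mul y).map_add, (L.mul y).map_smul,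
      (L.mul y).map_smul, e4, smul_zero, add_zero, h.ye, hyx, h.aeval_y_mul_e hL,
      ← aeval_C_mul_apply, ← LinearMap.add_apply, ← map_add] at e3
    intro j hj
    have e5 := h.coeff_y_eq e3 j hj
    rw [mul_comm p a, coeff_add, coeff_add, add_comm, add_left_inj, coeff_C_mul,
      coeff_C_mul] at e5
    rw [← e5]
    rcases j with _ | j
    · simp
    · rw [coeff_X_mul, coeff_derivative]; push_cast; ring
  -- Apply R_x to [e,e]: weight 2c on one side, and weight 2m·a(0) of D^(m-1)[y,y] on the other.
  · have e3 := hL.mul_mul_even hx e e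
    have e4 : L.mul e ((L.sqR y ^ (m - 1)) (L.mul y y)) = 0 := by
      rw [← R_apply, h.R_pow_sq hL]; rfl
    rw [h.ee, hex', map_smul, LinearMap.smul_apply, h.pow_mul_even hL hx hyx] at e3
    simp only [map_add, map_smul, LinearMap.add_apply, LinearMap.smul_apply, e4, h.ee,
      h.pow_mul_e hL, smul_zero, add_zero, smul_smul, ← add_smul] at e3
    have e5 := h.coeff_sq_eq (q := C (γ * (2 * m * a.coeff 0)) * X ^ (m - 1))
      (r := C (c * γ + c * γ) * X ^ (m - 1)) (by
        rwa [aeval_C_mul_X_pow_apply, aeval_C_mul_X_pow_apply]) (m - 1) (by omega)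
    simp only [coeff_C_mul, coeff_X_pow, if_true, mul_one] at e5
    linear_combination (-1 / 2 : ℂ) * e5

end Even

end NilFrame

end Superalgebra

/-! ### The filtration by powers of R_y, and the one-dimensional complement of the nilradical. -/

namespace Superalgebra

variable {V : Type*} [AddCommGroup V] [Module ℂ V]

/-- The span of the elements `[… [y, y], …, y]` with at least `k` factors after the first one. -/
def tail (L : Superalgebra V) (y : V) (k : ℕ) : Submodule ℂ V :=
  Submodule.span ℂ {v | ∃ j, k ≤ j ∧ v = (L.R y ^ j) y}

theorem tail_le {L : Superalgebra V} {y : V} {k : ℕ} {S : Submodule ℂ V} :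
    L.tail y k ≤ S ↔ ∀ j, k ≤ j → (L.R y ^ j) y ∈ S := by
  rw [tail, Submodule.span_le]
  constructor
  · intro h j hj
    exact h ⟨j, hj, rfl⟩
  · rintro h _ ⟨j, hj, rfl⟩
    exact h j hj

theorem tail_anti {L : Superalgebra V} {y : V} {k l : ℕ} (h : k ≤ l) : L.tail y l ≤ L.tail y k :=
  tail_le.2 fun j hj => Submodule.subset_span ⟨j, h.trans hj, rfl⟩

theorem pow_mem_tail (L : Superalgebra V) (y : V) (k : ℕ) : (L.R y ^ k) y ∈ L.tail y k :=
  Submodule.subset_span ⟨k, le_rfl, rfl⟩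

theorem self_mem_tail (L : Superalgebra V) (y : V) : y ∈ L.tail y 0 := by
  simpa using L.pow_mem_tail y 0

theorem sq_mem_tail (L : Superalgebra V) (y : V) : L.mul y y ∈ L.tail y 1 := by
  have := L.pow_mem_tail y 1
  rwa [pow_one] at this

theorem R_pow_mem_tail {L : Superalgebra V} {y v : V} {k : ℕ} (i : ℕ) (hv : v ∈ L.tail y k) :
    (L.R y ^ i) v ∈ L.tail y (i + k) := by
  have : L.tail y k ≤ (L.tail y (i + k)).comap (L.R y ^ i) := tail_le.2 fun j hj => by
    rw [Submodule.mem_comap, ← Module.End.mul_apply, ← pow_add]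
    exact Submodule.subset_span ⟨_, by omega, rfl⟩
  exact this hv

theorem R_mem_tail {L : Superalgebra V} {y v : V} {k : ℕ} (hv : v ∈ L.tail y k) :
    L.R y v ∈ L.tail y (k + 1) := by
  have := R_pow_mem_tail 1 hv
  rwa [pow_one, add_comm] at this

section Odd

variable {L : Superalgebra V} {y : V} (hL : L.IsLeibniz) (hy : y ∈ L.part 1)
include hL hy

theorem sqR_mem_tail {k : ℕ} {v : V} (hv : v ∈ L.tail y k) : L.sqR y v ∈ L.tail y (k + 2) := by
  rw [sqR_eq hL hy]
  exact Submodule.smul_mem _ _ (R_mem_tail (R_mem_tail hv))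

theorem aeval_mem_tail {k : ℕ} {v : V} (hv : v ∈ L.tail y k) (q : ℂ[X]) :
    aeval (L.sqR y) q v ∈ L.tail y k := by
  have hpow : ∀ j : ℕ, (L.sqR y ^ j) v ∈ L.tail y k := fun j => by
    induction j with
    | zero => simpa using hv
    | succ j ih =>
      rw [pow_succ', Module.End.mul_apply]
      exact tail_anti (Nat.le_add_right _ _) (sqR_mem_tail hL hy ih)
  induction q using Polynomial.induction_on' with
  | add p q hp hq => rw [map_add, LinearMap.add_apply]; exact Submodule.add_mem _ hp hq
  | monomial j a =>
    rw [← C_mul_X_pow_eq_monomial, aeval_C_mul_X_pow_apply]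
    exact Submodule.smul_mem _ _ (hpow j)

theorem aeval_X_mul_mem_tail {k : ℕ} {v : V} (hv : v ∈ L.tail y k) {q : ℂ[X]}
    (hq : q.coeff 0 = 0) : aeval (L.sqR y) q v ∈ L.tail y (k + 2) := by
  rw [aeval_split, hq, zero_smul, add_zero]
  exact aeval_mem_tail hL hy (sqR_mem_tail hL hy hv) _

theorem R_pow_two_mul (k : ℕ) : L.R y ^ (2 * k) = (1 / 2 : ℂ) ^ k • L.sqR y ^ k := by
  rw [sqR_eq hL hy, _root_.smul_pow, smul_smul, ← mul_pow, pow_mul, pow_two]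
  norm_num

end Odd

namespace NilFrame

variable {L : Superalgebra V} {N : Submodule ℂ V} {m : ℕ} {p : ℂ[X]} {γ : ℂ} {y e : V}
variable (h : NilFrame L N m p γ y e) (hL : L.IsLeibniz)
include h hL

/-- R_y^(2m) is a multiple of D^m, which kills y. -/
theorem tail_eq_bot : L.tail y (2 * m) = ⊥ := by
  rw [eq_bot_iff, tail_le]
  intro j hj
  obtain ⟨i, rfl⟩ := Nat.exists_eq_add_of_le' hj
  rw [pow_add, Module.End.mul_apply, R_pow_two_mul hL h.y_odd, LinearMap.smul_apply, h.pow_apply]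
  simp

/-- Elements of `N` decompose along `y`, `e` and the products of `y` with itself. -/
theorem mem_decomp {v : V} (hv : v ∈ N) : ∃ (s t : ℂ), ∃ w ∈ L.tail y 1, v = s • y + t • e + w := by
  obtain ⟨q, r, t, rfl⟩ := (h.mem_iff _).1 hv
  refine ⟨q.coeff 0, t, _, Submodule.add_mem _ (tail_anti one_le_two
    (sqR_mem_tail hL h.y_odd (aeval_mem_tail hL h.y_odd (L.self_mem_tail y) q.divX)))
    (aeval_mem_tail hL h.y_odd (L.sq_mem_tail y) r), ?_⟩
  rw [aeval_split (L.sqR y) q y, ← aeval_X_mul_apply, mul_comm, aeval_mul_apply, aeval_X]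
  abel

/-- The `y`-coefficient of an element of `N` does not depend on the decomposition. -/
theorem coeff_zero_of_mem {q : ℂ[X]}
    (hq : aeval (L.sqR y) q y ∈ L.tail y 1 ⊔ Submodule.span ℂ {e}) : q.coeff 0 = 0 := by
  obtain ⟨w, hw, w', hw', hww⟩ := Submodule.mem_sup.1 hq
  obtain ⟨t, rfl⟩ := Submodule.mem_span_singleton.1 hw'
  have key : ∃ q r : ℂ[X], w = aeval (L.sqR y) (X * q) y + aeval (L.sqR y) r (L.mul y y) := by
    clear hww
    refine Submodule.span_induction (p := fun w _ => ∃ q r : ℂ[X], w = aeval (L.sqR y) (X * q) y +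
      aeval (L.sqR y) r (L.mul y y)) ?_ ⟨0, 0, by simp⟩ ?_ ?_ hw
    · rintro _ ⟨j, hj, rfl⟩
      obtain ⟨i, rfl | rfl⟩ := Nat.even_or_odd' j
      · obtain ⟨k, rfl⟩ : ∃ k, i = k + 1 := ⟨i - 1, by omega⟩
        refine ⟨C ((1 / 2 : ℂ) ^ (k + 1)) * X ^ k, 0, ?_⟩
        rw [R_pow_two_mul hL h.y_odd, mul_left_comm, ← pow_succ', aeval_C_mul_X_pow_apply]
        simp
      · refine ⟨0, C ((1 / 2 : ℂ) ^ i) * X ^ i, ?_⟩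
        rw [pow_succ, Module.End.mul_apply, R_pow_two_mul hL h.y_odd, aeval_C_mul_X_pow_apply]
        simp
    · rintro _ _ _ _ ⟨q, r, rfl⟩ ⟨q', r', rfl⟩
      refine ⟨q + q', r + r', ?_⟩
      simp only [mul_add, map_add, LinearMap.add_apply]
      abel
    · rintro c _ _ ⟨q, r, rfl⟩
      refine ⟨C c * q, C c * r, ?_⟩
      rw [mul_left_comm, aeval_C_mul_apply, aeval_C_mul_apply, smul_add]
  obtain ⟨q', r, rfl⟩ := key
  have := (h.indep (X * q' - q) r t (by
    rw [map_sub, LinearMap.sub_apply, ← hww]; abel)).1 0 (by have := h.two_le; omega)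
  simpa using this

/-- An even element with no `y`-component in its action on `y` raises the filtration of `N`. -/
theorem even_mul (hNb : ∀ u v, L.mul u v ∈ N) (hns : (∃ j < m, p.coeff j ≠ 0) ∨ γ ≠ 0) {v : V}
    (hv : v ∈ L.part 0) (hyv : L.mul y v ∈ L.tail y 1 ⊔ Submodule.span ℂ {e}) :
    L.mul e v ∈ L.tail y 1 ∧ ∀ k, ∀ w ∈ L.tail y k, L.mul w v ∈ L.tail y (k + 1) := by
  obtain ⟨a, ha⟩ := h.odd_form (hNb y v) (mul_mem_odd_even h.y_odd hv)
  have ha0 : a.coeff 0 = 0 := h.coeff_zero_of_mem hL (ha ▸ hyv)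
  constructor
  · obtain ⟨c, c', hc, hp, hγ⟩ := h.exists_e_mul_even hL hv ha (hNb _ _)
    -- With a(0) = 0 the weight relations read c·p_j = 0 and c·γ = 0, and some p_j or γ is nonzero.
    have : c = 0 := by
      rcases hns with ⟨j, hj, hj'⟩ | hγ'
      · have := hp j hj
        rw [ha0, mul_zero, zero_mul, zero_mul] at this
        exact (mul_eq_zero.1 this).resolve_right hj'
      · rw [ha0, mul_zero, zero_mul] at hγ
        exact (mul_eq_zero.1 hγ).resolve_right hγ'
    rw [hc, this, zero_smul, zero_add, ← aeval_X_pow (R := ℂ) (L.sqR y)]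
    exact Submodule.smul_mem _ _ (aeval_mem_tail hL h.y_odd (L.sq_mem_tail y) _)
  · intro k
    -- The commutator is R_{[y,v]} = a(0) R_y = 0; R_v is then determined on all powers of R_y by
    -- its value at y.
    have hcomm : L.R v * L.R y = L.R y * L.R v := by
      have := hL.R_mul_even hv y
      rw [ha, h.R_aeval_y hL, ha0, zero_smul] at this
      exact sub_eq_zero.1 this.symm
    have : L.tail y k ≤ (L.tail y (k + 1)).comap (L.R v) := tail_le.2 fun j hj => by
      have e1 : L.R v ((L.R y ^ j) y) = (L.R y ^ j) (L.R v y) := by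
        have := (show Commute (L.R v) (L.R y) from hcomm).pow_right j
        exact congrArg (fun T : Module.End ℂ V => T y) this
      rw [Submodule.mem_comap, e1, R_apply, ha]
      refine tail_anti (by omega) (R_pow_mem_tail j
        (aeval_X_mul_mem_tail hL h.y_odd (L.self_mem_tail y) ha0))
    exact fun w hw => this hw

/-- Odd elements raise the filtration of `N`. -/
theorem odd_mul (hNb : ∀ u v, L.mul u v ∈ N) {v : V} (hv : v ∈ L.part 1) :
    L.mul y v ∈ L.tail y 1 ⊔ Submodule.span ℂ {e} ∧
    L.mul e v ∈ L.tail y 1 ∧ ∀ k, 1 ≤ k → ∀ w ∈ L.tail y k, L.mul w v ∈ L.tail y (k + 1) := by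
  have hm := h.two_le
  obtain ⟨r, s, hr⟩ := h.even_form (hNb y v) (mul_mem_odd_odd h.y_odd hv)
  have hrE := aeval_mem_tail hL h.y_odd (L.sq_mem_tail y) r
  refine ⟨?_, ?_, ?_⟩
  · rw [hr]
    exact Submodule.add_mem_sup hrE (Submodule.smul_mem _ _ (Submodule.mem_span_singleton_self e))
  · obtain ⟨q, hq⟩ := h.odd_form (hNb e v) (mul_mem_even_odd h.e_even hv)
    -- Expanding [[e,y],v] = 0 shows that q(D)[y,y] is a multiple of D^(m-1)[y,y]; since m ≥ 2, q
    -- has no constant term.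
    have e1 := hL.mul_mul_odd h.y_odd hv e
    rw [h.ey, LinearMap.map_zero, LinearMap.zero_apply, hr, map_add, map_smul, h.mul_aeval_sq hL,
      R_apply, h.e_sq hL, smul_zero, zero_add, h.ee, hq, aeval_mul_self hL h.y_odd, smul_smul,
      ← aeval_C_mul_X_pow_apply] at e1
    have e2 := h.coeff_sq_eq (sub_eq_zero.1 e1.symm) 0 (by omega)
    rw [coeff_C_mul, coeff_X_pow, if_neg (by omega), mul_zero] at e2
    rw [hq]
    exact tail_anti one_le_two
      (aeval_X_mul_mem_tail hL h.y_odd (L.self_mem_tail y) e2.symm)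
  -- R_v anticommutes with R_y up to R_{[y,v]} = r(0) D + s R_e, which raises the filtration by two;
  -- this moves R_v through the powers of R_y.
  · have hanti : L.R v * L.R y = r.coeff 0 • L.sqR y + s • L.R e - L.R y * L.R v := by
      have := hL.R_mul_odd h.y_odd hv
      rw [hr, map_add, map_smul, h.R_aeval_sq' hL] at this
      rw [this]; abel
    have hanti' : ∀ w, L.R v (L.R y w) =
        r.coeff 0 • L.sqR y w + s • L.R e w - L.R y (L.R v w) := fun w =>
      congrArg (fun T : Module.End ℂ V => T w) hanti
    have he : ∀ j, L.R e ((L.R y ^ j) y) ∈ L.tail y (j + 2) := fun j => by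
      have e1 : L.R e ((L.R y ^ j) y) = (L.R y ^ j) (L.R e y) := by
        have := (show Commute (L.R e) (L.R y) from h.R_e_comm hL).pow_right j
        exact congrArg (fun T : Module.End ℂ V => T y) this
      rw [e1, R_apply, h.ye]
      exact R_pow_mem_tail j
        (aeval_X_mul_mem_tail hL h.y_odd (L.self_mem_tail y) h.coeff_zero)
    have key : ∀ j, L.R v ((L.R y ^ (j + 1)) y) ∈ L.tail y (j + 2) := by
      intro j
      rw [pow_succ', Module.End.mul_apply, hanti']
      refine Submodule.sub_mem _ (Submodule.add_mem _ (Submodule.smul_mem _ _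
        (sqR_mem_tail hL h.y_odd (L.pow_mem_tail y j))) (Submodule.smul_mem _ _ (he j))) ?_
      induction j with
      | zero =>
        -- The base case: [y,v] may involve e, which lies outside the filtration, but R_y kills e.
        rw [pow_zero, Module.End.one_apply, R_apply y v, hr, map_add, map_smul, R_apply e y, h.ey,
          smul_zero, add_zero]
        exact R_mem_tail hrE
      | succ j ih =>
        rw [pow_succ', Module.End.mul_apply, hanti']
        refine R_mem_tail (Submodule.sub_mem _ (Submodule.add_mem _ (Submodule.smul_mem _ _
          (sqR_mem_tail hL h.y_odd (L.pow_mem_tail y j))) (Submodule.smul_mem _ _ (he j))) ih)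
    intro k hk
    have : L.tail y k ≤ (L.tail y (k + 1)).comap (L.R v) := tail_le.2 fun j hj => by
      obtain ⟨i, rfl⟩ : ∃ i, j = i + 1 := ⟨j - 1, by omega⟩
      exact tail_anti (by omega) (key i)
    exact fun w hw => this hw

theorem mem_mul_comap {v : V} (hv : v ∈ N) :
    L.mul y v ∈ L.tail y 1 ⊔ Submodule.span ℂ {e} := by
  refine Submodule.mem_sup_left ?_
  obtain ⟨q, r, s, rfl⟩ := (h.mem_iff _).1 hv
  rw [map_add, map_add, map_smul, h.mul_aeval_y hL, h.mul_aeval_sq hL, h.ye]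
  exact Submodule.add_mem _ (Submodule.add_mem _
    (Submodule.smul_mem _ _ (L.sq_mem_tail y))
    (Submodule.smul_mem _ _ (tail_anti one_le_two
      (sqR_mem_tail hL h.y_odd (L.self_mem_tail y)))))
    (Submodule.smul_mem _ _ (tail_anti one_le_two
      (aeval_X_mul_mem_tail hL h.y_odd (L.self_mem_tail y) h.coeff_zero)))

/-- If `N` is the nilradical and `L` is not nilpotent, then `L` is spanned by `N` and an even
element `x` which acts on `y` with eigenvalue `1` up to higher terms. -/
theorem exists_complement (hN : L.IsNilradical N) (hnil : ¬ L.IsNilpotent ⊤)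
    (hns : (∃ j < m, p.coeff j ≠ 0) ∨ γ ≠ 0) :
    ∃ x ∈ L.part 0, ∃ a : ℂ[X], L.mul y x = aeval (L.sqR y) a y ∧ a.coeff 0 = 1 ∧
      ∀ v, ∃ w ∈ N, ∃ t : ℂ, v = w + t • x := by
  have hNb : ∀ u v, L.mul u v ∈ N := fun u v =>
    hN.bracket_le (Submodule.apply_mem_map₂ _ Submodule.mem_top Submodule.mem_top)
  set F := L.tail y 1 ⊔ Submodule.span ℂ {e} with hF
  -- The kernel of v ↦ (y-coefficient of [y,v]). It contains all odd elements, since [y,v] is then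
  -- even.
  set K : Submodule ℂ V := F.comap (L.mul y) with hK
  have hsplit : ∀ v ∈ K, ∀ v₀ ∈ L.part 0, ∀ v₁ ∈ L.part 1, v = v₀ + v₁ → v₀ ∈ K := by
    rintro v hv v₀ h₀ v₁ h₁ rfl
    have : v₁ ∈ K := (h.odd_mul hL hNb h₁).1
    have := Submodule.sub_mem _ hv this
    rwa [add_sub_cancel_right] at this
  have hNK : N ≤ K := fun v hv => h.mem_mul_comap hL hv
  have hact : ∀ v ∈ K, L.mul e v ∈ L.tail y 1 ∧
      ∀ k, 1 ≤ k → ∀ w ∈ L.tail y k, L.mul w v ∈ L.tail y (k + 1) := by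
    intro v hv
    obtain ⟨v₀, h₀, v₁, h₁, rfl⟩ := L.exists_even_add_odd v
    have e0 := h.even_mul hL hNb hns h₀ (hsplit _ hv _ h₀ _ h₁ rfl)
    have e1 := h.odd_mul hL hNb h₁
    refine ⟨?_, fun k hk w hw => ?_⟩
    · rw [map_add]; exact Submodule.add_mem _ e0.1 e1.2.1
    · rw [map_add]; exact Submodule.add_mem _ (e0.2 k w hw) (e1.2.2 k hk w hw)
  have hKN : K = N := by
    -- K is an ideal because it contains N ⊇ [L,L]; once it is nilpotent, maximality gives K = N.
    refine hN.maximal K ⟨?_, fun u v _ => hNK (hNb _ _), fun u v _ => hNK (hNb _ _)⟩ ?_ hNK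
    · refine le_antisymm (fun v hv => ?_) (sup_le inf_le_left inf_le_left)
      obtain ⟨v₀, h₀, v₁, h₁, rfl⟩ := L.exists_even_add_odd v
      exact Submodule.add_mem_sup ⟨hsplit _ hv _ h₀ _ h₁ rfl, h₀⟩ ⟨(h.odd_mul hL hNb h₁).1, h₁⟩
    -- Three products lead from K through N and `F` into the first step of the filtration; 2m - 1
    -- more reach step 2m, which is zero.
    · refine ⟨2 * m - 1 + 3, ?_⟩
      have h1 : L.lowerSeries K 1 ≤ N := Submodule.map₂_le.2 fun u _ v _ => hNb u v
      have h2 : L.lowerSeries K 2 ≤ F := Submodule.map₂_le.2 fun u hu v hv => by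
        obtain ⟨s, t, w, hw, rfl⟩ := h.mem_decomp hL (h1 hu)
        rw [map_add, map_add, map_smul, map_smul, LinearMap.add_apply, LinearMap.add_apply,
          LinearMap.smul_apply, LinearMap.smul_apply]
        exact Submodule.add_mem _ (Submodule.add_mem _ (Submodule.smul_mem _ _ hv)
          (Submodule.smul_mem _ _ (Submodule.mem_sup_left (hact v hv).1)))
          (Submodule.mem_sup_left (tail_anti one_le_two ((hact v hv).2 1 le_rfl w hw)))
      have h3 : ∀ k, L.lowerSeries K (k + 3) ≤ L.tail y (k + 1) := by
        intro k
        induction k with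
        | zero =>
          refine Submodule.map₂_le.2 fun u hu v hv => ?_
          obtain ⟨w, hw, w', hw', rfl⟩ := Submodule.mem_sup.1 (h2 hu)
          obtain ⟨t, rfl⟩ := Submodule.mem_span_singleton.1 hw'
          rw [map_add, map_smul, LinearMap.add_apply, LinearMap.smul_apply]
          exact Submodule.add_mem _ (tail_anti one_le_two ((hact v hv).2 1 le_rfl w hw))
            (Submodule.smul_mem _ _ (hact v hv).1)
        | succ k ih =>
          exact Submodule.map₂_le.2 fun u hu v hv => (hact v hv).2 (k + 1) (by omega) u (ih hu)
      rw [eq_bot_iff, ← h.tail_eq_bot hL]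
      refine (h3 _).trans_eq ?_
      rw [Nat.sub_add_cancel (by have := h.two_le; omega)]
  have hKtop : K ≠ ⊤ := fun hK' => hnil (by rw [← hK', hKN]; exact hN.isNilpotent)
  obtain ⟨v, hv⟩ : ∃ v, v ∉ K := by
    by_contra! hall
    exact hKtop (eq_top_iff.2 fun v _ => hall v)
  obtain ⟨v₀, h₀, v₁, h₁, rfl⟩ := L.exists_even_add_odd v
  obtain ⟨a, ha⟩ := h.odd_form (hNb y v₀) (mul_mem_odd_even h.y_odd h₀)
  have hyK : ∀ (q : ℂ[X]), q.coeff 0 = 0 → aeval (L.sqR y) q y ∈ F := fun q hq =>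
    Submodule.mem_sup_left (tail_anti one_le_two
      (aeval_X_mul_mem_tail hL h.y_odd (L.self_mem_tail y) hq))
  have ha0 : a.coeff 0 ≠ 0 := by
    intro h0
    refine hv (Submodule.add_mem _ ?_ (h.odd_mul hL hNb h₁).1)
    rw [hK, Submodule.mem_comap, ha]
    exact hyK a h0
  refine ⟨(a.coeff 0)⁻¹ • v₀, Submodule.smul_mem _ _ h₀, C (a.coeff 0)⁻¹ * a, ?_, ?_, ?_⟩
  · rw [map_smul, ha, aeval_C_mul_apply]
  · rw [coeff_C_mul, inv_mul_cancel₀ ha0]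
  · intro v
    obtain ⟨u₀, hu₀, u₁, hu₁, rfl⟩ := L.exists_even_add_odd v
    obtain ⟨b, hb⟩ := h.odd_form (hNb y u₀) (mul_mem_odd_even h.y_odd hu₀)
    -- Subtracting b(0)·x removes the y-coefficient of [y,u₀], so the difference lies in K = N.
    refine ⟨u₀ + u₁ - b.coeff 0 • (a.coeff 0)⁻¹ • v₀, ?_, b.coeff 0, by abel⟩
    rw [← hKN, add_sub_right_comm]
    refine Submodule.add_mem _ ?_ (h.odd_mul hL hNb hu₁).1
    rw [hK, Submodule.mem_comap, map_sub, map_smul, map_smul, ha, hb, ← aeval_C_mul_apply,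
      ← aeval_C_mul_apply, ← LinearMap.sub_apply, ← map_sub]
    refine hyK _ ?_
    simp [ha0]

end NilFrame

end Superalgebra

/-! ### Normalising the generators and the action of x. -/

namespace Superalgebra

variable {V : Type*} [AddCommGroup V] [Module ℂ V]

theorem isCoprime_X_pow_of_coeff_zero_ne {u : ℂ[X]} (hu : u.coeff 0 ≠ 0) (m : ℕ) :
    IsCoprime u (X ^ m) := by
  refine IsCoprime.pow_right ⟨C (u.coeff 0)⁻¹, -C (u.coeff 0)⁻¹ * u.divX, ?_⟩
  have h1 := divX_mul_X_add u
  have h2 : C (u.coeff 0)⁻¹ * C (u.coeff 0) = 1 := by rw [← C_mul, inv_mul_cancel₀ hu, C_1]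
  linear_combination -C (u.coeff 0)⁻¹ * h1 + h2

/-- Polynomials with constant coefficient `1` are invertible modulo `X ^ m`. -/
theorem exists_inverse_mod {u : ℂ[X]} (hu : u.coeff 0 = 1) (m : ℕ) :
    ∃ w : ℂ[X], ∀ j < m, (u * w).coeff j = (1 : ℂ[X]).coeff j := by
  obtain ⟨w, b, hw⟩ := isCoprime_X_pow_of_coeff_zero_ne (u := u) (by simp [hu]) m
  refine ⟨w, fun j hj => ?_⟩
  rw [← hw, mul_comm u w, coeff_add, coeff_mul_X_pow', if_neg (by omega), add_zero]

theorem coeff_X_mul_derivative (q : ℂ[X]) (j : ℕ) :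
    (X * derivative q).coeff j = j * q.coeff j := by
  rcases j with _ | j
  · simp
  · rw [coeff_X_mul, coeff_derivative]; push_cast; ring

theorem coeff_congr_mul {m : ℕ} {q r : ℂ[X]} (h : ∀ j < m, q.coeff j = r.coeff j) (s : ℂ[X]) :
    ∀ j < m, (q * s).coeff j = (r * s).coeff j := by
  have hd : X ^ m ∣ q - r := X_pow_dvd_iff.2 fun d hd => by simp [h d hd]
  have := X_pow_dvd_iff.1 (hd.mul_right s)
  intro j hj
  have := this j hj
  rwa [sub_mul, coeff_sub, sub_eq_zero] at this

/-- `N` together with an even element `x` is a superalgebra of the form `Ĝ(β, γ; b)`. -/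
structure SolvFrame (L : Superalgebra V) (N : Submodule ℂ V) (m : ℕ) (p : ℂ[X]) (γ b : ℂ)
    (y e x : V) : Prop extends NilFrame L N m p γ y e where
  mul_mem : ∀ u v, L.mul u v ∈ N
  top_form : ∀ v, ∃ w ∈ N, ∃ t : ℂ, v = w + t • x
  x_even : x ∈ L.part 0
  yx : L.mul y x = y
  ex : L.mul e x = b • e
  xx : L.mul x x = 0
  xy : L.mul x y = -y
  xe : L.mul x e = -(b • e) - (2 : ℂ) • aeval (L.sqR y) p.divX (L.mul y y)

namespace NilFrame

variable {L : Superalgebra V} {N : Submodule ℂ V} {m : ℕ} {p : ℂ[X]} {γ : ℂ} {y e : V}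
variable (h : NilFrame L N m p γ y e) (hL : L.IsLeibniz)
include h hL

theorem sq_aeval {u : ℂ[X]} (hu : u.coeff 0 = 1) :
    L.mul (aeval (L.sqR y) u y) (aeval (L.sqR y) u y) = aeval (L.sqR y) u (L.mul y y) := by
  rw [h.mul_aeval_y hL, hu, one_smul, aeval_mul_self hL h.y_odd]

/-- The operator D does not notice the change y ↦ u(D)y, because only u(0) = 1 enters. -/
theorem sqR_aeval {u : ℂ[X]} (hu : u.coeff 0 = 1) :
    L.sqR (aeval (L.sqR y) u y) = L.sqR y := by
  rw [sqR, h.sq_aeval hL hu, h.R_aeval_sq' hL, hu, one_smul]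

theorem pow_aeval_sq (u : ℂ[X]) :
    (L.sqR y ^ (m - 1)) (aeval (L.sqR y) u (L.mul y y)) =
      u.coeff 0 • (L.sqR y ^ (m - 1)) (L.mul y y) := by
  have hm := h.two_le
  rw [← aeval_X_pow (R := ℂ) (L.sqR y), ← aeval_mul_apply, ← aeval_C_mul_apply]
  refine h.aeval_sq_congr hL fun j hj => ?_
  rw [coeff_C_mul, coeff_X_pow, coeff_X_pow_mul']
  rcases Nat.lt_or_ge j (m - 1) with h1 | h1
  · rw [if_neg (by omega), if_neg (by omega), mul_zero]
  · rw [if_pos (by omega), if_pos (by omega), mul_one, show j - (m - 1) = 0 by omega]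

/-- D is unchanged and u is invertible modulo X^m, so both cyclic pieces and the polynomial p stay
the same. -/
theorem change_y {u : ℂ[X]} (hu : u.coeff 0 = 1) :
    NilFrame L N m p γ (aeval (L.sqR y) u y) e := by
  have hD := h.sqR_aeval hL hu
  have hE := h.sq_aeval hL hu
  have hm := h.two_le
  obtain ⟨w, hw⟩ := exists_inverse_mod hu m
  refine ⟨hm, h.coeff_zero, h.coeff_one, aeval_mem_part h.y_odd u h.y_odd, h.e_even, ?_, ?_, ?_,
    ?_, ?_, ?_⟩
  · rw [hD, ← aeval_X_pow (R := ℂ) (L.sqR y), aeval_comm_apply, aeval_X_pow, h.pow_apply, map_zero]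
  · rw [hD, h.aeval_y_mul_e hL, mul_comm, aeval_mul_apply]
  · rw [h.mul_aeval_y hL, h.ey, smul_zero]
  · rw [h.ee, hD, hE, h.pow_aeval_sq hL, hu, one_smul]
  · intro v
    rw [h.mem_iff, hD, hE]
    constructor
    · rintro ⟨q, r, s, rfl⟩
      refine ⟨q * w, r * w, s, ?_⟩
      rw [← aeval_mul_apply, ← aeval_mul_apply]
      have key : ∀ q : ℂ[X], ∀ j < m, (q * w * u).coeff j = q.coeff j := fun q j hj => by
        have := coeff_congr_mul hw q j hj
        rwa [one_mul, mul_comm, mul_comm u w, ← mul_assoc] at this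
      rw [h.aeval_y_congr (key q), h.aeval_sq_congr hL (key r)]
    · rintro ⟨q, r, s, rfl⟩
      exact ⟨q * u, r * u, s, by rw [aeval_mul_apply, aeval_mul_apply]⟩
  · intro q r s hqr
    rw [hD, hE, ← aeval_mul_apply, ← aeval_mul_apply] at hqr
    obtain ⟨h1, h2, h3⟩ := h.indep _ _ _ hqr
    have key : ∀ q : ℂ[X], (∀ j < m, (q * u).coeff j = 0) → ∀ j < m, q.coeff j = 0 :=
      fun q hq => X_pow_dvd_iff.1 ((isCoprime_X_pow_of_coeff_zero_ne (u := u) (by simp [hu]) m).symm.dvd_of_dvd_mul_right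
        (X_pow_dvd_iff.2 hq))
    exact ⟨key q h1, key r h2, h3⟩

/-- The top vector D^(m-1)[y,y] is a right annihilator and is killed by R_y and R_e, so adding it to
e alters none of the defining products. -/
theorem change_e (τ : ℂ) :
    NilFrame L N m p γ y (e + τ • (L.sqR y ^ (m - 1)) (L.mul y y)) := by
  have hm := h.two_le
  have e1 : ∀ v, L.mul v ((L.sqR y ^ (m - 1)) (L.mul y y)) = 0 := fun v => by
    rw [← R_apply, h.R_pow_sq hL]; rfl
  have e2 : ∀ (r : ℂ[X]) (s : ℂ), aeval (L.sqR y) r (L.mul y y) +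
      s • (e + τ • (L.sqR y ^ (m - 1)) (L.mul y y)) =
      aeval (L.sqR y) (r + C (s * τ) * X ^ (m - 1)) (L.mul y y) + s • e := fun r s => by
    rw [map_add, LinearMap.add_apply, aeval_C_mul_X_pow_apply]
    module
  refine ⟨hm, h.coeff_zero, h.coeff_one, h.y_odd, ?_, h.pow_apply, ?_, ?_, ?_, ?_, ?_⟩
  · refine Submodule.add_mem _ h.e_even (Submodule.smul_mem _ _ ?_)
    rw [← aeval_X_pow (R := ℂ) (L.sqR y)]
    exact aeval_mem_part h.y_odd _ h.sq_even
  · rw [map_add, map_smul, e1, smul_zero, add_zero, h.ye]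
  · rw [map_add, map_smul, LinearMap.add_apply, LinearMap.smul_apply, h.ey, h.pow_mul_y hL,
      smul_zero, add_zero]
  · rw [map_add, map_smul, e1, smul_zero, add_zero, map_add, map_smul, LinearMap.add_apply,
      LinearMap.smul_apply, h.ee, h.pow_mul_e hL, smul_zero, add_zero]
  · intro v
    rw [h.mem_iff]
    constructor
    · rintro ⟨q, r, s, rfl⟩
      refine ⟨q, r - C (s * τ) * X ^ (m - 1), s, ?_⟩
      rw [add_assoc, add_assoc, e2, sub_add_cancel]
    · rintro ⟨q, r, s, rfl⟩
      refine ⟨q, r + C (s * τ) * X ^ (m - 1), s, ?_⟩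
      rw [add_assoc, add_assoc, e2]
  · intro q r s hqr
    rw [add_assoc, e2, ← add_assoc] at hqr
    obtain ⟨h1, h2, rfl⟩ := h.indep _ _ _ hqr
    exact ⟨h1, by simpa using h2, rfl⟩

/-- An even element acting on `y` with eigenvalue `1` up to higher terms has an eigenvector. -/
theorem exists_eigen {x : V} (hx : x ∈ L.part 0) {a : ℂ[X]}
    (hyx : L.mul y x = aeval (L.sqR y) a y) (ha : a.coeff 0 = 1) :
    ∃ y', NilFrame L N m p γ y' e ∧ L.mul y' x = y' := by
  have hm := h.two_le
  have key : ∀ k : ℕ, ∃ y', NilFrame L N m p γ y' e ∧ ∃ a : ℂ[X],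
      L.mul y' x = aeval (L.sqR y') a y' ∧ ∀ j < k + 1, a.coeff j = (1 : ℂ[X]).coeff j := by
    intro k
    induction k with
    | zero => exact ⟨y, h, a, hyx, fun j hj => by obtain rfl : j = 0 := by omega
                                                  simpa using ha⟩
    | succ k ih =>
      obtain ⟨z, hz, a, hza, haj⟩ := ih
      -- R_x multiplies D^(k+1) by weight 2(k+1) relative to y; dividing the unwanted coefficient by
      -- this number makes the Euler term cancel it. The inverse `w` of `u` rewrites the result in
      -- terms of the new vector.
      set u : ℂ[X] := 1 - C (a.coeff (k + 1) / (2 * (k + 1))) * X ^ (k + 1) with hu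
      have hu0 : u.coeff 0 = 1 := by simp [hu]
      obtain ⟨w, hw⟩ := exists_inverse_mod hu0 m
      have hw0 : w.coeff 0 = 1 := by
        have := hw 0 (by omega)
        rwa [mul_coeff_zero, hu0, one_mul, coeff_one_zero] at this
      have ha0 : a.coeff 0 = 1 := by simpa using haj 0 (by omega)
      have hk : (k + 1 : ℂ) ≠ 0 := by exact_mod_cast Nat.succ_ne_zero k
      have hder : C (2 : ℂ) * (X * derivative u) = - (C (a.coeff (k + 1)) * X ^ (k + 1)) := by
        ext j
        rw [coeff_C_mul, coeff_X_mul_derivative, coeff_neg, coeff_C_mul, hu, coeff_sub, coeff_C_mul,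
          coeff_X_pow, Polynomial.coeff_one]
        split_ifs with h1 h2 h2
        · omega
        · rw [h1]; push_cast; field_simp; ring
        · rw [h2]; push_cast; field_simp; ring
        · simp
      refine ⟨aeval (L.sqR z) u z, hz.change_y hL hu0,
        a - C (a.coeff (k + 1)) * X ^ (k + 1) * w, ?_, ?_⟩
      · rw [hz.sqR_aeval hL hu0, ← aeval_mul_apply, hz.aeval_y_mul_even hL hx hza, ha0, mul_one,
          hder]
        refine hz.aeval_y_congr fun j hj => ?_
        have := coeff_congr_mul hw (C (a.coeff (k + 1)) * X ^ (k + 1)) j hj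
        have e1 : (a - C (a.coeff (k + 1)) * X ^ (k + 1) * w) * u =
          u * a - u * w * (C (a.coeff (k + 1)) * X ^ (k + 1)) := by ring
        rw [coeff_add, coeff_neg, e1, coeff_sub, this, one_mul, sub_eq_add_neg]
      · intro j hj
        rw [coeff_sub, mul_assoc, coeff_C_mul, coeff_X_pow_mul']
        rcases Nat.lt_or_ge j (k + 1) with h1 | h1
        · rw [if_neg (by omega), mul_zero, sub_zero, haj j h1]
        · obtain rfl : j = k + 1 := by omega
          simp [hw0, Polynomial.coeff_one]
  obtain ⟨z, hz, a, hza, haj⟩ := key m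
  refine ⟨z, hz, ?_⟩
  rw [hza, hz.aeval_y_congr (r := 1) fun j hj => haj j (by omega), map_one]
  rfl

-- The freedom used to normalise parameters: e occurs once in [y,e] and twice in [e,e].
omit hL in
theorem change_scale {s : ℂ} (hs : s ≠ 0) : NilFrame L N m (C s * p) (s ^ 2 * γ) y (s • e) := by
  refine ⟨h.two_le, by simp [h.coeff_zero], by simp [h.coeff_one], h.y_odd,
    Submodule.smul_mem _ _ h.e_even, h.pow_apply, ?_, ?_, ?_, ?_, ?_⟩
  · rw [map_smul, h.ye, aeval_C_mul_apply]
  · rw [map_smul, LinearMap.smul_apply, h.ey, smul_zero]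
  · rw [map_smul, map_smul, LinearMap.smul_apply, h.ee, smul_smul, smul_smul]
    ring_nf
  · intro v
    rw [h.mem_iff]
    constructor
    · rintro ⟨q, r, t, rfl⟩
      exact ⟨q, r, t / s, by rw [smul_smul, div_mul_cancel₀ _ hs]⟩
    · rintro ⟨q, r, t, rfl⟩
      exact ⟨q, r, t * s, by rw [smul_smul]⟩
  · intro q r t hqr
    rw [smul_smul] at hqr
    obtain ⟨h1, h2, h3⟩ := h.indep _ _ _ hqr
    exact ⟨h1, h2, (mul_eq_zero.1 h3).resolve_right hs⟩

/-- The even right annihilators in `N`. -/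
theorem even_annihilator (hns : (∃ j < m, p.coeff j ≠ 0) ∨ γ ≠ 0) {v : V} (hv : v ∈ N)
    (hv0 : v ∈ L.part 0) (hyv : L.mul y v = 0) (hev : L.mul e v = 0) :
    ∃ r : ℂ[X], r.coeff 0 = 0 ∧ v = aeval (L.sqR y) r (L.mul y y) := by
  have hm := h.two_le
  obtain ⟨r, s, rfl⟩ := h.even_form hv hv0
  rw [map_add, map_smul, h.mul_aeval_sq hL, h.ye, ← aeval_C_mul_apply, ← aeval_X (R := ℂ) (L.sqR y),
    ← aeval_C_mul_apply, ← LinearMap.add_apply, aeval_X, ← map_add] at hyv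
  rw [map_add, map_smul, h.mul_aeval_sq hL, R_apply, h.e_sq hL, smul_zero, zero_add, h.ee,
    smul_smul, ← aeval_C_mul_X_pow_apply] at hev
  have e1 := h.coeff_y hyv
  have e2 := h.coeff_sq hev (m - 1) (by omega)
  -- The coefficient of X isolates r(0), because p has no linear term.
  have hr : r.coeff 0 = 0 := by
    have := e1 1 (by omega)
    rwa [coeff_add, coeff_C_mul, coeff_C_mul, coeff_X_one, h.coeff_one, mul_one, mul_zero,
      add_zero] at this
  have hs : s = 0 := by
    rcases hns with ⟨j, hj, hj'⟩ | hγ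
    · have := e1 j hj
      rw [hr, C_0, zero_mul, zero_add, coeff_C_mul] at this
      exact (mul_eq_zero.1 this).resolve_right hj'
    · rw [coeff_C_mul, coeff_X_pow, if_pos rfl, mul_one] at e2
      exact (mul_eq_zero.1 e2).resolve_right hγ
  exact ⟨r, hr, by rw [hs, zero_smul, add_zero]⟩

theorem odd_annihilator {v : V} (hv : v ∈ N) (hv0 : v ∈ L.part 1) (hyv : L.mul y v = 0) :
    ∃ r : ℂ[X], r.coeff 0 = 0 ∧ v = aeval (L.sqR y) r y := by
  obtain ⟨q, rfl⟩ := h.odd_form hv hv0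
  refine ⟨q, ?_, rfl⟩
  rw [h.mul_aeval_y hL] at hyv
  have := h.coeff_sq (q := C (q.coeff 0)) (by
    rw [← mul_one (C (q.coeff 0)), aeval_C_mul_apply, map_one]; exact hyv) 0
    (by have := h.two_le; omega)
  simpa using this

/-- A nilradical `N` with a `NilFrame` has a complementary element `x` which acts diagonally, and
whose left action is then determined by its right action. -/
theorem exists_solvFrame (hN : L.IsNilradical N) (hnil : ¬ L.IsNilpotent ⊤)
    (hns : (∃ j < m, p.coeff j ≠ 0) ∨ γ ≠ 0) (hpm : p.coeff m = 0) :
    ∃ (b : ℂ) (y e x : V), SolvFrame L N m p γ b y e x ∧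
      (∀ j < m, b * p.coeff j = 2 * j * p.coeff j) ∧ b * γ = m * γ := by
  have hm := h.two_le
  have hNb : ∀ u v, L.mul u v ∈ N := fun u v =>
    hN.bracket_le (Submodule.apply_mem_map₂ _ Submodule.mem_top Submodule.mem_top)
  obtain ⟨x, hx, a, hyx, ha, htop⟩ := h.exists_complement hL hN hnil hns
  obtain ⟨y, h, hyx⟩ := h.exists_eigen hL hx hyx ha
  have hyx1 : L.mul y x = aeval (L.sqR y) (1 : ℂ[X]) y := by
    rw [hyx, map_one]; rfl
  obtain ⟨b, c', hb, hp, hγ⟩ := h.exists_e_mul_even hL hx hyx1 (hNb e x)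
  simp only [coeff_one_zero, mul_one] at hp hγ
  -- A nonzero p_j forces b = 2j with j < m, and a nonzero γ forces b = m; so b never equals the
  -- weight 2m of the top vector.
  have hb2 : 2 * (m : ℂ) - b ≠ 0 := by
    intro h0
    have hb' : b = 2 * m := by linear_combination -h0
    rcases hns with ⟨j, hj, hj'⟩ | hγ'
    · have := mul_right_cancel₀ hj' (hp j hj)
      rw [hb'] at this
      have : m = j := by exact_mod_cast mul_left_cancel₀ two_ne_zero this
      omega
    · have := mul_right_cancel₀ hγ' hγ
      rw [hb'] at this
      have h2 : ((2 * m : ℕ) : ℂ) = (m : ℕ) := by push_cast; exact this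
      have := Nat.cast_injective h2
      omega
  -- Chosen so that e plus τ times the top vector is an exact eigenvector of R_x.
  set τ := c' / (b - 2 * m) with hτ
  have hex : L.mul (e + τ • (L.sqR y ^ (m - 1)) (L.mul y y)) x =
      b • (e + τ • (L.sqR y ^ (m - 1)) (L.mul y y)) := by
    have hb3 : b - 2 * m ≠ 0 := fun h0 => hb2 (by linear_combination -h0)
    have : c' = τ * (b - 2 * m) := by rw [hτ, div_mul_cancel₀ _ hb3]
    rw [map_add, map_smul, LinearMap.add_apply, LinearMap.smul_apply, h.pow_mul_even hL hx hyx1,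
      hb, coeff_one_zero, this]
    module
  have h := h.change_e hL τ
  generalize e + τ • (L.sqR y ^ (m - 1)) (L.mul y y) = e at h hex
  clear hτ τ hb c'
  -- the square of `x`
  have hann : ∀ v, L.R v = 0 → ∀ u, L.mul u v = 0 := fun v hv u => by rw [← R_apply, hv]; rfl
  -- R_{[x,x]} is the commutator of R_x with itself, so [x,x] is a right annihilator.
  obtain ⟨r, hr0, hr⟩ := h.even_annihilator hL hns (hNb x x) (mul_mem_even_even hx hx)
    (by rw [← R_apply, hL.R_mul_even hx, sub_self]; rfl)
    (by rw [← R_apply, hL.R_mul_even hx, sub_self]; rfl)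
  -- The weight of D^j[y,y] is 2(j+1) ≠ 0, so [x,x] has a preimage under R_x among right
  -- annihilators. Subtracting it from x leaves R_x unchanged and makes the square vanish.
  obtain ⟨r', hr'⟩ : ∃ r' : ℂ[X], ∀ j, 2 * (j + 1) * r'.coeff j = r.coeff j := by
    clear hr hr0
    induction r using Polynomial.induction_on' with
    | add p q hp hq =>
      obtain ⟨p', hp'⟩ := hp
      obtain ⟨q', hq'⟩ := hq
      exact ⟨p' + q', fun j => by rw [coeff_add, coeff_add, mul_add, hp', hq']⟩
    | monomial k c =>
      have hk : (k + 1 : ℂ) ≠ 0 := by exact_mod_cast Nat.succ_ne_zero k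
      refine ⟨monomial k (c / (2 * (k + 1))), fun j => ?_⟩
      rw [coeff_monomial, coeff_monomial]
      split_ifs with hj
      · rw [← hj]; field_simp
      · rw [mul_zero]
  have hr'0 : r'.coeff 0 = 0 := by
    have := hr' 0
    rw [hr0] at this
    simpa using this
  have hu : L.R (aeval (L.sqR y) r' (L.mul y y)) = 0 := by
    rw [h.R_aeval_sq' hL, hr'0, zero_smul]
  have hux : L.mul (aeval (L.sqR y) r' (L.mul y y)) x = L.mul x x := by
    rw [h.aeval_sq_mul_even hL hx hyx1, hr]
    refine h.aeval_sq_congr hL fun j _ => ?_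
    rw [← hr', coeff_one_zero, mul_add, coeff_add, coeff_add, C_1, mul_one, coeff_C_mul,
      coeff_X_mul_derivative]
    ring
  obtain ⟨u, hu_def⟩ : ∃ u, u = aeval (L.sqR y) r' (L.mul y y) := ⟨_, rfl⟩
  have huN : u ∈ N := hu_def ▸ h.aeval_sq_mem r'
  have hu0 : u ∈ L.part 0 := hu_def ▸ aeval_mem_part h.y_odd r' h.sq_even
  rw [← hu_def] at hu hux
  have hxu0 : x - u ∈ L.part 0 := Submodule.sub_mem _ hx hu0
  have hR : L.R (x - u) = L.R x := by rw [map_sub, hu, sub_zero]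
  have hmul : ∀ v, L.mul v (x - u) = L.mul v x := fun v => by rw [← R_apply, hR]; rfl
  have hxx : L.mul (x - u) (x - u) = 0 := by
    rw [hmul, map_sub, LinearMap.sub_apply, hux, sub_self]
  have htop' : ∀ v, ∃ w ∈ N, ∃ t : ℂ, v = w + t • (x - u) := fun v => by
    obtain ⟨w, hw, t, rfl⟩ := htop v
    exact ⟨w + t • u, Submodule.add_mem _ hw (Submodule.smul_mem _ _ huN), t, by module⟩
  rw [← hmul y] at hyx hyx1
  rw [← hmul e] at hex
  generalize x - u = x at hxu0 hxx htop' hyx hex hyx1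
  clear hR hmul hux hu0 huN hu hu_def hr'0 hr' hr hr0 htop r' r u
  have hx := hxu0
  -- the product `[x, y]`
  have hxy : L.mul x y = -y := by
    obtain ⟨w, hw⟩ : ∃ w, w = L.mul x y + L.mul y x := ⟨_, rfl⟩
    have hRw : L.R w = 0 := by
      rw [hw, map_add, hL.R_mul_even hx, hL.R_even_mul hx]; abel
    obtain ⟨q, hq0, hq⟩ := h.odd_annihilator hL (hw ▸ Submodule.add_mem _ (hNb _ _) (hNb _ _))
      (hw ▸ Submodule.add_mem _ (mul_mem_even_odd hx h.y_odd) (mul_mem_odd_even h.y_odd hx))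
      (hann w hRw y)
    have hxyw : L.mul x y = w - y := by rw [hw, hyx]; abel
    -- Since [x,x] = 0, [x,y] has weight 1, hence so has `w`. As D^j y has weight 2j+1 and q(0) = 0,
    -- `w` vanishes.
    have e1 := hL.mul_mul_even hx x y
    rw [hyx, hxx, LinearMap.map_zero, LinearMap.zero_apply, add_zero, hxyw, map_sub,
      LinearMap.sub_apply, hyx, sub_left_inj, hq, h.aeval_y_mul_even hL hx hyx1] at e1
    have hq' : ∀ j < m, q.coeff j = (0 : ℂ[X]).coeff j := fun j hj => by
      have := h.coeff_y_eq e1 j hj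
      rw [coeff_one_zero, mul_one, mul_one, coeff_add, coeff_C_mul, coeff_X_mul_derivative,
        add_eq_left] at this
      rcases j with _ | j
      · exact hq0
      · have h2 : (j + 1 : ℂ) ≠ 0 := Nat.cast_add_one_ne_zero j
        rw [Polynomial.coeff_zero]
        simpa [h2] using this
    rw [hxyw, hq, h.aeval_y_congr hq', map_zero, LinearMap.zero_apply, zero_sub]
  -- the product `[x, e]`
  refine ⟨b, y, e, x, ⟨h, hNb, htop', hx, hyx, hex, hxx, hxy, ?_⟩, hp, hγ⟩
  obtain ⟨w, hw⟩ : ∃ w, w = L.mul x e + L.mul e x := ⟨_, rfl⟩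
  have hRw : L.R w = 0 := by
    rw [hw, map_add, hL.R_mul_even hx, hL.R_even_mul hx]; abel
  obtain ⟨r, hr0, hr⟩ := h.even_annihilator hL hns (hw ▸ Submodule.add_mem _ (hNb _ _) (hNb _ _))
    (hw ▸ Submodule.add_mem _ (mul_mem_even_even hx h.e_even) (mul_mem_even_even h.e_even hx))
    (hann w hRw y) (hann w hRw e)
  have hxew : L.mul x e = w - b • e := by rw [hw, hex]; abel
  -- Expanding [[x,y],e] determines all coefficients of `r` but the top one, which right
  -- multiplication by y cannot see.
  have e1 := hL.mul_mul_even h.e_even x y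
  rw [hxy, map_neg, LinearMap.neg_apply, h.ye, ← h.ye, h.ye, hxew, map_sub, LinearMap.sub_apply,
    map_smul, LinearMap.smul_apply, h.ey, smul_zero, sub_zero, h.mul_aeval_y hL, h.coeff_zero,
    zero_smul, zero_add, hr, h.aeval_sq_mul_y hL, ← aeval_C_mul_apply, ← LinearMap.neg_apply,
    ← map_neg] at e1
  -- The top coefficient is settled by weights: [x,e] has weight b ≠ 2m, so it is zero. This agrees
  -- with the general formula because p_m = 0.
  have e2 := hL.mul_mul_even hx x e
  rw [hxx, LinearMap.map_zero, LinearMap.zero_apply, add_zero, hex, map_smul, hxew, map_sub,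
    LinearMap.sub_apply, map_smul, LinearMap.smul_apply, hex, smul_sub, sub_left_inj, hr,
    h.aeval_sq_mul_even hL hx hyx1, ← aeval_C_mul_apply] at e2
  have hr2 : ∀ j < m, r.coeff j = (C (-2) * p.divX).coeff j := fun j hj => by
    rw [coeff_C_mul, coeff_divX]
    rcases Nat.lt_or_ge (j + 1) m with h1 | h1
    · have := h.coeff_y_eq e1 (j + 1) h1
      rw [coeff_neg, coeff_C_mul, coeff_X_mul] at this
      linear_combination (-2 : ℂ) * this
    · have hj1 : j + 1 = m := by omega
      have := h.coeff_sq_eq e2 j hj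
      rw [coeff_one_zero, mul_one, C_1, mul_add, mul_one, coeff_add, coeff_add, coeff_C_mul,
        coeff_X_mul_derivative, coeff_C_mul] at this
      have h0 : r.coeff j = 0 := by
        refine (mul_eq_zero.1 (?_ : (2 * (m : ℂ) - b) * r.coeff j = 0)).resolve_left hb2
        rw [← hj1]
        push_cast
        linear_combination this
      rw [h0, hj1, hpm, mul_zero]
  rw [hxew, hr, h.aeval_sq_congr hL hr2, aeval_C_mul_apply]
  module

end NilFrame

end Superalgebra

/-! ### Invariants of a presentation. -/

namespace Superalgebra

variable {V : Type*} [AddCommGroup V] [Module ℂ V]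

namespace NilFrame

variable {L : Superalgebra V} {N : Submodule ℂ V} {m : ℕ} {p : ℂ[X]} {γ : ℂ} {y e : V}
variable (h : NilFrame L N m p γ y e)
include h

theorem coeff_e_eq {q r : ℂ[X]} {s t : ℂ}
    (hq : aeval (L.sqR y) q (L.mul y y) + s • e = aeval (L.sqR y) r (L.mul y y) + t • e) :
    s = t := by
  have := (h.indep 0 (q - r) (s - t) (by
    rw [map_zero, LinearMap.zero_apply, zero_add, map_sub, LinearMap.sub_apply, sub_smul,
      ← add_sub_add_comm, hq, sub_self])).2.2
  exact sub_eq_zero.1 this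

theorem aeval_sq_eq_of_coeff (hL : L.IsLeibniz) {c : ℂ[X]} (hc : ∀ j < m - 1, c.coeff j = 0) :
    aeval (L.sqR y) c (L.mul y y) = c.coeff (m - 1) • (L.sqR y ^ (m - 1)) (L.mul y y) := by
  rw [← aeval_C_mul_X_pow_apply]
  refine h.aeval_sq_congr hL fun j hj => ?_
  rw [coeff_C_mul, coeff_X_pow]
  split_ifs with hj'
  · rw [hj', mul_one]
  · rw [hc j (by omega), mul_zero]

end NilFrame

/-- The parameters of two presentations of `L` agree up to the action of the torus. -/
theorem SolvFrame.param_eq {L : Superalgebra V} (hL : L.IsLeibniz) {N N' : Submodule ℂ V} {m : ℕ}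
    {p p' : ℂ[X]} {γ γ' b b' : ℂ} {y y' e e' x x' : V} (F : SolvFrame L N m p γ b y e x)
    (F' : SolvFrame L N' m p' γ' b' y' e' x') (hb : b ≠ 0) :
    b = b' ∧ ∃ u d : ℂ, u ≠ 0 ∧ d ≠ 0 ∧ (∀ j < m, p.coeff j * u ^ j = d * p'.coeff j) ∧
      γ * u ^ m = d ^ 2 * γ' := by
  have H := F.toNilFrame
  have H' := F'.toNilFrame
  have hm := H.two_le
  -- y = [y,x] is a product, hence lies in the other nilradical; likewise e below, by b ≠ 0.
  obtain ⟨a, ha⟩ := H'.odd_form (F.yx ▸ F'.mul_mem y x) H.y_odd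
  have heN : e ∈ N' := by
    have : e = b⁻¹ • L.mul e x := by rw [F.ex, smul_smul, inv_mul_cancel₀ hb, one_smul]
    rw [this]
    exact Submodule.smul_mem _ _ (F'.mul_mem _ _)
  obtain ⟨c, d, hc⟩ := H'.even_form heN H.e_even
  have hmy : ∀ v, L.mul v y = a.coeff 0 • L.mul v y' := fun v => by rw [ha, H'.mul_aeval_y hL]
  have hE : L.mul y y = aeval (L.sqR y') (C (a.coeff 0) * a) (L.mul y' y') := by
    rw [hmy, aeval_C_mul_apply]
    conv_lhs => rw [ha]
    rw [aeval_mul_self hL H'.y_odd]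
  set a₀ := a.coeff 0 with ha₀
  have hD : L.sqR y = (a₀ ^ 2) • L.sqR y' := by
    rw [sqR, hE, H'.R_aeval_sq' hL, coeff_C_mul, ← ha₀, pow_two]
  have ha0 : a₀ ≠ 0 := by
    intro h0
    have := H.coeff_sq (q := 1) (by rw [hE, h0]; simp) 0 (by omega)
    simp at this
  have hcj : ∀ j < m - 1, c.coeff j = 0 := by
    have := H.ey
    rw [hmy, hc, map_add, map_smul, LinearMap.add_apply, LinearMap.smul_apply, H'.ey, smul_zero,
      add_zero, H'.aeval_sq_mul_y hL] at this
    have := H'.coeff_y ((smul_eq_zero.1 ((smul_eq_zero.1 this).resolve_left ha0)).resolve_left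
      (by norm_num))
    intro j hj
    have := this (j + 1) (by omega)
    rwa [coeff_X_mul] at this
  have hc0 : c.coeff 0 = 0 := hcj 0 (by omega)
  have hme : ∀ v, L.mul v e = d • L.mul v e' := fun v => by
    rw [hc, map_add, map_smul, H'.mul_aeval_sq hL, hc0, zero_smul, zero_add]
  have hctop := H'.aeval_sq_eq_of_coeff hL hcj
  have htop : (L.sqR y ^ (m - 1)) (L.mul y y) =
      (a₀ ^ 2) ^ m • (L.sqR y' ^ (m - 1)) (L.mul y' y') := by
    rw [hD, _root_.smul_pow, LinearMap.smul_apply, hE, H'.pow_aeval_sq hL, coeff_C_mul, ← ha₀,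
      smul_smul, ← pow_two, ← pow_succ, Nat.sub_add_cancel (by omega)]
  -- The torus parameters: u = a₀² is the ratio of D to D', and d is the coefficient of e' in e.
  have hu : a₀ ^ 2 ≠ 0 := pow_ne_zero 2 ha0
  have hd : d ≠ 0 := by
    intro h0
    rw [h0, zero_smul, add_zero, hctop] at hc
    have := (H.indep 0 (C (-c.coeff (m - 1) * ((a₀ ^ 2) ^ m)⁻¹) * X ^ (m - 1)) 1 (by
      rw [aeval_C_mul_X_pow_apply, htop, smul_smul, mul_assoc,
        inv_mul_cancel₀ (pow_ne_zero m hu), mul_one, one_smul, neg_smul, ← hc]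
      simp)).2.2
    exact one_ne_zero this
  -- the element `x`
  obtain ⟨w, hw, t, hx⟩ := F'.top_form x
  have hw0 : w ∈ L.part 0 := by
    have := Submodule.sub_mem _ F.x_even (Submodule.smul_mem _ t F'.x_even)
    rwa [hx, add_sub_cancel_right] at this
  obtain ⟨r, s, hr⟩ := H'.even_form hw hw0
  have hyx' : L.mul y' x' = aeval (L.sqR y') (1 : ℂ[X]) y' := by rw [F'.yx, map_one]; rfl
  -- Compare the y'-coefficients in [y,x] = y: the N'-part of x contributes only higher terms.
  have ht : t = 1 := by
    have := F.yx
    rw [hx, hr, ha] at this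
    simp only [map_add, map_smul] at this
    rw [H'.mul_aeval_sq hL, H'.aeval_y_mul_e hL, H'.aeval_y_mul_even hL F'.x_even hyx',
      ← aeval_X_mul_apply, ← aeval_C_mul_apply, ← aeval_C_mul_apply, ← aeval_C_mul_apply,
      ← LinearMap.add_apply, ← LinearMap.add_apply, ← map_add, ← map_add] at this
    have := H'.coeff_y_eq this 0 (by omega)
    simp [H'.coeff_zero, mul_coeff_zero] at this
    rw [← ha₀] at this
    exact mul_right_cancel₀ ha0 (this.trans (one_mul a₀).symm)
  rw [ht, one_smul] at hx
  have hbb : b = b' := by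
    have := F.ex
    rw [hx, hr, hc] at this
    simp only [map_add, map_smul, LinearMap.add_apply, LinearMap.smul_apply] at this
    rw [H'.mul_aeval_sq hL, H'.mul_aeval_sq hL, R_apply, R_apply e', H'.e_sq hL,
      H'.aeval_sq_mul_e hL, H'.ee, H'.aeval_sq_mul_even hL F'.x_even hyx', F'.ex] at this
    have e1 : L.mul (aeval (L.sqR y') c (L.mul y' y')) (L.mul y' y') =
      aeval (L.sqR y') (X * c) (L.mul y' y') := by rw [aeval_X_mul_apply]; rfl
    rw [e1] at this
    have e2 := H'.coeff_e_eq
      (q := C (r.coeff 0) * (X * c) + C s * (c * p') + C s * C d * C γ' * X ^ (m - 1) +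
        (c * (1 + C ((1 : ℂ[X]).coeff 0)) + C (2 * (1 : ℂ[X]).coeff 0) * (X * derivative c)))
      (r := C b * c) (s := d * b') (t := b * d) (by
        rw [aeval_C_mul_apply, mul_smul b d, ← smul_add, ← this]
        simp only [map_add, LinearMap.add_apply, ← C_mul, aeval_C_mul_apply,
          aeval_X_pow]
        module)
    rw [mul_comm] at e2
    exact (mul_right_cancel₀ hd e2).symm
  refine ⟨hbb, a₀ ^ 2, d, hu, hd, ?_, ?_⟩
  · have := H.ye
    rw [hme, ha, H'.aeval_y_mul_e hL, ← ha, hD] at this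
    have e1 : aeval ((a₀ ^ 2) • L.sqR y') p = aeval (L.sqR y') (p.comp (C (a₀ ^ 2) * X)) := by
      rw [aeval_comp, map_mul, aeval_C, aeval_X, Algebra.algebraMap_eq_smul_one, smul_mul_assoc,
        one_mul]
    rw [e1, ha, ← aeval_mul_apply, ← aeval_C_mul_apply] at this
    have e2 := H'.coeff_y_eq this
    -- y = a(D')y', so the comparison of [y,e] carries a factor a; it is a unit modulo X^m since
    -- a(0) ≠ 0.
    have e3 : X ^ m ∣ (p.comp (C (a₀ ^ 2) * X) - C d * p') * a := X_pow_dvd_iff.2 fun j hj => by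
      have := e2 j hj
      rw [show (p.comp (C (a₀ ^ 2) * X) - C d * p') * a = p.comp (C (a₀ ^ 2) * X) * a -
        C d * (a * p') by ring, coeff_sub, this, sub_self]
    have e4 := (isCoprime_X_pow_of_coeff_zero_ne ha0 m).symm.dvd_of_dvd_mul_right e3
    intro j hj
    have := X_pow_dvd_iff.1 e4 j hj
    rwa [coeff_sub, comp_C_mul_X_coeff, coeff_C_mul, sub_eq_zero] at this
  · have := H.ee
    rw [hme, hc, hctop, map_add, map_smul, map_smul, LinearMap.add_apply, LinearMap.smul_apply,
      LinearMap.smul_apply, H'.pow_mul_e hL, H'.ee, smul_zero, zero_add, htop, smul_smul, smul_smul,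
      smul_smul, ← aeval_C_mul_X_pow_apply, ← aeval_C_mul_X_pow_apply] at this
    have := H'.coeff_sq_eq this (m - 1) (by omega)
    rw [coeff_C_mul, coeff_C_mul, coeff_X_pow, if_pos rfl, mul_one, mul_one] at this
    linear_combination -this

end Superalgebra

/-! ### Multiplication tables and the Leibniz identity for them. -/

namespace Superalgebra

variable {V W : Type*} [AddCommGroup V] [Module ℂ V] [AddCommGroup W] [Module ℂ W]

/-- Families `Y 0, Y 1, …`, `E 0, E 1, …` and a vector `e` multiply like
`y 1, y 2, …`, `e 1, e 3, e 4, …` and `e 2` in `G(β, γ)`. -/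
structure NilTable (A : Superalgebra V) (n : ℕ) (β : ℕ → ℂ) (γ : ℂ) (Y E : ℕ → V) (e : V) :
    Prop where
  Y_odd : ∀ j, Y j ∈ A.part 1
  E_even : ∀ j, E j ∈ A.part 0
  e_even : e ∈ A.part 0
  Y_zero : ∀ j, n ≤ j + 1 → Y j = 0
  E_zero : ∀ j, n ≤ j + 1 → E j = 0
  YY : ∀ j, A.mul (Y j) (Y 0) = E j
  EY : ∀ j, A.mul (E j) (Y 0) = (1 / 2 : ℂ) • Y (j + 1)
  YE : ∀ j, A.mul (Y j) (E 0) = Y (j + 1)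
  EE : ∀ j, A.mul (E j) (E 0) = E (j + 1)
  Ye : ∀ j, A.mul (Y j) e = ∑ k ∈ Finset.Icc 4 n, β k • Y (j + (k - 2))
  Ee : ∀ j, A.mul (E j) e = ∑ k ∈ Finset.Icc 4 n, β k • E (j + (k - 2))
  eY : A.mul e (Y 0) = 0
  eE : A.mul e (E 0) = 0
  ee : A.mul e e = γ • E (n - 2)

/-- The families of `NilTable` and a vector `x` multiply like the basis of `Ĝ(β, γ; b)`. -/
structure SolvTable (A : Superalgebra V) (n : ℕ) (β : ℕ → ℂ) (γ b : ℂ) (Y E : ℕ → V) (e x : V) :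
    Prop extends NilTable A n β γ Y E e where
  x_even : x ∈ A.part 0
  mul_Y : ∀ j u, A.mul u (Y (j + 1)) = 0
  mul_E : ∀ j u, A.mul u (E (j + 1)) = 0
  Yx : ∀ j, A.mul (Y j) x = (2 * j + 1 : ℂ) • Y j
  Ex : ∀ j, A.mul (E j) x = (2 * j + 2 : ℂ) • E j
  ex : A.mul e x = b • e
  xx : A.mul x x = 0
  xY : A.mul x (Y 0) = -Y 0
  xE : A.mul x (E 0) = (-2 : ℂ) • E 0
  xe : A.mul x e = (-b) • e + (-2 : ℂ) • ∑ k ∈ Finset.Icc 4 n, β k • E (k - 3)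
  span_eq_top : Submodule.span ℂ (Set.range E ∪ {e, x}) ⊔ Submodule.span ℂ (Set.range Y) = ⊤

namespace NilTable

variable {A : Superalgebra V} {n : ℕ} {β : ℕ → ℂ} {γ : ℂ} {Y E : ℕ → V} {e : V}

theorem map (T : NilTable A n β γ Y E e) {B : Superalgebra W} (F : V →ₗ[ℂ] W)
    (hF : ∀ a, ∀ v ∈ A.part a, F v ∈ B.part a) (hmul : ∀ u v, F (A.mul u v) = B.mul (F u) (F v)) :
    NilTable B n β γ (fun j => F (Y j)) (fun j => F (E j)) (F e) where
  Y_odd j := hF _ _ (T.Y_odd j)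
  E_even j := hF _ _ (T.E_even j)
  e_even := hF _ _ T.e_even
  Y_zero j hj := by rw [T.Y_zero j hj, map_zero]
  E_zero j hj := by rw [T.E_zero j hj, map_zero]
  YY j := by rw [← hmul, T.YY]
  EY j := by rw [← hmul, T.EY, map_smul]
  YE j := by rw [← hmul, T.YE]
  EE j := by rw [← hmul, T.EE]
  Ye j := by rw [← hmul, T.Ye, map_sum]; simp only [map_smul]
  Ee j := by rw [← hmul, T.Ee, map_sum]; simp only [map_smul]
  eY := by rw [← hmul, T.eY, map_zero]
  eE := by rw [← hmul, T.eE, map_zero]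
  ee := by rw [← hmul, T.ee, map_smul]

end NilTable

namespace SolvTable

variable {A : Superalgebra V} {n : ℕ} {β : ℕ → ℂ} {γ b : ℂ} {Y E : ℕ → V} {e x : V}

/-- The spans lie in the homogeneous parts and together fill the space; as the parts meet trivially,
each part lies in its span. -/
theorem part_le (T : SolvTable A n β γ b Y E e x) :
    A.part 0 ≤ Submodule.span ℂ (Set.range E ∪ {e, x}) ∧
      A.part 1 ≤ Submodule.span ℂ (Set.range Y) := by
  have h0 : Submodule.span ℂ (Set.range E ∪ {e, x}) ≤ A.part 0 := by
    rw [Submodule.span_le]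
    rintro _ (⟨j, rfl⟩ | rfl | rfl)
    · exact T.E_even j
    · exact T.e_even
    · exact T.x_even
  have h1 : Submodule.span ℂ (Set.range Y) ≤ A.part 1 := by
    rw [Submodule.span_le]
    rintro _ ⟨j, rfl⟩
    exact T.Y_odd j
  constructor <;> intro v hv <;> have htop : v ∈ (⊤ : Submodule ℂ V) := Submodule.mem_top <;>
    rw [← T.span_eq_top] at htop <;> obtain ⟨u, hu, w, hw, rfl⟩ := Submodule.mem_sup.1 htop
  · have h2 := Submodule.sub_mem _ hv (h0 hu)
    rw [add_sub_cancel_left] at h2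
    rwa [eq_zero_of_even_of_odd h2 (h1 hw), add_zero]
  · have h2 := Submodule.sub_mem _ hv (h1 hw)
    rw [add_sub_cancel_right] at h2
    rwa [eq_zero_of_even_of_odd (h0 hu) h2, zero_add]

theorem le_of_mem (T : SolvTable A n β γ b Y E e x) {S : Submodule ℂ V} (hY : ∀ j, Y j ∈ S)
    (hE : ∀ j, E j ∈ S) (he : e ∈ S) (hx : x ∈ S) (v : V) : v ∈ S := by
  have : (⊤ : Submodule ℂ V) ≤ S := by
    rw [← T.span_eq_top, sup_le_iff, Submodule.span_le, Submodule.span_le]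
    refine ⟨?_, ?_⟩
    · rintro _ (⟨j, rfl⟩ | rfl | rfl)
      exacts [hE j, he, hx]
    · rintro _ ⟨j, rfl⟩
      exact hY j
  exact this Submodule.mem_top

theorem hom_ext (T : SolvTable A n β γ b Y E e x) {F G : V →ₗ[ℂ] W} (hY : ∀ j, F (Y j) = G (Y j))
    (hE : ∀ j, F (E j) = G (E j)) (he : F e = G e) (hx : F x = G x) : F = G :=
  LinearMap.ext fun v => T.le_of_mem (S := LinearMap.eqLocus F G) hY hE he hx v

/-- A linear bijection which matches the families is an isomorphism. -/
theorem isomorphic (T : SolvTable A n β γ b Y E e x) {B : Superalgebra W} {Y' E' : ℕ → W}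
    {e' x' : W} (T' : SolvTable B n β γ b Y' E' e' x') (f : V ≃ₗ[ℂ] W) (hY : ∀ j, f (Y j) = Y' j)
    (hE : ∀ j, f (E j) = E' j) (he : f e = e') (hx : f x = x') : A.Isomorphic B := by
  refine ⟨f, ?_, ?_⟩
  · have h0 : A.part 0 ≤ (B.part 0).comap f.toLinearMap := T.part_le.1.trans (by
      rw [Submodule.span_le]
      rintro _ (⟨j, rfl⟩ | rfl | rfl)
      · simpa [hE] using T'.E_even j
      · simpa [he] using T'.e_even
      · simpa [hx] using T'.x_even)
    have h1 : A.part 1 ≤ (B.part 1).comap f.toLinearMap := T.part_le.2.trans (by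
      rw [Submodule.span_le]
      rintro _ ⟨j, rfl⟩
      simpa [hY] using T'.Y_odd j)
    intro a v hv
    fin_cases a
    exacts [h0 hv, h1 hv]
  · have key : A.mul.compr₂ f.toLinearMap = B.mul.compl₁₂ f.toLinearMap f.toLinearMap := by
      refine T.hom_ext (fun i => T.hom_ext ?_ ?_ ?_ ?_) (fun i => T.hom_ext ?_ ?_ ?_ ?_)
        (T.hom_ext ?_ ?_ ?_ ?_) (T.hom_ext ?_ ?_ ?_ ?_) <;>
      first
      | intro j
        rcases j with _ | j <;>
          simp [hY, hE, he, hx, T.YY, T'.YY, T.EY, T'.EY, T.YE, T'.YE, T.EE, T'.EE, T.eY, T'.eY,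
            T.eE, T'.eE, T.mul_Y, T'.mul_Y, T.mul_E, T'.mul_E, T.xY, T'.xY, T.xE, T'.xE]
      | simp [hY, hE, he, hx, T.Ye, T'.Ye, T.Ee, T'.Ee, T.ee, T'.ee, T.Yx, T'.Yx, T.Ex, T'.Ex,
          T.ex, T'.ex, T.xx, T'.xx, T.xe, T'.xe]
    intro u v
    exact LinearMap.congr_fun (LinearMap.congr_fun key u) v

theorem map (T : SolvTable A n β γ b Y E e x) {B : Superalgebra W} (F : V ≃ₗ[ℂ] W)
    (hF : ∀ a, ∀ v ∈ A.part a, F v ∈ B.part a) (hmul : ∀ u v, F (A.mul u v) = B.mul (F u) (F v)) :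
    SolvTable B n β γ b (fun j => F (Y j)) (fun j => F (E j)) (F e) (F x) where
  toNilTable := T.toNilTable.map F.toLinearMap hF hmul
  x_even := hF _ _ T.x_even
  mul_Y j u := by rw [← F.apply_symm_apply u, ← hmul, T.mul_Y, map_zero]
  mul_E j u := by rw [← F.apply_symm_apply u, ← hmul, T.mul_E, map_zero]
  Yx j := by rw [← hmul, T.Yx, map_smul]
  Ex j := by rw [← hmul, T.Ex, map_smul]
  ex := by rw [← hmul, T.ex, map_smul]
  xx := by rw [← hmul, T.xx, map_zero]
  xY := by rw [← hmul, T.xY, map_neg]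
  xE := by rw [← hmul, T.xE, map_smul]
  xe := by rw [← hmul, T.xe]; simp
  span_eq_top := by
    have := congrArg (Submodule.map F.toLinearMap) T.span_eq_top
    rw [Submodule.map_sup, Submodule.map_span, Submodule.map_span, Submodule.map_top,
      LinearEquiv.range, Set.image_union, Set.image_pair, ← Set.range_comp, ← Set.range_comp] at this
    exact this

section Leibniz

variable (T : SolvTable A n β γ b Y E e x)
include T

theorem R_Y_zero {j : ℕ} (hj : j ≠ 0) : A.R (Y j) = 0 := by
  obtain ⟨k, rfl⟩ := Nat.exists_eq_succ_of_ne_zero hj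
  exact LinearMap.ext fun u => T.mul_Y k u

theorem R_E_zero {j : ℕ} (hj : j ≠ 0) : A.R (E j) = 0 := by
  obtain ⟨k, rfl⟩ := Nat.exists_eq_succ_of_ne_zero hj
  exact LinearMap.ext fun u => T.mul_E k u

theorem R_sum_Y (j : ℕ) : A.R (∑ k ∈ Finset.Icc 4 n, β k • Y (j + (k - 2))) = 0 := by
  rw [map_sum]
  refine Finset.sum_eq_zero fun k hk => ?_
  rw [map_smul, T.R_Y_zero (by have := (Finset.mem_Icc.1 hk).1; omega), smul_zero]

theorem R_sum_E (j : ℕ) : A.R (∑ k ∈ Finset.Icc 4 n, β k • E (j + (k - 2))) = 0 := by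
  rw [map_sum]
  refine Finset.sum_eq_zero fun k hk => ?_
  rw [map_smul, T.R_E_zero (by have := (Finset.mem_Icc.1 hk).1; omega), smul_zero]

theorem R_sum_E' : A.R (∑ k ∈ Finset.Icc 4 n, β k • E (k - 3)) = 0 := by
  rw [map_sum]
  refine Finset.sum_eq_zero fun k hk => ?_
  rw [map_smul, T.R_E_zero (by have := (Finset.mem_Icc.1 hk).1; omega), smul_zero]

theorem R_E_eq : A.R (E 0) = (2 : ℂ) • (A.R (Y 0) * A.R (Y 0)) := by
  refine T.hom_ext (fun j => ?_) (fun j => ?_) ?_ ?_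
  · simp [T.YY, T.YE, T.EY]
  · simp [T.YY, T.EE, T.EY]
  · simp [T.eE, T.eY]
  · simp [T.xE, T.xY, T.YY]

theorem R_Y_R_e (hn : 3 ≤ n) : A.R (Y 0) * A.R e = A.R e * A.R (Y 0) := by
  refine T.hom_ext (fun j => ?_) (fun j => ?_) ?_ ?_
  · simp [T.YY, T.Ye, T.Ee]
  · simp only [R_apply, Module.End.mul_apply, T.Ee, T.EY, map_smul, T.Ye,
      map_sum, Finset.smul_sum]
    refine Finset.sum_congr rfl fun k _ => ?_
    rw [smul_comm, show j + (k - 2) + 1 = j + 1 + (k - 2) by omega]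
  · simp [T.ee, T.eY, T.EY, T.Y_zero (n - 2 + 1) (by omega)]
  · simp only [R_apply, Module.End.mul_apply, T.xe, T.xY, map_add, map_smul, T.eY,
      map_sum, T.EY, map_neg, T.Ye, smul_zero, zero_add, Finset.smul_sum, ← Finset.sum_neg_distrib]
    refine Finset.sum_congr rfl fun k hk => ?_
    rw [show k - 3 + 1 = k - 2 by have := (Finset.mem_Icc.1 hk).1; omega]
    module

theorem R_x_R_Y : A.R x * A.R (Y 0) - A.R (Y 0) * A.R x = A.R (Y 0) := by
  refine T.hom_ext (fun j => ?_) (fun j => ?_) ?_ ?_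
  · simp only [LinearMap.sub_apply, Module.End.mul_apply, R_apply, T.YY, T.Ex, T.Yx, map_smul]
    module
  · simp only [LinearMap.sub_apply, Module.End.mul_apply, R_apply, T.EY, T.Ex, T.Yx, map_smul]
    push_cast
    module
  · simp [T.eY, T.ex]
  · simp [T.xx, T.xY, T.Yx]

/-- The commutator relation that carries the weight conditions on β and γ: each monomial in the
action of e must have weight b. -/
theorem R_x_R_e (hn : 3 ≤ n) (hβ : ∀ k, 4 ≤ k → k ≤ n → b * β k = 2 * ((k : ℂ) - 2) * β k)
    (hγ : b * γ = ((n : ℂ) - 1) * γ) : A.R x * A.R e - A.R e * A.R x = b • A.R e := by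
  refine T.hom_ext (fun j => ?_) (fun j => ?_) ?_ ?_
  · simp only [LinearMap.sub_apply, Module.End.mul_apply, R_apply, T.Ye, T.Yx, map_smul,
      LinearMap.smul_apply, map_sum, Finset.smul_sum,
      ← Finset.sum_sub_distrib]
    refine Finset.sum_congr rfl fun k hk => ?_
    obtain ⟨h4, hkn⟩ := Finset.mem_Icc.1 hk
    rw [smul_smul b, hβ k h4 hkn]
    push_cast [show 2 ≤ k by omega]
    module
  · simp only [LinearMap.sub_apply, Module.End.mul_apply, R_apply, T.Ee, T.Ex, map_smul,
      LinearMap.smul_apply, map_sum, Finset.smul_sum,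
      ← Finset.sum_sub_distrib]
    refine Finset.sum_congr rfl fun k hk => ?_
    obtain ⟨h4, hkn⟩ := Finset.mem_Icc.1 hk
    rw [smul_smul b, hβ k h4 hkn]
    push_cast [show 2 ≤ k by omega]
    module
  · simp only [LinearMap.sub_apply, Module.End.mul_apply, R_apply, T.ee, T.Ex, T.ex, map_smul,
      LinearMap.smul_apply, smul_smul, ← sub_smul]
    congr 1
    push_cast [show 2 ≤ n by omega]
    linear_combination (-2 : ℂ) * hγ
  · simp only [LinearMap.sub_apply, Module.End.mul_apply, R_apply, T.xx, T.xe, T.Ex, T.ex, map_smul,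
      LinearMap.smul_apply, map_sum, map_add, map_zero, sub_zero, smul_add]
    rw [smul_comm b (-b)]
    congr 1
    rw [smul_comm b (-2 : ℂ), Finset.smul_sum (r := b)]
    congr 1
    refine Finset.sum_congr rfl fun k hk => ?_
    obtain ⟨h4, hkn⟩ := Finset.mem_Icc.1 hk
    rw [smul_smul b, hβ k h4 hkn]
    push_cast [show 3 ≤ k by omega]
    module

/-- The superidentity is a bilinear relation between R_{[u,v]}, R_u and R_v, so it may be checked on
spanning vectors. All of these except `Y 0`, `E 0`, `e`, `x` are right annihilators, which leaves
the commutators of four operators. -/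
theorem isLeibniz (hn : 3 ≤ n) (hβ : ∀ k, 4 ≤ k → k ≤ n → b * β k = 2 * ((k : ℂ) - 2) * β k)
    (hγ : b * γ = ((n : ℂ) - 1) * γ) : A.IsLeibniz := by
  have iYe := T.R_Y_R_e hn
  have ixY := T.R_x_R_Y
  have ixe := T.R_x_R_e hn hβ hγ
  have iE := T.R_E_eq
  have iEe : A.R (E 0) * A.R e = A.R e * A.R (E 0) := by
    rw [iE, smul_mul_assoc, mul_smul_comm, mul_assoc, iYe, ← mul_assoc, iYe, mul_assoc]
  have iEY : A.R (E 0) * A.R (Y 0) = A.R (Y 0) * A.R (E 0) := by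
    rw [iE, smul_mul_assoc, mul_smul_comm, mul_assoc]
  have ixE : A.R x * A.R (E 0) - A.R (E 0) * A.R x = (2 : ℂ) • A.R (E 0) := by
    have h1 : A.R x * A.R (Y 0) = A.R (Y 0) * A.R x + A.R (Y 0) := by
      rw [add_comm]; exact sub_eq_iff_eq_add.1 ixY
    have h2 : A.R x * (A.R (Y 0) * A.R (Y 0)) =
        A.R (Y 0) * (A.R (Y 0) * A.R x) + (2 : ℂ) • (A.R (Y 0) * A.R (Y 0)) := by
      rw [← mul_assoc, h1, add_mul, mul_assoc, h1, mul_add, two_smul, add_assoc]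
    rw [iE, mul_smul_comm, h2, smul_mul_assoc, mul_assoc]
    module
  have cEe := sub_eq_zero.2 iEe
  have ceE := sub_eq_zero.2 iEe.symm
  have cEY := sub_eq_zero.2 iEY
  have cYE := sub_eq_zero.2 iEY.symm
  have cYe := sub_eq_zero.2 iYe
  have ceY := sub_eq_zero.2 iYe.symm
  have cYx : A.R (Y 0) * A.R x - A.R x * A.R (Y 0) = -A.R (Y 0) := by rw [← neg_sub, ixY]
  have cEx : A.R (E 0) * A.R x - A.R x * A.R (E 0) = -((2 : ℂ) • A.R (E 0)) := by
    rw [← neg_sub, ixE]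
  have cex : A.R e * A.R x - A.R x * A.R e = -(b • A.R e) := by rw [← neg_sub, ixe]
  -- [e,e] is a right annihilator because n ≥ 3 keeps it away from `E 0`.
  have hEz := T.R_E_zero (show n - 2 ≠ 0 by omega)
  have hs1 : ∀ j, A.R (Y (j + 1)) = 0 := fun j => T.R_Y_zero (Nat.succ_ne_zero j)
  have hs2 : ∀ j, A.R (E (j + 1)) = 0 := fun j => T.R_E_zero (Nat.succ_ne_zero j)
  have key : ∀ (s : ℂ) (G H : Set V), (∀ u ∈ G, ∀ v ∈ H, A.R (A.mul u v) =
      A.R v * A.R u - s • (A.R u * A.R v)) → ∀ u ∈ Submodule.span ℂ G, ∀ v ∈ Submodule.span ℂ H,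
      A.R (A.mul u v) = A.R v * A.R u - s • (A.R u * A.R v) := by
    intro s G H hGH u hu v hv
    refine Submodule.span_induction₂ (p := fun u v _ _ => A.R (A.mul u v) =
      A.R v * A.R u - s • (A.R u * A.R v)) (fun u v hu hv => hGH u hu v hv) ?_ ?_ ?_ ?_ ?_ ?_ hu hv
    · intro v _; simp
    · intro u _; simp
    · intro u u' v _ _ _ h1 h2
      rw [map_add, LinearMap.add_apply, map_add, h1, h2, map_add, mul_add, add_mul, smul_add]
      abel
    · intro u v v' _ _ _ h1 h2
      rw [map_add, map_add, h1, h2, map_add, mul_add, add_mul, smul_add]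
      abel
    · intro r u v _ _ h1
      rw [map_smul, LinearMap.smul_apply, map_smul, h1, map_smul, smul_mul_assoc, mul_smul_comm,
        smul_sub, smul_comm s]
    · intro r u v _ _ h1
      rw [map_smul, map_smul, h1, map_smul, smul_mul_assoc, mul_smul_comm, smul_sub, smul_comm s]
  have k00 : ∀ u ∈ Set.range E ∪ {e, x}, ∀ v ∈ Set.range E ∪ {e, x}, A.R (A.mul u v) =
      A.R v * A.R u - (-1 : ℂ) ^ 0 • (A.R u * A.R v) := by
    simp only [pow_zero, one_smul]
    rintro _ (⟨_ | i, rfl⟩ | rfl | rfl) _ (⟨_ | j, rfl⟩ | rfl | rfl) <;>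
    simp only [T.mul_E, T.EE, T.Ee, T.Ex, T.eE, T.ee, T.ex, T.xE, T.xe, T.xx, hs2, hEz, map_zero,
      map_add, map_smul, T.R_sum_E, T.R_sum_E', zero_mul, mul_zero, sub_self, smul_zero, cEe, ceE,
      ixE, ixe, cEx, cex] <;> norm_num
  have k01 : ∀ u ∈ Set.range E ∪ {e, x}, ∀ v ∈ Set.range Y, A.R (A.mul u v) =
      A.R v * A.R u - (-1 : ℂ) ^ 0 • (A.R u * A.R v) := by
    simp only [pow_zero, one_smul]
    rintro _ (⟨_ | i, rfl⟩ | rfl | rfl) _ ⟨_ | j, rfl⟩ <;>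
    simp only [T.mul_Y, T.EY, T.eY, T.xY, hs1, hs2, map_zero, map_neg, map_smul, zero_mul, mul_zero,
      sub_self, smul_zero, cYE, cYe, cYx]
  have k10 : ∀ u ∈ Set.range Y, ∀ v ∈ Set.range E ∪ {e, x}, A.R (A.mul u v) =
      A.R v * A.R u - (-1 : ℂ) ^ 0 • (A.R u * A.R v) := by
    simp only [pow_zero, one_smul]
    rintro _ ⟨_ | i, rfl⟩ _ (⟨_ | j, rfl⟩ | rfl | rfl) <;>
    simp only [T.mul_E, T.YE, T.Ye, T.Yx, hs1, hs2, map_zero, map_smul, T.R_sum_Y, zero_mul,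
      mul_zero, sub_self, smul_zero, cEY, ceY, ixY]
    norm_num
  have k11 : ∀ u ∈ Set.range Y, ∀ v ∈ Set.range Y, A.R (A.mul u v) =
      A.R v * A.R u - (-1 : ℂ) ^ 1 • (A.R u * A.R v) := by
    simp only [pow_one]
    rintro _ ⟨_ | i, rfl⟩ _ ⟨_ | j, rfl⟩ <;>
    simp only [T.mul_Y, T.YY, hs1, hs2, map_zero, zero_mul, mul_zero, sub_self, smul_zero]
    rw [iE]
    module
  intro a c w u v hu hv
  have final : A.R (A.mul u v) = A.R v * A.R u - (-1 : ℂ) ^ (a.val * c.val) • (A.R u * A.R v) := by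
    fin_cases a <;> fin_cases c
    · exact key _ _ _ k00 u (T.part_le.1 hu) v (T.part_le.1 hv)
    · exact key _ _ _ k01 u (T.part_le.1 hu) v (T.part_le.2 hv)
    · exact key _ _ _ k10 u (T.part_le.2 hu) v (T.part_le.1 hv)
    · exact key _ _ _ k11 u (T.part_le.2 hu) v (T.part_le.2 hv)
  exact LinearMap.congr_fun final w

end Leibniz

end SolvTable

end Superalgebra

/-! ### Passing between frames and tables. -/

namespace Superalgebra

variable {V W : Type*} [AddCommGroup V] [Module ℂ V] [AddCommGroup W] [Module ℂ W]

/-- The polynomial `∑ β k • X ^ (k - 2)`. -/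
noncomputable def betaPoly (n : ℕ) (β : ℕ → ℂ) : ℂ[X] :=
  ∑ k ∈ Finset.Icc 4 n, C (β k) * X ^ (k - 2)

theorem coeff_betaPoly (n : ℕ) (β : ℕ → ℂ) (j : ℕ) :
    (betaPoly n β).coeff j = if 2 ≤ j ∧ j + 2 ≤ n then β (j + 2) else 0 := by
  simp only [betaPoly, finsetSum_coeff, coeff_C_mul, coeff_X_pow]
  have : ∀ k ∈ Finset.Icc 4 n, (β k * if j = k - 2 then (1 : ℂ) else 0) =
      if j + 2 = k then β k else 0 := fun k hk => by
    have := (Finset.mem_Icc.1 hk).1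
    by_cases h : j = k - 2
    · rw [if_pos h, if_pos (by omega), mul_one]
    · rw [if_neg h, if_neg (by omega), mul_zero]
  rw [Finset.sum_congr rfl this, Finset.sum_ite_eq]
  simp only [Finset.mem_Icc]
  congr 1
  simp only [eq_iff_iff]
  omega

theorem aeval_betaPoly_apply (n : ℕ) (β : ℕ → ℂ) (D : Module.End ℂ V) (v : V) :
    aeval D (betaPoly n β) v = ∑ k ∈ Finset.Icc 4 n, β k • (D ^ (k - 2)) v := by
  rw [betaPoly, map_sum, LinearMap.sum_apply]
  exact Finset.sum_congr rfl fun k _ => aeval_C_mul_X_pow_apply _ _ _ _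

theorem aeval_divX_betaPoly_apply (n : ℕ) (β : ℕ → ℂ) (D : Module.End ℂ V) (v : V) :
    aeval D (betaPoly n β).divX v = ∑ k ∈ Finset.Icc 4 n, β k • (D ^ (k - 3)) v := by
  have : (betaPoly n β).divX = ∑ k ∈ Finset.Icc 4 n, C (β k) * X ^ (k - 3) := by
    have h : betaPoly n β = (∑ k ∈ Finset.Icc 4 n, C (β k) * X ^ (k - 3)) * X := by
      rw [betaPoly, Finset.sum_mul]
      refine Finset.sum_congr rfl fun k hk => ?_
      rw [mul_assoc, ← pow_succ, show k - 3 + 1 = k - 2 by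
        have := (Finset.mem_Icc.1 hk).1; omega]
    ext j
    rw [coeff_divX, h, coeff_mul_X]
  rw [this, map_sum, LinearMap.sum_apply]
  exact Finset.sum_congr rfl fun k _ => aeval_C_mul_X_pow_apply _ _ _ _

theorem aeval_apply_eq_sum {D : Module.End ℂ V} {v : V} {m : ℕ} (h : (D ^ m) v = 0) (q : ℂ[X]) :
    aeval D q v = ∑ j ∈ Finset.range m, q.coeff j • (D ^ j) v := by
  rw [aeval_apply_congr h (q := ∑ j ∈ Finset.range m, C (q.coeff j) * X ^ j), map_sum,
    LinearMap.sum_apply]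
  · exact Finset.sum_congr rfl fun k _ => aeval_C_mul_X_pow_apply _ _ _ _
  · intro j hj
    simp only [finsetSum_coeff, coeff_C_mul, coeff_X_pow, mul_ite, mul_one, mul_zero,
      Finset.sum_ite_eq, Finset.mem_range, if_pos hj]

/-- Linear independence of the nonzero members of the families of a `NilTable`. -/
def TableIndep (n : ℕ) (Y E : ℕ → V) (e : V) : Prop :=
  ∀ (a b : ℕ → ℂ) (s : ℂ), ∑ j ∈ Finset.range (n - 1), a j • Y j +
    ∑ j ∈ Finset.range (n - 1), b j • E j + s • e = 0 →
      (∀ j < n - 1, a j = 0) ∧ (∀ j < n - 1, b j = 0) ∧ s = 0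

theorem TableIndep.map {n : ℕ} {Y E : ℕ → V} {e : V} (h : TableIndep n Y E e) {F : V →ₗ[ℂ] W}
    (hF : Function.Injective F) : TableIndep n (fun j => F (Y j)) (fun j => F (E j)) (F e) := by
  intro a b s hs
  refine h a b s (hF ?_)
  simpa using hs

section

variable {L : Superalgebra V} {n : ℕ} {β : ℕ → ℂ} {γ b : ℂ} {Y E : ℕ → V} {e x : V}

theorem NilTable.pow_Y (T : NilTable L n β γ Y E e) (j : ℕ) : (L.sqR (Y 0) ^ j) (Y 0) = Y j := by
  induction j with
  | zero => rfl
  | succ j ih => rw [pow_succ', Module.End.mul_apply, ih, sqR, T.YY, R_apply, T.YE]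

theorem NilTable.pow_E (T : NilTable L n β γ Y E e) (j : ℕ) : (L.sqR (Y 0) ^ j) (E 0) = E j := by
  induction j with
  | zero => rfl
  | succ j ih => rw [pow_succ', Module.End.mul_apply, ih, sqR, T.YY, R_apply, T.EE]

theorem NilTable.nilFrame (T : NilTable L n β γ Y E e) (hn : 3 ≤ n) (hind : TableIndep n Y E e)
    {N : Submodule ℂ V} (hN : N = Submodule.span ℂ (Set.range Y ∪ Set.range E ∪ {e})) :
    NilFrame L N (n - 1) (betaPoly n β) γ (Y 0) e := by
  have hY : (L.sqR (Y 0) ^ (n - 1)) (Y 0) = 0 := by rw [T.pow_Y, T.Y_zero _ (by omega)]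
  have hE : (L.sqR (Y 0) ^ (n - 1)) (E 0) = 0 := by rw [T.pow_E, T.E_zero _ (by omega)]
  refine ⟨by omega, ?_, ?_, T.Y_odd 0, T.e_even, hY, ?_, T.eY, ?_, ?_, ?_⟩
  · rw [coeff_betaPoly, if_neg (by omega)]
  · rw [coeff_betaPoly, if_neg (by omega)]
  · rw [aeval_betaPoly_apply, T.Ye]
    simp only [T.pow_Y, zero_add]
  · rw [T.YY, T.ee, T.pow_E, Nat.sub_sub]
  · intro v
    rw [hN, T.YY]
    constructor
    · intro hv
      refine Submodule.span_induction (p := fun v _ => ∃ (q r : ℂ[X]) (s : ℂ),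
        v = aeval (L.sqR (Y 0)) q (Y 0) + aeval (L.sqR (Y 0)) r (E 0) + s • e) ?_
        ⟨0, 0, 0, by simp⟩ ?_ ?_ hv
      · rintro _ ((⟨j, rfl⟩ | ⟨j, rfl⟩) | rfl)
        · exact ⟨X ^ j, 0, 0, by rw [aeval_X_pow, T.pow_Y]; simp⟩
        · exact ⟨0, X ^ j, 0, by rw [aeval_X_pow, T.pow_E]; simp⟩
        · exact ⟨0, 0, 1, by simp⟩
      · rintro _ _ _ _ ⟨q, r, s, rfl⟩ ⟨q', r', s', rfl⟩
        exact ⟨q + q', r + r', s + s', by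
          simp only [map_add, LinearMap.add_apply, add_smul]; abel⟩
      · rintro c _ _ ⟨q, r, s, rfl⟩
        exact ⟨C c * q, C c * r, c * s, by
          rw [aeval_C_mul_apply, aeval_C_mul_apply, smul_add, smul_add, smul_smul]⟩
    · rintro ⟨q, r, s, rfl⟩
      rw [aeval_apply_eq_sum hY, aeval_apply_eq_sum hE]
      simp only [T.pow_Y, T.pow_E]
      refine Submodule.add_mem _ (Submodule.add_mem _ (Submodule.sum_mem _ fun j _ =>
        Submodule.smul_mem _ _ (Submodule.subset_span ?_)) (Submodule.sum_mem _ fun j _ =>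
        Submodule.smul_mem _ _ (Submodule.subset_span ?_)))
        (Submodule.smul_mem _ _ (Submodule.subset_span ?_))
      · exact Or.inl (Or.inl ⟨j, rfl⟩)
      · exact Or.inl (Or.inr ⟨j, rfl⟩)
      · exact Or.inr rfl
  · intro q r s hqr
    rw [T.YY, aeval_apply_eq_sum hY, aeval_apply_eq_sum hE] at hqr
    simp only [T.pow_Y, T.pow_E] at hqr
    exact hind _ _ s hqr

theorem SolvTable.solvFrame (T : SolvTable L n β γ b Y E e x) (hn : 3 ≤ n)
    (hind : TableIndep n Y E e) :
    SolvFrame L (Submodule.span ℂ (Set.range Y ∪ Set.range E ∪ {e})) (n - 1) (betaPoly n β) γ b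
      (Y 0) e x := by
  set N := Submodule.span ℂ (Set.range Y ∪ Set.range E ∪ {e}) with hN
  have memY : ∀ j, Y j ∈ N := fun j => Submodule.subset_span (Or.inl (Or.inl ⟨j, rfl⟩))
  have memE : ∀ j, E j ∈ N := fun j => Submodule.subset_span (Or.inl (Or.inr ⟨j, rfl⟩))
  have meme : e ∈ N := Submodule.subset_span (Or.inr rfl)
  refine ⟨T.toNilTable.nilFrame hn hind rfl, ?_, ?_, T.x_even, ?_, T.ex, T.xx, T.xY, ?_⟩
  · intro u v
    have hs : ∀ {f : ℕ → V} {t : Finset ℕ} {c : ℕ → ℂ}, (∀ j, f j ∈ N) →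
        ∑ k ∈ t, c k • f k ∈ N := fun hf =>
      Submodule.sum_mem _ fun k _ => Submodule.smul_mem _ _ (hf k)
    refine T.le_of_mem (S := N.comap (L.mul.flip v)) ?_ ?_ ?_ ?_ u
    · intro i
      refine T.le_of_mem (S := N.comap (L.mul (Y i))) ?_ ?_ ?_ ?_ v
      · rintro (_ | j)
        · simpa [T.YY] using memE i
        · simp [T.mul_Y]
      · rintro (_ | j)
        · simpa [T.YE] using memY (i + 1)
        · simp [T.mul_E]
      · simpa [T.Ye] using hs fun k => memY (i + (k - 2))
      · simpa [T.Yx] using Submodule.smul_mem _ _ (memY i)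
    · intro i
      refine T.le_of_mem (S := N.comap (L.mul (E i))) ?_ ?_ ?_ ?_ v
      · rintro (_ | j)
        · simpa only [Submodule.mem_comap, T.EY] using Submodule.smul_mem _ _ (memY (i + 1))
        · simp [T.mul_Y]
      · rintro (_ | j)
        · simpa [T.EE] using memE (i + 1)
        · simp [T.mul_E]
      · simpa [T.Ee] using hs fun k => memE (i + (k - 2))
      · simpa [T.Ex] using Submodule.smul_mem _ _ (memE i)
    · refine T.le_of_mem (S := N.comap (L.mul e)) ?_ ?_ ?_ ?_ v
      · rintro (_ | j)
        · simp [T.eY]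
        · simp [T.mul_Y]
      · rintro (_ | j)
        · simp [T.eE]
        · simp [T.mul_E]
      · simpa only [Submodule.mem_comap, T.ee] using Submodule.smul_mem _ _ (memE _)
      · simpa only [Submodule.mem_comap, T.ex] using Submodule.smul_mem _ _ meme
    · refine T.le_of_mem (S := N.comap (L.mul x)) ?_ ?_ ?_ ?_ v
      · rintro (_ | j)
        · simpa only [Submodule.mem_comap, T.xY] using Submodule.neg_mem _ (memY 0)
        · simp [T.mul_Y]
      · rintro (_ | j)
        · simpa only [Submodule.mem_comap, T.xE] using Submodule.smul_mem _ _ (memE 0)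
        · simp [T.mul_E]
      · simpa only [Submodule.mem_comap, T.xe] using Submodule.add_mem _
          (Submodule.smul_mem _ _ meme) (Submodule.smul_mem _ _ (hs fun k => memE (k - 3)))
      · simp [T.xx]
  · refine T.le_of_mem (S := { carrier := {v | ∃ w ∈ N, ∃ t : ℂ, v = w + t • x}
                               zero_mem' := ⟨0, Submodule.zero_mem _, 0, by simp⟩
                               add_mem' := ?_
                               smul_mem' := ?_ }) ?_ ?_ ?_ ?_
    · rintro _ _ ⟨w, hw, t, rfl⟩ ⟨w', hw', t', rfl⟩
      exact ⟨w + w', Submodule.add_mem _ hw hw', t + t', by module⟩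
    · rintro c _ ⟨w, hw, t, rfl⟩
      exact ⟨c • w, Submodule.smul_mem _ _ hw, c * t, by module⟩
    · exact fun j => ⟨Y j, memY j, 0, by simp⟩
    · exact fun j => ⟨E j, memE j, 0, by simp⟩
    · exact ⟨e, meme, 0, by simp⟩
    · exact ⟨0, Submodule.zero_mem _, 1, by simp⟩
  · simpa using T.Yx 0
  · rw [T.xe, T.YY, aeval_divX_betaPoly_apply]
    simp only [T.pow_E]
    module

/-- A frame records only products of generators; the Leibniz identity propagates them along the
powers of D to the whole table. -/
theorem SolvFrame.solvTable (hL : L.IsLeibniz) {N : Submodule ℂ V} {y : V} (hn : 3 ≤ n)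
    (F : SolvFrame L N (n - 1) (betaPoly n β) γ b y e x) :
    SolvTable L n β γ b (fun j => (L.sqR y ^ j) y) (fun j => (L.sqR y ^ j) (L.mul y y)) e x := by
  have H := F.toNilFrame
  have hE := H.pow_sq hL
  have hyx : L.mul y x = aeval (L.sqR y) (1 : ℂ[X]) y := by rw [F.yx, map_one]; rfl
  have hge : ∀ {v : V}, (L.sqR y ^ (n - 1)) v = 0 → ∀ j, n ≤ j + 1 → (L.sqR y ^ j) v = 0 := by
    intro v hv j hj
    obtain ⟨i, rfl⟩ : ∃ i, j = i + (n - 1) := ⟨j - (n - 1), by omega⟩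
    rw [pow_add, Module.End.mul_apply, hv, map_zero]
  have hpow : ∀ (j : ℕ) (v : V), (L.sqR y ^ j) v = aeval (L.sqR y) (X ^ j : ℂ[X]) v := fun j v => by
    rw [aeval_X_pow]
  have hder : ∀ j : ℕ, (X * derivative (X ^ j) : ℂ[X]) = C (j : ℂ) * X ^ j := fun j => by
    ext i
    rw [coeff_X_mul_derivative, coeff_C_mul, coeff_X_pow]
    split_ifs with h
    · rw [h]
    · simp
  refine
  { Y_odd := fun j => ?_
    E_even := fun j => ?_
    e_even := H.e_even
    Y_zero := hge H.pow_apply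
    E_zero := hge hE
    YY := fun j => ?_
    EY := fun j => ?_
    YE := fun j => ?_
    EE := fun j => ?_
    Ye := fun j => ?_
    Ee := fun j => ?_
    eY := H.ey
    eE := H.e_sq hL
    ee := ?_
    x_even := F.x_even
    mul_Y := fun j u => ?_
    mul_E := fun j u => ?_
    Yx := fun j => ?_
    Ex := fun j => ?_
    ex := F.ex
    xx := F.xx
    xY := F.xy
    xE := ?_
    xe := ?_
    span_eq_top := ?_ }
  · rw [hpow]; exact aeval_mem_part H.y_odd _ H.y_odd
  · rw [hpow]; exact aeval_mem_part H.y_odd _ H.sq_even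
  · simp only [hpow, pow_zero, Module.End.one_apply]
    exact aeval_mul_self hL H.y_odd _ _
  · simp only [pow_zero, Module.End.one_apply]
    rw [hpow, H.aeval_sq_mul_y hL, ← pow_succ', hpow]
  · rw [pow_succ']; rfl
  · rw [pow_succ']; rfl
  · rw [hpow, H.aeval_y_mul_e hL, aeval_mul_apply, aeval_betaPoly_apply, map_sum]
    refine Finset.sum_congr rfl fun k _ => ?_
    rw [map_smul, pow_add, Module.End.mul_apply, aeval_X_pow]
  · rw [hpow, H.aeval_sq_mul_e hL, aeval_mul_apply, aeval_betaPoly_apply, map_sum]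
    refine Finset.sum_congr rfl fun k _ => ?_
    rw [map_smul, pow_add, Module.End.mul_apply, aeval_X_pow]
  · rw [H.ee, Nat.sub_sub]
  · simp only [hpow]
    rw [H.mul_aeval_y hL]; simp
  · simp only [hpow]
    rw [H.mul_aeval_sq hL]; simp
  · simp only [hpow]
    rw [H.aeval_y_mul_even hL F.x_even hyx, hder, ← aeval_C_mul_apply]
    congr 2
    simp only [coeff_one_zero, map_add, map_mul, C_1]
    ring
  · simp only [hpow]
    rw [H.aeval_sq_mul_even hL F.x_even hyx, hder, ← aeval_C_mul_apply]
    congr 2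
    simp only [coeff_one_zero, map_add, map_mul, C_1]
    rw [show (C 2 : ℂ[X]) = 1 + 1 by rw [← C_1, ← C_add]; norm_num]
    ring
  · simp only [pow_zero, Module.End.one_apply]
    -- The superidentity gives [x,[y,y]] = 2[[x,y],y], and [x,y] = -y.
    have := hL.mul_mul_odd H.y_odd H.y_odd x
    rw [F.xy, map_neg, LinearMap.neg_apply, sub_neg_eq_add] at this
    rw [eq_sub_of_add_eq this.symm]
    module
  · rw [F.xe, aeval_divX_betaPoly_apply]
    module
  · refine eq_top_iff.2 fun v _ => ?_
    obtain ⟨w, hw, t, rfl⟩ := F.top_form v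
    obtain ⟨q, r, s, rfl⟩ := (H.mem_iff w).1 hw
    rw [aeval_apply_eq_sum H.pow_apply, aeval_apply_eq_sum hE]
    refine Submodule.add_mem _ (Submodule.add_mem _ (Submodule.add_mem _ ?_ ?_) ?_) ?_
    · exact Submodule.mem_sup_right (Submodule.sum_mem _ fun j _ => Submodule.smul_mem _ _
        (Submodule.subset_span ⟨j, rfl⟩))
    · exact Submodule.mem_sup_left (Submodule.sum_mem _ fun j _ => Submodule.smul_mem _ _
        (Submodule.subset_span (Or.inl ⟨j, rfl⟩)))
    · exact Submodule.mem_sup_left (Submodule.smul_mem _ _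
        (Submodule.subset_span (Or.inr (Or.inl rfl))))
    · exact Submodule.mem_sup_left (Submodule.smul_mem _ _
        (Submodule.subset_span (Or.inr (Or.inr rfl))))

end

end Superalgebra

/-! ### The explicit bases of G and Ĝ. -/

namespace Superalgebra

/-- The basis vectors `y 1, y 2, …`. -/
noncomputable def ySeq (S : Set Gen) (j : ℕ) : Space S := vec S (.y (j + 1))

/-- The basis vectors `e 1, e 3, e 4, …`. -/
noncomputable def eSeq (S : Set Gen) (j : ℕ) : Space S := vec S (.e (if j = 0 then 1 else j + 2))

theorem vec_apply {S : Set Gen} (g h : Gen) (hh : h ∈ S) :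
    vec S g ⟨h, hh⟩ = open Classical in if g = h then 1 else 0 := by
  classical
  unfold vec
  split_ifs with h1 h2 h2
  · subst h2; simp
  · rw [Finsupp.single_apply, if_neg (by simpa using h2)]
  · subst h2; exact absurd hh h1
  · rfl

theorem vec_of_notMem {S : Set Gen} {g : Gen} (h : g ∉ S) : vec S g = 0 := by
  unfold vec; rw [dif_neg h]

theorem ofTable_mul_vec {S : Set Gen} {T : Gen → Gen → Space S}
    {hT : ∀ g h, T g h ∈ spacePart S (g.parity + h.parity)} {g h : Gen} (hg : g ∈ S) (hh : h ∈ S) :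
    (ofTable S T hT).mul (vec S g) (vec S h) = T g h := by
  unfold vec
  rw [dif_pos hg, dif_pos hh]
  simp [ofTable]

theorem space_le_of_vec_mem {S : Set Gen} {P : Submodule ℂ (Space S)}
    (h : ∀ g ∈ S, vec S g ∈ P) (v : Space S) : v ∈ P := by
  induction v using Finsupp.induction_linear with
  | zero => exact P.zero_mem
  | add f g hf hg => exact P.add_mem hf hg
  | single g c =>
    have := P.smul_mem c (h g.1 g.2)
    unfold vec at this
    rwa [dif_pos g.2, Finsupp.smul_single, smul_eq_mul, mul_one] at this

section

variable {n : ℕ} {S : Set Gen} (hS : nilGens n ⊆ S) (hSe : ∀ i, Gen.e i ∈ S → 1 ≤ i ∧ i ≤ n)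
  (hSy : ∀ j, Gen.y j ∈ S → 1 ≤ j ∧ j + 1 ≤ n)

include hSy in
theorem ySeq_zero (j : ℕ) (hj : n ≤ j + 1) : ySeq S j = 0 :=
  vec_of_notMem fun h => by have := hSy _ h; omega

include hSe in
theorem eSeq_zero (hn : 3 ≤ n) (j : ℕ) (hj : n ≤ j + 1) : eSeq S j = 0 :=
  vec_of_notMem fun h => by
    have := hSe _ h
    split_ifs at this <;> omega

theorem eSeq_succ (j : ℕ) : eSeq S (j + 1) = vec S (.e (j + 3)) := by simp [eSeq]

theorem eSeq_pos {j : ℕ} (hj : j ≠ 0) : eSeq S j = vec S (.e (j + 2)) := by simp [eSeq, hj]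

-- The uniform relations hold for every index because basis vectors out of range are zero: the terms
-- cut off by the ranges in `gTable` are exactly those that vanish.
include hS hSe hSy in
theorem nilTable_ofTable (hn : 3 ≤ n) {β : ℕ → ℂ} {γ : ℂ} {T : Gen → Gen → Space S}
    {hT : ∀ g h, T g h ∈ spacePart S (g.parity + h.parity)}
    (hTg : ∀ g ∈ nilGens n, ∀ h ∈ nilGens n, T g h = gTable S n β γ g h) :
    NilTable (ofTable S T hT) n β γ (ySeq S) (eSeq S) (vec S (.e 2)) := by
  have memY : ∀ j, j + 1 < n → Gen.y (j + 1) ∈ nilGens n := fun j hj =>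
    Or.inr ⟨j + 1, by omega, by omega, rfl⟩
  have memE : ∀ j, 1 ≤ j → j ≤ n → Gen.e j ∈ nilGens n := fun j h1 h2 => Or.inl ⟨j, h1, h2, rfl⟩
  have hmul : ∀ g ∈ nilGens n, ∀ h ∈ nilGens n,
      (ofTable S T hT).mul (vec S g) (vec S h) = gTable S n β γ g h := fun g hg h hh => by
    rw [ofTable_mul_vec (hS hg) (hS hh), hTg g hg h hh]
  have Y0 := ySeq_zero hSy
  have E0 := eSeq_zero hSe hn
  have m1 := memE 1 le_rfl (by omega)
  have m2 := memE 2 (by omega) (by omega)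
  have my := memY 0 (by omega)
  have ve : ∀ i, n < i → vec S (.e i) = 0 := fun i hi => vec_of_notMem fun h => by
    have := hSe _ h; omega
  have vy : ∀ i, n < i + 1 → vec S (.y i) = 0 := fun i hi => vec_of_notMem fun h => by
    have := hSy _ h; omega
  have eS0 : eSeq S 0 = vec S (.e 1) := by simp [eSeq]
  have yS0 : ySeq S 0 = vec S (.y 1) := rfl
  refine ⟨fun j => vec_mem_spacePart rfl, fun j => vec_mem_spacePart rfl, vec_mem_spacePart rfl,
    Y0, E0, ?_, ?_, ?_, ?_, ?_, ?_, ?_, ?_, ?_⟩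
  · intro j
    rcases Nat.lt_or_ge (j + 1) n with hj | hj
    · rw [yS0, ySeq, hmul _ (memY j hj) _ my]
      rcases j with _ | j
      · simp [gTable, eS0]
      · simp [gTable, eSeq_succ, show j + 1 + 1 + 1 ≤ n by omega]
    · rw [Y0 j hj, E0 j hj, map_zero, LinearMap.zero_apply]
  · intro j
    rcases Nat.lt_or_ge (j + 1) n with hj | hj
    · rcases j with _ | j
      · rw [yS0, eS0, ySeq, hmul _ m1 _ my]
        simp [gTable]
      · rw [yS0, eSeq_succ, ySeq, hmul _ (memE _ (by omega) (by omega)) _ my]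
        rcases Nat.lt_or_ge (j + 3) n with hj' | hj'
        · simp [gTable, show j + 3 + 1 ≤ n by omega]
        · rw [vy _ (by omega)]
          simp [gTable, show ¬ j + 3 + 1 ≤ n by omega]
    · rw [Y0 (j + 1) (by omega), E0 j hj, map_zero, LinearMap.zero_apply, smul_zero]
  · intro j
    rcases Nat.lt_or_ge (j + 1) n with hj | hj
    · rw [eS0, ySeq, ySeq, hmul _ (memY j hj) _ m1]
      rcases Nat.lt_or_ge (j + 2) n with hj' | hj'
      · simp [gTable, show j + 1 + 2 ≤ n by omega]
      · rw [vy (j + 1 + 1) (by omega)]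
        simp [gTable, show ¬ j + 1 + 2 ≤ n by omega]
    · rw [Y0 j hj, Y0 (j + 1) (by omega), map_zero, LinearMap.zero_apply]
  · intro j
    rcases Nat.lt_or_ge (j + 1) n with hj | hj
    · rcases j with _ | j
      · rw [eS0, eSeq_succ, hmul _ m1 _ m1]
        simp [gTable]
      · rw [eS0, eSeq_succ, eSeq_succ, hmul _ (memE _ (by omega) (by omega)) _ m1]
        rcases Nat.lt_or_ge (j + 3) n with hj' | hj'
        · simp [gTable, show j + 3 + 1 ≤ n by omega]
        · rw [ve (j + 1 + 3) (by omega)]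
          simp [gTable, show ¬ j + 3 + 1 ≤ n by omega]
    · rw [E0 j hj, E0 (j + 1) (by omega), map_zero, LinearMap.zero_apply]
  · intro j
    rcases Nat.lt_or_ge (j + 1) n with hj | hj
    · rw [ySeq, hmul _ (memY j hj) _ m2]
      rcases Nat.lt_or_ge (j + 3) n with hj' | hj'
      · rw [gTable]
        rw [if_neg (by omega), if_pos (by omega), zero_add]
        refine Finset.sum_subset_zero_on_sdiff (Finset.Icc_subset_Icc_right (by omega)) ?_ ?_
        · intro k hk
          simp only [Finset.mem_sdiff, Finset.mem_Icc] at hk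
          rw [Y0 _ (by omega), smul_zero]
        · intro k hk
          rw [ySeq, show j + 1 + k - 2 = j + (k - 2) + 1 by
            have := (Finset.mem_Icc.1 hk).1; omega]
      · rw [gTable]
        rw [if_neg (by omega), if_neg (by omega), zero_add]
        refine (Finset.sum_eq_zero fun k hk => ?_).symm
        rw [Y0 _ (by have := (Finset.mem_Icc.1 hk).1; omega), smul_zero]
    · rw [Y0 _ hj, map_zero, LinearMap.zero_apply]
      exact (Finset.sum_eq_zero fun k hk => by rw [Y0 _ (by omega), smul_zero]).symm
  · intro j
    rcases Nat.lt_or_ge (j + 1) n with hj | hj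
    · rcases j with _ | j
      · rw [eS0, hmul _ m1 _ m2]
        rw [gTable]
        rw [if_neg (by omega), if_neg (by omega), if_pos (by omega), if_neg (by omega),
          if_neg (by omega)]
        simp only [zero_add, add_zero]
        refine Finset.sum_congr rfl fun k hk => ?_
        have := (Finset.mem_Icc.1 hk).1
        rw [eSeq_pos (by omega), Nat.sub_add_cancel (by omega)]
      · rw [eSeq_succ, hmul _ (memE _ (by omega) (by omega)) _ m2]
        rw [gTable]
        rcases Nat.lt_or_ge (j + 4) n with hj' | hj'
        · rw [if_neg (by omega), if_neg (by omega), if_neg (by omega), if_pos (by omega),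
            if_neg (by omega)]
          simp only [zero_add, add_zero]
          refine Finset.sum_subset_zero_on_sdiff (Finset.Icc_subset_Icc_right (by omega)) ?_ ?_
          · intro k hk
            simp only [Finset.mem_sdiff, Finset.mem_Icc] at hk
            rw [E0 _ (by omega), smul_zero]
          · intro k hk
            have := (Finset.mem_Icc.1 hk).1
            rw [eSeq_pos (by omega), show j + 3 + k - 2 = j + 1 + (k - 2) + 2 by omega]
        · rw [if_neg (by omega), if_neg (by omega), if_neg (by omega), if_neg (by omega),
            if_neg (by omega)]
          simp only [add_zero]
          refine (Finset.sum_eq_zero fun k hk => ?_).symm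
          rw [E0 _ (by have := (Finset.mem_Icc.1 hk).1; omega), smul_zero]
    · rw [E0 _ hj, map_zero, LinearMap.zero_apply]
      exact (Finset.sum_eq_zero fun k hk => by rw [E0 _ (by omega), smul_zero]).symm
  · rw [yS0, hmul _ m2 _ my]
    simp [gTable]
  · rw [eS0, hmul _ m2 _ m1]
    simp [gTable]
  · rw [eSeq_pos (by omega), hmul _ m2 _ m2, Nat.sub_add_cancel (by omega)]
    simp [gTable]

include hS in
theorem tableIndep_vec (hn : 3 ≤ n) : TableIndep n (ySeq S) (eSeq S) (vec S (.e 2)) := by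
  classical
  intro a b s h
  have hy : ∀ j < n - 1, Gen.y (j + 1) ∈ S := fun j hj => hS (Or.inr ⟨j + 1, by omega, by omega, rfl⟩)
  have he : ∀ j, 1 ≤ j → j ≤ n → Gen.e j ∈ S := fun j h1 h2 => hS (Or.inl ⟨j, h1, h2, rfl⟩)
  have hc : ∀ g (hg : g ∈ S), ∑ j ∈ Finset.range (n - 1), a j * (if Gen.y (j + 1) = g then 1 else 0)
      + ∑ j ∈ Finset.range (n - 1), b j * (if Gen.e (if j = 0 then 1 else j + 2) = g then 1 else 0)
      + s * (if Gen.e 2 = g then 1 else 0) = 0 := by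
    intro g hg
    have := DFunLike.congr_fun h ⟨g, hg⟩
    simpa only [Finsupp.add_apply, Finsupp.finsetSum_apply, Finsupp.smul_apply, smul_eq_mul,
      ySeq, eSeq, vec_apply, Finsupp.zero_apply] using this
  refine ⟨fun i hi => ?_, fun i hi => ?_, ?_⟩
  · have := hc _ (hy i hi)
    simpa [hi] using this
  · have := hc (.e (if i = 0 then 1 else i + 2)) (he _ (by split_ifs <;> omega)
      (by split_ifs <;> omega))
    have hinj : ∀ j, ((if j = 0 then 1 else j + 2) = (if i = 0 then 1 else i + 2)) ↔ j = i := by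
      intro j
      split_ifs <;> omega
    have hne : 2 ≠ (if i = 0 then 1 else i + 2) := by split_ifs <;> omega
    simpa [hinj, hne, hi] using this
  · have := hc _ (he 2 (by omega) (by omega))
    have hne : ∀ j, (if j = 0 then 1 else j + 2) ≠ 2 := by
      intro j
      split_ifs <;> omega
    simpa [hne] using this

end

theorem e_mem_solvGens {n i : ℕ} (h : Gen.e i ∈ solvGens n) : 1 ≤ i ∧ i ≤ n := by
  rcases h with h | ⟨j, h1, h2, h⟩ | ⟨j, h1, h2, h⟩
  · cases h
  · cases h; exact ⟨h1, h2⟩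
  · cases h

theorem y_mem_solvGens {n i : ℕ} (h : Gen.y i ∈ solvGens n) : 1 ≤ i ∧ i + 1 ≤ n := by
  rcases h with h | ⟨j, h1, h2, h⟩ | ⟨j, h1, h2, h⟩
  · cases h
  · cases h
  · cases h; exact ⟨h1, h2⟩

theorem nilTable_superG {n : ℕ} (hn : 3 ≤ n) (β : ℕ → ℂ) (γ : ℂ) :
    NilTable (superG n β γ) n β γ (ySeq (nilGens n)) (eSeq (nilGens n)) (vec (nilGens n) (.e 2)) :=
  nilTable_ofTable subset_rfl (fun _ h => e_mem_solvGens (Or.inr h))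
    (fun _ h => y_mem_solvGens (Or.inr h)) hn fun _ _ _ _ => rfl

theorem xTable_nil {S : Set Gen} {n : ℕ} {β : ℕ → ℂ} {b : ℂ} {g h : Gen} (hg : g ∈ nilGens n)
    (hh : h ∈ nilGens n) : xTable S n β b g h = 0 := by
  rcases hg with ⟨i, -, -, rfl⟩ | ⟨i, -, -, rfl⟩ <;>
    rcases hh with ⟨j, -, -, rfl⟩ | ⟨j, -, -, rfl⟩ <;> rfl

theorem span_superG {n : ℕ} :
    Submodule.span ℂ (Set.range (ySeq (nilGens n)) ∪ Set.range (eSeq (nilGens n)) ∪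
      {vec (nilGens n) (.e 2)}) = ⊤ := by
  refine eq_top_iff.2 fun v _ => space_le_of_vec_mem (fun g hg => Submodule.subset_span ?_) v
  rcases hg with ⟨i, h1, h2, rfl⟩ | ⟨i, h1, h2, rfl⟩
  · by_cases hi : i = 2
    · exact Or.inr (by rw [hi]; rfl)
    · refine Or.inl (Or.inr ⟨if i = 1 then 0 else i - 2, ?_⟩)
      split_ifs with h
      · simp [eSeq, h]
      · rw [eSeq_pos (by omega), Nat.sub_add_cancel (by omega)]
  · exact Or.inl (Or.inl ⟨i - 1, by rw [ySeq, Nat.sub_add_cancel h1]⟩)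

theorem solvTable_extG {n : ℕ} (hn : 3 ≤ n) (β : ℕ → ℂ) (γ b : ℂ) :
    SolvTable (extG n β γ b) n β γ b (ySeq (solvGens n)) (eSeq (solvGens n))
      (vec (solvGens n) (.e 2)) (vec (solvGens n) .x) := by
  have mx : Gen.x ∈ solvGens n := Or.inl rfl
  have memY : ∀ j, j + 1 < n → Gen.y (j + 1) ∈ solvGens n := fun j hj =>
    Or.inr (Or.inr ⟨j + 1, by omega, by omega, rfl⟩)
  have memE : ∀ j, 1 ≤ j → j ≤ n → Gen.e j ∈ solvGens n := fun j h1 h2 => Or.inr (Or.inl ⟨j, h1, h2, rfl⟩)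
  have hmul : ∀ g ∈ solvGens n, ∀ h ∈ solvGens n, (extG n β γ b).mul (vec (solvGens n) g) (vec (solvGens n) h) =
      gTable (solvGens n) n β γ g h + xTable (solvGens n) n β b g h := fun g hg h hh => ofTable_mul_vec hg hh
  have Y0 := ySeq_zero (S := solvGens n) (n := n) fun _ h => y_mem_solvGens h
  have E0 := eSeq_zero (S := solvGens n) (n := n) (fun _ h => e_mem_solvGens h) hn
  have m1 := memE 1 le_rfl (by omega)
  have m2 := memE 2 (by omega) (by omega)
  have my := memY 0 (by omega)
  have eS0 : eSeq (solvGens n) 0 = vec (solvGens n) (.e 1) := by simp [eSeq]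
  have yS0 : ySeq (solvGens n) 0 = vec (solvGens n) (.y 1) := rfl
  have hnil : NilTable (extG n β γ b) n β γ (ySeq (solvGens n)) (eSeq (solvGens n)) (vec (solvGens n) (.e 2)) :=
    nilTable_ofTable (S := solvGens n) (fun _ h => Or.inr h) (fun _ h => e_mem_solvGens h)
      (fun _ h => y_mem_solvGens h) hn fun g hg h hh => by
        rw [xTable_nil hg hh, add_zero]
  refine ⟨hnil, vec_mem_spacePart rfl, ?_, ?_, ?_, ?_, ?_, ?_, ?_, ?_, ?_, ?_⟩
  · intro j u
    rcases Nat.lt_or_ge (j + 1 + 1) n with hj | hj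
    · refine space_le_of_vec_mem (P := LinearMap.ker ((extG n β γ b).mul.flip (ySeq (solvGens n) (j + 1))))
        (fun g hg => ?_) u
      rw [LinearMap.mem_ker, LinearMap.flip_apply, ySeq, hmul _ hg _ (memY _ hj)]
      cases g <;> simp [gTable, xTable]
    · rw [Y0 _ hj, map_zero]
  · intro j u
    rcases Nat.lt_or_ge (j + 1 + 1) n with hj | hj
    · refine space_le_of_vec_mem (P := LinearMap.ker ((extG n β γ b).mul.flip (eSeq (solvGens n) (j + 1))))
        (fun g hg => ?_) u
      rw [LinearMap.mem_ker, LinearMap.flip_apply, eSeq_succ,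
        hmul _ hg _ (memE _ (by omega) (by omega))]
      cases g <;> simp [gTable, xTable]
    · rw [E0 _ hj, map_zero]
  · intro j
    rcases Nat.lt_or_ge (j + 1) n with hj | hj
    · rw [ySeq, hmul _ (memY _ hj) _ mx]
      rw [gTable, xTable, zero_add]
      rw [if_pos (by omega)]
      push_cast
      module
    · rw [Y0 _ hj, map_zero, LinearMap.zero_apply, smul_zero]
  · intro j
    rcases Nat.lt_or_ge (j + 1) n with hj | hj
    · rcases j with _ | j
      · rw [eS0, hmul _ m1 _ mx]
        simp [gTable, xTable]
      · rw [eSeq_succ, hmul _ (memE _ (by omega) (by omega)) _ mx]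
        rw [gTable, xTable, zero_add]
        rw [if_neg (by omega), if_neg (by omega), if_pos (by omega)]
        push_cast
        module
    · rw [E0 _ hj, map_zero, LinearMap.zero_apply, smul_zero]
  · rw [hmul _ m2 _ mx]
    simp [gTable, xTable]
  · rw [hmul _ mx _ mx]
    simp [gTable, xTable]
  · rw [yS0, hmul _ mx _ my]
    simp [gTable, xTable]
  · rw [eS0, hmul _ mx _ m1]
    simp [gTable, xTable]
  · rw [hmul _ mx _ m2]
    rw [gTable, xTable, zero_add]
    rw [if_neg (by omega), if_pos rfl, zero_add]
    congr 2
    refine Finset.sum_congr rfl fun k hk => ?_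
    have := (Finset.mem_Icc.1 hk).1
    rw [eSeq_pos (by omega), show k - 3 + 2 = k - 1 by omega]
  · refine eq_top_iff.2 fun v _ => space_le_of_vec_mem (fun g hg => ?_) v
    rcases hg with rfl | ⟨i, h1, h2, rfl⟩ | ⟨i, h1, h2, rfl⟩
    · exact Submodule.mem_sup_left (Submodule.subset_span (Or.inr (Or.inr rfl)))
    · refine Submodule.mem_sup_left (Submodule.subset_span ?_)
      by_cases hi : i = 2
      · exact Or.inr (Or.inl (by rw [hi]))
      · refine Or.inl ⟨if i = 1 then 0 else i - 2, ?_⟩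
        split_ifs with h
        · simp [eSeq, h]
        · rw [eSeq_pos (by omega), Nat.sub_add_cancel (by omega)]
    · exact Submodule.mem_sup_right (Submodule.subset_span
        ⟨i - 1, by rw [ySeq, Nat.sub_add_cancel h1]⟩)

end Superalgebra

/-! ### The split case, the dimension count and the structure theorem. -/

namespace Superalgebra

theorem supported_graded {S : Set Gen} {T : Gen → Gen → Space S}
    {hT : ∀ g h, T g h ∈ spacePart S (g.parity + h.parity)} (P : Set S) :
    Finsupp.supported ℂ ℂ P = (Finsupp.supported ℂ ℂ P ⊓ (ofTable S T hT).part 0) ⊔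
      (Finsupp.supported ℂ ℂ P ⊓ (ofTable S T hT).part 1) := by
  change Finsupp.supported ℂ ℂ P = (Finsupp.supported ℂ ℂ P ⊓ spacePart S 0) ⊔
      (Finsupp.supported ℂ ℂ P ⊓ spacePart S 1)
  rw [spacePart, spacePart, ← Finsupp.supported_inter, ← Finsupp.supported_inter,
    ← Finsupp.supported_union, ← Set.inter_union_distrib_left]
  congr 1
  refine (Set.inter_eq_left.2 ?_).symm
  rintro ⟨g, hg⟩ -
  cases g
  · exact Or.inl rfl
  · exact Or.inr rfl
  · exact Or.inl rfl

theorem mem_of_vec_mul {S : Set Gen} (A : Superalgebra (Space S)) {P : Submodule ℂ (Space S)}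
    (h : ∀ g ∈ S, ∀ k ∈ S, A.mul (vec S g) (vec S k) ∈ P) (u v : Space S) : A.mul u v ∈ P :=
  space_le_of_vec_mem (P := P.comap (A.mul.flip v)) (fun g hg =>
    space_le_of_vec_mem (P := P.comap (A.mul (vec S g))) (fun k hk => h g hg k hk) v) u

/-- With all parameters zero, e_2 multiplies to zero on both sides and occurs in no product, so its
line and the span of the other basis vectors are complementary ideals. -/
theorem isSplit_superG {n : ℕ} (hn : 3 ≤ n) {β : ℕ → ℂ} (hβ : ∀ k, 4 ≤ k → k ≤ n → β k = 0) :
    (superG n β 0).IsSplit := by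
  have h2 : Gen.e 2 ∈ nilGens n := Or.inl ⟨2, by omega, by omega, rfl⟩
  have h1 : Gen.e 1 ∈ nilGens n := Or.inl ⟨1, by omega, by omega, rfl⟩
  set P : Set (nilGens n) := {s | s.1 = .e 2} with hP
  have memJ : ∀ g, g ≠ .e 2 → vec (nilGens n) g ∈ Finsupp.supported ℂ ℂ Pᶜ := fun g hg => by
    unfold vec
    split_ifs with h
    · exact Finsupp.single_mem_supported ℂ 1 hg
    · exact Submodule.zero_mem _
  have memI : ∀ v ∈ Finsupp.supported ℂ ℂ P, ∃ c : ℂ, v = c • vec (nilGens n) (.e 2) := by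
    intro v hv
    refine ⟨v ⟨.e 2, h2⟩, ?_⟩
    ext ⟨g, hg⟩
    rw [Finsupp.smul_apply, vec_apply]
    split_ifs with h
    · subst h; simp
    · have : (⟨g, hg⟩ : nilGens n) ∉ v.support := fun hs => h ((Finsupp.mem_supported ℂ v).1 hv hs).symm
      rw [Finsupp.notMem_support_iff.1 this, smul_zero]
  have hz : ∀ m ≤ n, ∀ f : ℕ → Space (nilGens n), ∑ k ∈ Finset.Icc 4 m, β k • f k = 0 :=
    fun m hm f => Finset.sum_eq_zero fun k hk => by
      obtain ⟨hk4, hkm⟩ := Finset.mem_Icc.1 hk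
      rw [hβ k hk4 (by omega), zero_smul]
  have hJ : ∀ u v, (superG n β 0).mul u v ∈ Finsupp.supported ℂ ℂ Pᶜ := by
    refine mem_of_vec_mul _ fun g hg k hk => ?_
    have e1 : (superG n β 0).mul (vec _ g) (vec _ k) = gTable _ n β 0 g k := ofTable_mul_vec hg hk
    have hm : ∀ (p : Prop) [Decidable p] (v : Space (nilGens n)),
        v ∈ Finsupp.supported ℂ ℂ Pᶜ → (if p then v else 0) ∈ Finsupp.supported ℂ ℂ Pᶜ := by
      intro p _ v hv
      split_ifs
      · exact hv
      · exact Submodule.zero_mem _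
    rw [e1]
    cases g with
    | x => exact Submodule.zero_mem _
    | e i =>
      cases k with
      | x => exact Submodule.zero_mem _
      | e j =>
        rw [gTable, zero_smul, hz n le_rfl]
        by_cases hi : 3 ≤ i
        · rw [hz (n + 2 - i) (by omega)]
          refine Submodule.add_mem _ (Submodule.add_mem _ (Submodule.add_mem _ (Submodule.add_mem _
            (hm _ _ (memJ _ (by simp))) (hm _ _ (memJ _ ?_))) (hm _ _ (Submodule.zero_mem _)))
            (hm _ _ (Submodule.zero_mem _))) (hm _ _ (Submodule.zero_mem _))
          simp; omega
        · rw [if_neg (by omega : ¬ (3 ≤ i ∧ i + 1 ≤ n ∧ j = 1)),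
            if_neg (by omega : ¬ (3 ≤ i ∧ i + 2 ≤ n ∧ j = 2))]
          refine Submodule.add_mem _ (Submodule.add_mem _ (Submodule.add_mem _ (Submodule.add_mem _
            (hm _ _ (memJ _ (by simp))) (Submodule.zero_mem _)) (hm _ _ (Submodule.zero_mem _)))
            (Submodule.zero_mem _)) (hm _ _ (Submodule.zero_mem _))
      | y j =>
        rw [gTable]
        exact Submodule.add_mem _ (hm _ _ (Submodule.smul_mem _ _ (memJ _ (by simp))))
          (hm _ _ (Submodule.smul_mem _ _ (memJ _ (by simp))))
    | y i =>
      cases k with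
      | x => exact Submodule.zero_mem _
      | e j =>
        rw [gTable]
        exact Submodule.add_mem _ (hm _ _ (memJ _ (by simp))) (hm _ _ (Submodule.sum_mem _ fun k _ =>
          Submodule.smul_mem _ _ (memJ _ (by simp))))
      | y j =>
        rw [gTable]
        by_cases hi : 2 ≤ i
        · refine Submodule.add_mem _ (hm _ _ (memJ _ (by simp))) (hm _ _ (memJ _ ?_))
          simp; omega
        · rw [if_neg (by omega : ¬ (2 ≤ i ∧ i + 1 ≤ n ∧ j = 1))]
          exact Submodule.add_mem _ (hm _ _ (memJ _ (by simp))) (Submodule.zero_mem _)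
  have hright : ∀ u, (superG n β 0).mul u (vec (nilGens n) (.e 2)) = 0 := fun u => by
    have := space_le_of_vec_mem
      (P := LinearMap.ker ((superG n β 0).mul.flip (vec (nilGens n) (.e 2)))) (fun g hg => ?_) u
    · exact this
    · rw [LinearMap.mem_ker, LinearMap.flip_apply]
      refine (ofTable_mul_vec hg h2).trans ?_
      cases g with
      | x => rfl
      | e i =>
        rw [gTable, hz n le_rfl]
        by_cases hi : 3 ≤ i
        · rw [hz (n + 2 - i) (by omega)]; simp
        · simp [hi]
      | y i =>
        rw [gTable]
        by_cases hi : 1 ≤ i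
        · rw [hz (n + 1 - i) (by omega)]; simp
        · simp [hi]
  have hleft : ∀ v, (superG n β 0).mul (vec (nilGens n) (.e 2)) v = 0 := fun v => by
    have := space_le_of_vec_mem
      (P := LinearMap.ker ((superG n β 0).mul (vec (nilGens n) (.e 2)))) (fun g hg => ?_) v
    · exact this
    · rw [LinearMap.mem_ker]
      refine (ofTable_mul_vec h2 hg).trans ?_
      cases g <;> simp [gTable]
  refine ⟨Finsupp.supported ℂ ℂ P, Finsupp.supported ℂ ℂ Pᶜ, ⟨supported_graded P, ?_, ?_⟩,
    ⟨supported_graded Pᶜ, fun u v _ => hJ u v, fun u v _ => hJ u v⟩, ?_, ?_, ?_, ?_⟩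
  · intro u v hv
    obtain ⟨c, rfl⟩ := memI v hv
    rw [map_smul, hright, smul_zero]
    exact Submodule.zero_mem _
  · intro u v hu
    obtain ⟨c, rfl⟩ := memI u hu
    rw [map_smul, LinearMap.smul_apply, hleft, smul_zero]
    exact Submodule.zero_mem _
  · rw [Submodule.ne_bot_iff]
    exact ⟨Finsupp.single ⟨.e 2, h2⟩ 1, Finsupp.single_mem_supported ℂ 1 rfl, by simp⟩
  · rw [Submodule.ne_bot_iff]
    exact ⟨Finsupp.single ⟨.e 1, h1⟩ 1, Finsupp.single_mem_supported ℂ 1 (by simp [hP]), by simp⟩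
  · exact Finsupp.disjoint_supported_supported disjoint_compl_right
  · exact Finsupp.codisjoint_supported_supported (by rw [codisjoint_iff]; simp)

theorem finite_nilGens (n : ℕ) : (nilGens n).Finite := by
  refine (((Set.finite_Iic n).image Gen.e).union ((Set.finite_Iic n).image Gen.y)).subset ?_
  rintro _ (⟨i, h1, h2, rfl⟩ | ⟨i, h1, h2, rfl⟩)
  · exact Or.inl ⟨i, h2, rfl⟩
  · exact Or.inr ⟨i, Set.mem_Iic.2 (by omega), rfl⟩

theorem finrank_space {S : Set Gen} (hS : S.Finite) : Module.finrank ℂ (Space S) = S.ncard := by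
  have := hS.fintype
  rw [Module.finrank_finsupp_self, ← Set.toFinset_card, Set.ncard_eq_toFinset_card']

theorem finrank_solv (n : ℕ) :
    Module.finrank ℂ (Space (solvGens n)) = Module.finrank ℂ (Space (nilGens n)) + 1 := by
  rw [finrank_space (finite_nilGens n),
    finrank_space (S := solvGens n) ((finite_nilGens n).insert _), solvGens,
    Set.ncard_insert_of_notMem _ (finite_nilGens n)]
  rintro (⟨i, -, -, h⟩ | ⟨i, -, -, h⟩) <;> cases h

/-- A superalgebra with the multiplication table and the dimension of `extG` is isomorphic to it. -/
theorem SolvTable.isomorphic_extG {V : Type*} [AddCommGroup V] [Module ℂ V] [FiniteDimensional ℂ V]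
    {L : Superalgebra V} {n : ℕ} (hn : 3 ≤ n) {β : ℕ → ℂ} {γ b : ℂ} {Y E : ℕ → V} {e x : V}
    (T : SolvTable L n β γ b Y E e x)
    (hdim : Module.finrank ℂ (Space (solvGens n)) ≤ Module.finrank ℂ V) :
    L.Isomorphic (extG n β γ b) := by
  have : Finite (solvGens n) := ((finite_nilGens n).insert Gen.x).to_subtype
  let im : Gen → V
    | .e i => if i = 1 then E 0 else if i = 2 then e else E (i - 2)
    | .y j => Y (j - 1)
    | .x => x
  let G : Space (solvGens n) →ₗ[ℂ] V := Finsupp.linearCombination ℂ fun g : solvGens n => im g.1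
  have hG : ∀ g ∈ solvGens n, G (vec _ g) = im g := fun g hg => by
    unfold vec
    rw [dif_pos hg]
    simp [G]
  have hGY : ∀ j, G (ySeq _ j) = Y j := fun j => by
    rcases Nat.lt_or_ge (j + 1) n with hj | hj
    · exact hG _ (Or.inr (Or.inr ⟨j + 1, by omega, by omega, rfl⟩))
    · rw [T.Y_zero j hj, ySeq_zero (fun _ h => y_mem_solvGens h) j hj, map_zero]
  have hGE : ∀ j, G (eSeq _ j) = E j := fun j => by
    rcases Nat.lt_or_ge (j + 1) n with hj | hj
    · rcases j with _ | j
      · exact hG _ (Or.inr (Or.inl ⟨1, by omega, by omega, rfl⟩))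
      · rw [eSeq_succ, hG _ (Or.inr (Or.inl ⟨j + 3, by omega, by omega, rfl⟩))]
        simp [im]
    · rw [T.E_zero j hj, eSeq_zero (fun _ h => e_mem_solvGens h) hn j hj, map_zero]
  have hGe : G (vec _ (.e 2)) = e := hG _ (Or.inr (Or.inl ⟨2, by omega, by omega, rfl⟩))
  have hGx : G (vec _ .x) = x := hG _ (Or.inl rfl)
  -- The table gives only spanning, hence surjectivity; the bound on dimensions supplies
  -- injectivity.
  have hsurj : Function.Surjective G := fun v =>
    T.le_of_mem (S := LinearMap.range G) (fun j => ⟨_, hGY j⟩) (fun j => ⟨_, hGE j⟩) ⟨_, hGe⟩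
      ⟨_, hGx⟩ v
  have hle := LinearMap.finrank_le_finrank_of_surjective hsurj
  have hinj : Function.Injective G :=
    (LinearMap.injective_iff_surjective_of_finrank_eq_finrank (le_antisymm hdim hle)).2 hsurj
  let f := LinearEquiv.ofBijective G ⟨hinj, hsurj⟩
  refine T.isomorphic (solvTable_extG hn β γ b) f.symm ?_ ?_ ?_ ?_
  · exact fun j => (LinearEquiv.symm_apply_eq _).2 (hGY j).symm
  · exact fun j => (LinearEquiv.symm_apply_eq _).2 (hGE j).symm
  · exact (LinearEquiv.symm_apply_eq _).2 hGe.symm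
  · exact (LinearEquiv.symm_apply_eq _).2 hGx.symm

theorem SolvFrame.change_scale {V : Type*} [AddCommGroup V] [Module ℂ V] {L : Superalgebra V}
    {N : Submodule ℂ V} {m : ℕ} {p : ℂ[X]} {γ b : ℂ} {y e x : V} (F : SolvFrame L N m p γ b y e x)
    {s : ℂ} (hs : s ≠ 0) : SolvFrame L N m (C s * p) (s ^ 2 * γ) b y (s • e) x := by
  refine ⟨F.toNilFrame.change_scale hs, F.mul_mem, F.top_form, F.x_even, F.yx, ?_, F.xx, F.xy, ?_⟩
  · rw [map_smul, LinearMap.smul_apply, F.ex, smul_comm]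
  · rw [map_smul, F.xe, divX_C_mul, aeval_C_mul_apply]
    module

/-- The structure theorem: the solvable extension has the form `extG`. -/
theorem exists_isomorphic_extG {V : Type*} [AddCommGroup V] [Module ℂ V] [FiniteDimensional ℂ V]
    {n : ℕ} (hn : 3 ≤ n) {L : Superalgebra V} {N : Submodule ℂ V} {β : ℕ → ℂ} {γ : ℂ}
    (hL : L.IsLeibniz) (hnil : ¬ L.IsNilpotent ⊤) (hN : L.IsNilradical N)
    (hsplit : ¬ (superG n β γ).IsSplit) (hiso : L.IdealIsomorphic N (superG n β γ)) :
    ((∃ k, 4 ≤ k ∧ k ≤ n ∧ β k ≠ 0) ∨ γ ≠ 0) ∧ ∃ b : ℂ,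
      (∀ k, 4 ≤ k → k ≤ n → b * β k = 2 * ((k : ℂ) - 2) * β k) ∧ b * γ = ((n : ℂ) - 1) * γ ∧
      ∀ (s : ℂ) (β' : ℕ → ℂ), s ≠ 0 → (∀ k, 4 ≤ k → k ≤ n → β' k = s * β k) →
        L.Isomorphic (extG n β' (s ^ 2 * γ) b) := by
  have hns : (∃ k, 4 ≤ k ∧ k ≤ n ∧ β k ≠ 0) ∨ γ ≠ 0 := by
    by_contra! hcon
    obtain ⟨h1, rfl⟩ := hcon
    exact hsplit (isSplit_superG hn h1)
  refine ⟨hns, ?_⟩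
  have hcoeff : ∀ k, 4 ≤ k → k ≤ n → (betaPoly n β).coeff (k - 2) = β k := fun k h4 hk => by
    rw [coeff_betaPoly, if_pos (by omega), Nat.sub_add_cancel (by omega)]
  have hns' : (∃ j < n - 1, (betaPoly n β).coeff j ≠ 0) ∨ γ ≠ 0 := by
    refine hns.imp_left ?_
    rintro ⟨k, h4, hk, h0⟩
    exact ⟨k - 2, by omega, by rwa [hcoeff k h4 hk]⟩
  obtain ⟨f, hfp, hfm⟩ := hiso
  set F : Space (nilGens n) →ₗ[ℂ] V := N.subtype ∘ₗ f.toLinearMap with hF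
  have hFinj : Function.Injective F := N.injective_subtype.comp f.injective
  have T := (nilTable_superG hn β γ).map (B := L) F (fun a v hv => hfp a v hv)
    fun u v => hfm u v
  have hspan : N = Submodule.span ℂ (Set.range (fun j => F (ySeq (nilGens n) j)) ∪
      Set.range (fun j => F (eSeq (nilGens n) j)) ∪ {F (vec (nilGens n) (.e 2))}) := by
    have h1 := congrArg (Submodule.map F) (span_superG (n := n))
    rw [Submodule.map_span, Submodule.map_top, Set.image_union, Set.image_union,
      Set.image_singleton, ← Set.range_comp, ← Set.range_comp] at h1
    have h2 : LinearMap.range F = N := by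
      rw [hF, LinearMap.range_comp, LinearEquiv.range, Submodule.map_top, Submodule.range_subtype]
    exact h2.symm.trans h1.symm
  have H := T.nilFrame hn ((tableIndep_vec subset_rfl hn).map hFinj) hspan
  obtain ⟨b, y, e, x, S, hp, hγ⟩ := H.exists_solvFrame hL hN hnil hns'
    (by rw [coeff_betaPoly, if_neg (by omega)])
  refine ⟨b, fun k h4 hk => ?_, ?_, fun s β' hs hβ' => ?_⟩
  · have := hp (k - 2) (by omega)
    rw [hcoeff k h4 hk] at this
    rw [this]
    push_cast [show 2 ≤ k by omega]
    ring
  · rw [hγ]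
    push_cast [show 1 ≤ n by omega]
    ring
  · have hpoly : C s * betaPoly n β = betaPoly n β' := by
      rw [betaPoly, betaPoly, Finset.mul_sum]
      refine Finset.sum_congr rfl fun k hk => ?_
      obtain ⟨h4, hk⟩ := Finset.mem_Icc.1 hk
      rw [hβ' k h4 hk, C_mul, mul_assoc]
    have S' := S.change_scale hs
    rw [hpoly] at S'
    refine (S'.solvTable hL hn).isomorphic_extG hn ?_
    rw [finrank_solv, f.finrank_eq]
    -- N is proper because it is nilpotent and L is not; this supplies the one extra dimension.
    refine Submodule.finrank_lt ?_
    rintro rfl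
    exact hnil hN.isNilpotent

/-- The parameters of isomorphic superalgebras `extG` agree up to the action of the torus. -/
theorem extG_param_eq {n : ℕ} (hn : 3 ≤ n) {β β' : ℕ → ℂ} {γ γ' b b' : ℂ} (hb : b ≠ 0)
    (hL : (extG n β' γ' b').IsLeibniz) (hiso : (extG n β γ b).Isomorphic (extG n β' γ' b')) :
    b = b' ∧ ∃ u d : ℂ, u ≠ 0 ∧ d ≠ 0 ∧
      (∀ k, 4 ≤ k → k ≤ n → β k * u ^ (k - 2) = d * β' k) ∧ γ * u ^ (n - 1) = d ^ 2 * γ' := by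
  obtain ⟨f, hfp, hfm⟩ := hiso
  have hind := tableIndep_vec (S := solvGens n) (fun _ h => Or.inr h) hn
  have F := ((solvTable_extG hn β γ b).map f hfp hfm).solvFrame hn
    (hind.map (F := f.toLinearMap) f.injective)
  have F' := (solvTable_extG hn β' γ' b').solvFrame hn hind
  obtain ⟨h1, u, d, hu, hd, hp, hγ⟩ := SolvFrame.param_eq hL F F' hb
  refine ⟨h1, u, d, hu, hd, fun k h4 hk => ?_, hγ⟩
  have := hp (k - 2) (by omega)
  rwa [coeff_betaPoly, coeff_betaPoly, if_pos (by omega), if_pos (by omega),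
    Nat.sub_add_cancel (by omega)] at this

/-! ### The list: Leibniz identity, non-isomorphism and completeness. -/

theorem isLeibniz_alg {n : ℕ} (hn : 3 ≤ n) (s : SGEntry) (hs : s.Admissible n) :
    (s.alg n).IsLeibniz := by
  cases s with
  | sg₁ t =>
    refine (solvTable_extG hn _ _ _).isLeibniz hn (fun k _ _ => ?_) (by simp)
    by_cases hk : k = t
    · subst hk; rfl
    · rw [Pi.single_eq_of_ne hk]; simp
  | sg₂ γ =>
    refine (solvTable_extG hn _ _ _).isLeibniz hn (fun k _ _ => ?_) rfl
    obtain ⟨⟨r, rfl⟩, h5, -⟩ := hs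
    by_cases hk : k = (2 * r + 1 + 3) / 2
    · have : k = r + 2 := by omega
      rw [← hk, this]
      push_cast
      ring
    · rw [Pi.single_eq_of_ne hk]; simp
  | sg₃ => exact (solvTable_extG hn _ _ _).isLeibniz hn (fun k _ _ => by simp) rfl

/-- The weight b recovers t; vanishing of γ separates `sg₁` from the others, and vanishing of β
separates `sg₃` from `sg₂`. -/
theorem alg_injective {n : ℕ} (hn : 3 ≤ n) (s s' : SGEntry) (hs : s.Admissible n)
    (hs' : s'.Admissible n) (hiso : (s.alg n).Isomorphic (s'.alg n)) : s = s' := by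
  have hL := isLeibniz_alg hn s' hs'
  have hn1 : (n : ℂ) - 1 ≠ 0 := by
    intro h
    have h2 : (n : ℂ) = (1 : ℕ) := by push_cast; linear_combination h
    have := Nat.cast_injective h2
    omega
  have ht2 : ∀ t : ℕ, 4 ≤ t → 2 * ((t : ℂ) - 2) ≠ 0 := by
    intro t ht h
    have h2 : (t : ℂ) = (2 : ℕ) := by push_cast; linear_combination h / 2
    have := Nat.cast_injective h2
    omega
  cases s with
  | sg₁ t =>
    obtain ⟨h4, htn⟩ := hs
    cases s' with
    | sg₁ t' =>
      obtain ⟨hb, -⟩ := extG_param_eq hn (ht2 t h4) hL hiso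
      have h2 : (t : ℂ) = (t' : ℂ) := by linear_combination hb / 2
      rw [Nat.cast_injective h2]
    | sg₂ γ =>
      obtain ⟨-, u, d, hu, hd, -, hγ⟩ := extG_param_eq hn (ht2 t h4) hL hiso
      rw [zero_mul] at hγ
      exact absurd hγ.symm (mul_ne_zero (pow_ne_zero 2 hd) hs'.2.2)
    | sg₃ =>
      obtain ⟨-, u, d, hu, hd, -, hγ⟩ := extG_param_eq hn (ht2 t h4) hL hiso
      rw [zero_mul] at hγ
      exact absurd hγ.symm (mul_ne_zero (pow_ne_zero 2 hd) one_ne_zero)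
  | sg₂ γ =>
    obtain ⟨⟨r, rfl⟩, h5, hγ0⟩ := hs
    have hr : (2 * r + 1 + 3) / 2 = r + 2 := by omega
    cases s' with
    | sg₁ t' =>
      obtain ⟨-, u, d, hu, hd, -, hγ⟩ := extG_param_eq hn hn1 hL hiso
      rw [mul_zero] at hγ
      exact absurd hγ (mul_ne_zero hγ0 (pow_ne_zero _ hu))
    | sg₂ γ' =>
      obtain ⟨-, u, d, hu, hd, hβ, hγ⟩ := extG_param_eq hn hn1 hL hiso
      have h1 := hβ (r + 2) (by omega) (by omega)
      rw [hr, Pi.single_eq_same, one_mul, mul_one, Nat.add_sub_cancel] at h1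
      -- With n = 2r+1 and t = r+2, u^(n-1) = (u^(t-2))² = d², so the torus cannot move γ.
      rw [Nat.add_sub_cancel, mul_comm 2 r, pow_mul, h1, mul_comm] at hγ
      rw [mul_left_cancel₀ (pow_ne_zero 2 hd) hγ]
    | sg₃ =>
      obtain ⟨-, u, d, hu, hd, hβ, hγ⟩ := extG_param_eq hn hn1 hL hiso
      have h1 := hβ (r + 2) (by omega) (by omega)
      rw [hr, Pi.single_eq_same, one_mul, Pi.zero_apply, mul_zero] at h1
      exact absurd h1 (pow_ne_zero _ hu)
  | sg₃ =>
    cases s' with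
    | sg₁ t' =>
      obtain ⟨-, u, d, hu, hd, -, hγ⟩ := extG_param_eq hn hn1 hL hiso
      rw [mul_zero, one_mul] at hγ
      exact absurd hγ (pow_ne_zero _ hu)
    | sg₂ γ' =>
      obtain ⟨⟨r, rfl⟩, h5, hγ0⟩ := hs'
      have hr : (2 * r + 1 + 3) / 2 = r + 2 := by omega
      obtain ⟨-, u, d, hu, hd, hβ, hγ⟩ := extG_param_eq hn hn1 hL hiso
      have h1 := hβ (r + 2) (by omega) (by omega)
      rw [hr, Pi.single_eq_same, mul_one, Pi.zero_apply, zero_mul] at h1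
      exact absurd h1.symm hd
    | sg₃ => rfl

/-- Each nonzero β_k determines b = 2(k-2), so at most one is nonzero and rescaling e makes it 1. -/
theorem exists_isomorphic_alg {V : Type*} [AddCommGroup V] [Module ℂ V] [FiniteDimensional ℂ V]
    {n : ℕ} (hn : 3 ≤ n) {L : Superalgebra V} {N : Submodule ℂ V} {β : ℕ → ℂ} {γ : ℂ}
    (hL : L.IsLeibniz) (hnil : ¬ L.IsNilpotent ⊤) (hN : L.IsNilradical N)
    (hsplit : ¬ (superG n β γ).IsSplit) (hiso : L.IdealIsomorphic N (superG n β γ)) :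
    ∃ s : SGEntry, s.Admissible n ∧ L.Isomorphic (s.alg n) := by
  obtain ⟨hns, b, hβ, hγ, hext⟩ := exists_isomorphic_extG hn hL hnil hN hsplit hiso
  by_cases hex : ∃ t, 4 ≤ t ∧ t ≤ n ∧ β t ≠ 0
  · obtain ⟨t, h4, htn, ht⟩ := hex
    have hb : b = 2 * ((t : ℂ) - 2) := mul_right_cancel₀ ht (hβ t h4 htn)
    have hsingle : ∀ k, 4 ≤ k → k ≤ n →
        (Pi.single t 1 : ℕ → ℂ) k = (β t)⁻¹ * β k := by
      intro k hk4 hkn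
      by_cases hk : k = t
      · rw [hk, Pi.single_eq_same, inv_mul_cancel₀ ht]
      · rw [Pi.single_eq_of_ne hk]
        by_cases h0 : β k = 0
        · rw [h0, mul_zero]
        · have h1 := mul_right_cancel₀ h0 (hβ k hk4 hkn)
          rw [hb] at h1
          have h2 : (k : ℂ) = (t : ℂ) := by linear_combination -h1 / 2
          exact absurd (Nat.cast_injective h2) hk
    have hi := hext _ _ (inv_ne_zero ht) hsingle
    by_cases hγ0 : γ = 0
    · refine ⟨.sg₁ t, ⟨h4, htn⟩, ?_⟩
      rwa [hγ0, mul_zero, hb] at hi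
    · have hbn : b = (n : ℂ) - 1 := mul_right_cancel₀ hγ0 hγ
      have h1 : ((2 * t : ℕ) : ℂ) = ((n + 3 : ℕ) : ℂ) := by
        push_cast
        linear_combination hbn - hb
      -- Both weight equations hold, so 2(t-2) = n-1; hence n is odd, and t ≥ 4 gives n ≥ 5.
      have h2 : 2 * t = n + 3 := Nat.cast_injective h1
      refine ⟨.sg₂ ((β t)⁻¹ ^ 2 * γ), ⟨⟨t - 2, by omega⟩, by omega,
        mul_ne_zero (pow_ne_zero 2 (inv_ne_zero ht)) hγ0⟩, ?_⟩
      rw [hbn, show t = (n + 3) / 2 by omega] at hi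
      rw [show t = (n + 3) / 2 by omega]
      exact hi
  · have hγ0 : γ ≠ 0 := hns.resolve_left hex
    have hbn : b = (n : ℂ) - 1 := mul_right_cancel₀ hγ0 hγ
    push Not at hex
    -- Scaling e by s multiplies γ by s², so a square root of γ⁻¹ normalises γ to 1.
    obtain ⟨s, hs⟩ := IsAlgClosed.exists_pow_nat_eq γ⁻¹ (n := 2) two_pos
    have hs0 : s ≠ 0 := by
      rintro rfl
      exact inv_ne_zero hγ0 (by rw [← hs]; simp)
    have hi := hext s 0 hs0 fun k h4 hk => by rw [hex k h4 hk, mul_zero, Pi.zero_apply]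
    rw [hs, inv_mul_cancel₀ hγ0, hbn] at hi
    exact ⟨.sg₃, trivial, hi⟩

end Superalgebra

/-- Let `n ≥ 3`.
* Every finite-dimensional non-nilpotent solvable Leibniz superalgebra whose nilradical is
  isomorphic to a non-split superalgebra `G(β₄, …, βₙ, γ)` is isomorphic to a superalgebra of the
  list `SG₁(t)`, `SG₂(γ)`, `SG₃`.
* The superalgebras of the list are Leibniz superalgebras.
* They are pairwise non-isomorphic. -/
theorem mainTheorem4 (n : ℕ) (hn : 3 ≤ n) :
    (∀ (V : Type*) [AddCommGroup V] [Module ℂ V] [FiniteDimensional ℂ V]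
      (L : Superalgebra V) (N : Submodule ℂ V) (β : ℕ → ℂ) (γ : ℂ),
      L.IsLeibniz → L.IsSolvable → ¬ L.IsNilpotent ⊤ →
      L.IsNilradical N → ¬ (superG n β γ).IsSplit → L.IdealIsomorphic N (superG n β γ) →
      ∃ s : SGEntry, s.Admissible n ∧ L.Isomorphic (s.alg n)) ∧
    (∀ s : SGEntry, s.Admissible n → (s.alg n).IsLeibniz) ∧
    (∀ s s' : SGEntry, s.Admissible n → s'.Admissible n →
      (s.alg n).Isomorphic (s'.alg n) → s = s') :=
  ⟨fun _ _ _ _ _ _ _ _ hL _ hnil hN hsplit hiso =>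
    Superalgebra.exists_isomorphic_alg hn hL hnil hN hsplit hiso,
    fun s hs => Superalgebra.isLeibniz_alg hn s hs,
    fun s s' hs hs' => Superalgebra.alg_injective hn s s' hs hs'⟩
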